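/- Let $V$ be a vertex operator algebra over $\mathbb C$, and let $\mathcal D$ be one of the following two categories of weak $V$-modules: $\mathcal C(V)$, whose objects are the weak modules on which $L(0)$ is semisimple with finite-dimensional eigenspaces $W_h$ such that, for each $h\in\mathbb C$, $W_{h+n}=0$ for $n\in\mathbb Z$ sufficiently small; or $\mathcal C^1(V)$, whose objects are the weak modules on which $L(0)$ is locally finite and whose generalized weights lie in $\bigcup_{i=1}^n(h_i+\mathbb Z_{\ge0})$ for finitely many $h_i\in\mathbb C$. For $W$ in $\mathcal D$ let $W_h$ be the generalized eigenspace of $L(0)$ with generalized weight $h$, and let $W'=\bigoplus_h (W_h)^*$ be the restricted dual. An element of some $W_h$ is called homogeneous, with $\mathrm{gwt}=h$; an element of some $(W_h)^*$ is also called homogeneous. An intertwining operator of type $\binom{U_3}{U_1\,U_2}$ is a linear map $w\mapsto I(w,z)=\sum_{n\in\mathbb C}w_nz^{-n-1}$ from $U_1$ to $\mathrm{Hom}(U_2,U_3)\{z\}$ such that, for $w\in U_1$, $u\in U_2$, $\alpha\in\mathbb C$, $w_{\alpha+n}u=0$ for $n\in\mathbb Z$ sufficiently large, $I(L(-1)w,z)=\frac{d}{dz}I(w,z)$,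 and the Jacobi identity holds. Let $W_1,W_2,W_3,W_4$ be objects of $\mathcal D$ and $W_5$ a weak $V$-module, and let $\mathcal Y_1,\mathcal Y_2$ be intertwining operators of types $\binom{W_4}{W_1\,W_5}$ and $\binom{W_5}{W_2\,W_3}$ with the convergence and extension property: there is an integer $N$ such that for all homogeneous $w_i\in W_i$ $(i=1,2,3)$ and $w_4'\in W_4'$ there are $k\in\mathbb N$, $r_i,s_i\in\mathbb C$ and analytic functions $f_i$ on $|z|<1$ $(1\le i\le k)$ with $\mathrm{Re}(\mathrm{gwt}\,w_1+\mathrm{gwt}\,w_2+s_i)>N$, such that $\langle w_4',\mathcal Y_1(w_1,z_1)\mathcal Y_2(w_2,z_2)w_3\rangle$ converges absolutely for $|z_1|>|z_2|>0$ (on all branches of the logarithms of $z_1,z_2$) and is extended analytically by $$\sum_{i=1}^k z_2^{r_i}(z_1-z_2)^{s_i}f_i\!\left(\tfrac{z_1-z_2}{z_2}\right)\qquad(|z_2|>|z_1-z_2|>0),$$ where on the overlap $|z_1|>|z_2|>|z_1-z_2|>0$ the branches are $\log z_1=\log z_2+\log\frac{z_1}{z_2}$ and $\log(z_1-z_2)=\log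 z_2+\log\frac{z_1-z_2}{z_2}$, with principal logarithms of the two quotients. For any formal series $c(z_1,z_2)$ (complex exponents) that converges and has an extension of this form, without the condition involving $N$, write $E_{12}c(z_1,z_2)|_{z_1=z_0+z_2}$ for the formal series $\sum_i z_2^{r_i}z_0^{s_i}f_i(z_0/z_2)$ in $z_0,z_2$, with $f_i$ replaced by its Taylor series at $0$. For $w_1\in W_1$, $w_2\in W_2$ define $\psi(w_1,w_2;z_0,z_2)=\sum_{n\in\mathbb C}\psi_n(w_1,w_2,z_2)z_0^{-n-1}$ by $$\langle w_4',\psi(w_1,w_2;z_0,z_2)w_3\rangle=E_{12}\langle w_4',\mathcal Y_1(w_1,z_1)\mathcal Y_2(w_2,z_2)w_3\rangle|_{z_1=z_0+z_2}\qquad(w_3\in W_3,\ w_4'\in W_4').$$ Let $W$ be the linear span of all the $\psi_n(w_1,w_2,z_2)$ in $\mathrm{Hom}(W_3,W_4)\{z_2\}$. A generalized left intertwining operator from $W_3$ to $W_4$ is a series $\Phi(z)=\sum_{n\in\mathbb C}\Phi_nz^{-n-1}$ with $\Phi_n\in\mathrm{Hom}(W_3,W_4)$ such that for all $\alpha\in\mathbb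 C$, $u\in W_3$, $\Phi_{\alpha+n}u=0$ for $n\in\mathbb Z$ sufficiently large, $[L(-1),\Phi(z)]=\Phi'(z)$, and for each $a\in V$ there is a positive integer $k$ with $(z_1-z_2)^kY(a,z_1)\Phi(z_2)=(z_1-z_2)^k\Phi(z_2)Y(a,z_1)$. It is homogeneous of generalized weight $h$ if $\Phi_n((W_3)_{h_1})\subseteq(W_4)_{h_1+h-n-1}$ for all $n,h_1\in\mathbb C$. Let $G_l^o(W_3,W_4)$ be the sum over $h\in\mathbb C$ of the spaces of generalized left intertwining operators homogeneous of generalized weight $h$. Then all the $\psi_n(w_1,w_2,z_2)$ exist, $W\subseteq G_l^o(W_3,W_4)$, and $W$ is a weak $V$-module under the action $$a_m\circ_l\Phi(z_2)=\mathrm{Res}_{z_1}\big((z_1-z_2)^mY(a,z_1)\Phi(z_2)-(-z_2+z_1)^m\Phi(z_2)Y(a,z_1)\big)\qquad(a\in V,\ m\in\mathbb Z).$$ Moreover there are intertwining operators $\mathcal Y_3$ of type $\binom{W}{W_1\,W_2}$ and $\mathcal Y_4$ of type $\binom{W_4}{W\,W_3}$, given by $\mathcal Y_3(w_1,z_0)w_2=\sum_n\psi_n(w_1,w_2,\cdot)z_0^{-n-1}$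 and $\mathcal Y_4(\Phi,z_2)w_3=\Phi(z_2)w_3$, such that for all $w_i\in W_i$ $(i=1,2,3)$ and $w_4'\in W_4'$ the product $\langle w_4',\mathcal Y_1(w_1,z_1)\mathcal Y_2(w_2,z_2)w_3\rangle$ converges and has an extension of the above form, and $$E_{12}\langle w_4',\mathcal Y_1(w_1,z_1)\mathcal Y_2(w_2,z_2)w_3\rangle|_{z_1=z_0+z_2}=\langle w_4',\mathcal Y_4(\mathcal Y_3(w_1,z_0)w_2,z_2)w_3\rangle .$$ -/

import Mathlib

open scoped BigOperators

noncomputable section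

namespace VertexAssoc

/-! Formal series are recorded by their modes: `Y(a,z) = ∑ a_n z^{-n-1}`, with `n ∈ ℤ` for the
vertex operators of a module and `n ∈ ℂ` for intertwining operators. -/

section Jacobi

variable {V U₁ U₂ U₃ : Type*} [AddCommGroup V] [Module ℂ V] [AddCommGroup U₁] [Module ℂ U₁]
  [AddCommGroup U₂] [Module ℂ U₂] [AddCommGroup U₃] [Module ℂ U₃]

/-- The Jacobi identity
`z₀⁻¹δ((z₁-z₂)/z₀) Y(a,z₁)I(b,z₂)u - z₀⁻¹δ((z₂-z₁)/(-z₀)) I(b,z₂)Y(a,z₁)u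
  = z₂⁻¹δ((z₁-z₀)/z₂) I(Y(a,z₀)b,z₂)u`,
written as the equality of the coefficients of `z₀^{-l-1} z₁^{-m-1} z₂^{-n-1}`. The modes of `I` are
indexed by `Γ` (`ℤ` or `ℂ`). All sums are finite by the truncation conditions. -/
def JacobiIdentity {Γ : Type*} [AddCommGroupWithOne Γ]
    (Y₁ : V →ₗ[ℂ] VertexOperator ℂ U₁) (Y₂ : V →ₗ[ℂ] VertexOperator ℂ U₂)
    (Y₃ : V →ₗ[ℂ] VertexOperator ℂ U₃) (I : Γ → U₁ → U₂ → U₃) : Prop :=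
  ∀ (a : V) (b : U₁) (u : U₂) (l m : ℤ) (n : Γ),
    ∑ᶠ i : ℕ, ((-1 : ℤ) ^ i * Ring.choose l i) •
        ((Y₃ a).ncoeff (m + l - i) (I (n + (i : Γ)) b u)
          - (l.negOnePow : ℤ) • I (n + (l : Γ) - (i : Γ)) b ((Y₂ a).ncoeff (m + i) u))
      = ∑ᶠ i : ℕ, Ring.choose m i • I ((m : Γ) + n - (i : Γ)) ((Y₁ a).ncoeff (l + i) b) u

end Jacobi

/-- A vertex operator algebra over `ℂ`. The homogeneous subspace `V_(n)`, `n ∈ ℤ`, is the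
`n`-eigenspace of `L(0)`; these subspaces are automatically independent. -/
structure VertexOperatorAlgebra (V : Type*) [AddCommGroup V] [Module ℂ V] where
  /-- `Y(a,z)`; truncation is part of the notion of `VertexOperator`. -/
  Y : V →ₗ[ℂ] VertexOperator ℂ V
  /-- The vacuum vector. -/
  vacuum : V
  /-- The Virasoro element; `L(n)` is `ω_{n+1}`. -/
  omega : V
  centralCharge : ℂ
  vacuum_mode : ∀ n : ℤ, (Y vacuum).ncoeff n = if n = -1 then 1 else 0
  creation : ∀ a : V, (Y a).ncoeff (-1) vacuum = a
  creation_nonneg : ∀ (a : V) (n : ℤ), 0 ≤ n → (Y a).ncoeff n vacuum = 0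
  jacobi : JacobiIdentity Y Y Y (fun (n : ℤ) b u => (Y b).ncoeff n u)
  virasoro : ∀ m n : ℤ,
    (Y omega).ncoeff (m + 1) * (Y omega).ncoeff (n + 1)
        - (Y omega).ncoeff (n + 1) * (Y omega).ncoeff (m + 1)
      = ((m : ℂ) - n) • (Y omega).ncoeff (m + n + 1)
        + (if m + n = 0 then ((m : ℂ) ^ 3 - m) / 12 * centralCharge else 0) • 1
  derivative : ∀ (a : V) (n : ℤ),
    (Y ((Y omega).ncoeff 0 a)).ncoeff n = (-(n : ℂ)) • (Y a).ncoeff (n - 1)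
  grading : ⨆ n : ℤ, ((Y omega).ncoeff 1).eigenspace (n : ℂ) = ⊤
  finite_dimensional : ∀ n : ℤ,
    FiniteDimensional ℂ (((Y omega).ncoeff 1).eigenspace (n : ℂ))
  bounded_below : ∃ N : ℤ, ∀ n : ℤ, n < N → ((Y omega).ncoeff 1).eigenspace (n : ℂ) = ⊥

section Modules

variable {V : Type*} [AddCommGroup V] [Module ℂ V]

/-- The structure of a weak module over the vertex operator algebra `A` on the space `W`. -/
structure WeakModule (A : VertexOperatorAlgebra V) (W : Type*) [AddCommGroup W] [Module ℂ W] where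
  Y : V →ₗ[ℂ] VertexOperator ℂ W
  vacuum_mode : ∀ n : ℤ, (Y A.vacuum).ncoeff n = if n = -1 then 1 else 0
  derivative : ∀ (a : V) (n : ℤ),
    (Y ((A.Y A.omega).ncoeff 0 a)).ncoeff n = (-(n : ℂ)) • (Y a).ncoeff (n - 1)
  jacobi : JacobiIdentity A.Y Y Y (fun (n : ℤ) b u => (Y b).ncoeff n u)

variable {A : VertexOperatorAlgebra V}

section OneModule

variable {W : Type*} [AddCommGroup W] [Module ℂ W] (M : WeakModule A W)

/-- The mode `a_n` acting on a weak module. -/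
def WeakModule.mode (a : V) (n : ℤ) : Module.End ℂ W := (M.Y a).ncoeff n

/-- `L(n) = ω_{n+1}` acting on a weak module. -/
def WeakModule.L (n : ℤ) : Module.End ℂ W := M.mode A.omega (n + 1)

/-- The generalized eigenspace of `L(0)` for the generalized weight `h`. -/
def WeakModule.weightSpace (h : ℂ) : Submodule ℂ W := (M.L 0).maxGenEigenspace h

/-- Membership in the category `C(V)` of (ordinary) modules: `L(0)` is semisimple, with
finite-dimensional eigenspaces which vanish far down in each coset of `ℤ`. -/
def WeakModule.IsOrdinary : Prop :=
  (⨆ h : ℂ, (M.L 0).eigenspace h = ⊤) ∧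
  (∀ h : ℂ, FiniteDimensional ℂ ((M.L 0).eigenspace h)) ∧
  ∀ h : ℂ, ∃ N : ℤ, ∀ n : ℤ, n < N → (M.L 0).eigenspace (h + n) = ⊥

/-- Membership in the category `C¹(V)`: `L(0)` is locally finite and the generalized weights lie in
finitely many sets `h_i + ℤ_{≥0}`. -/
def WeakModule.IsC1 : Prop :=
  (∀ w : W, ∃ S : Submodule ℂ W, w ∈ S ∧ FiniteDimensional ℂ S ∧ ∀ u ∈ S, M.L 0 u ∈ S) ∧
  ∃ H : Finset ℂ, ∀ h : ℂ, M.weightSpace h ≠ ⊥ → ∃ h₀ ∈ H, ∃ n : ℕ, h = h₀ + n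

/-- A linear functional is homogeneous of weight `h` if it vanishes on all other weight spaces. -/
def WeakModule.IsHomogeneousDual (h : ℂ) (φ : Module.Dual ℂ W) : Prop :=
  ∀ h' : ℂ, h' ≠ h → ∀ w ∈ M.weightSpace h', φ w = 0

/-- Membership in the restricted dual `W' = ⊕_h (W_h)^*`: the functional vanishes on all but
finitely many weight spaces. -/
def WeakModule.InRestrictedDual (φ : Module.Dual ℂ W) : Prop :=
  {h : ℂ | ∃ w ∈ M.weightSpace h, φ w ≠ 0}.Finite

end OneModule

section Intertwining

variable {W₁ W₂ W₃ : Type*} [AddCommGroup W₁] [Module ℂ W₁] [AddCommGroup W₂] [Module ℂ W₂]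
  [AddCommGroup W₃] [Module ℂ W₃]

/-- An intertwining operator `I(w,z) = ∑_{n ∈ ℂ} w_n z^{-n-1}` of type `(W₃; W₁ W₂)`;
`I.modes n w u` is `w_n u`. -/
structure IntertwiningOperator (M₁ : WeakModule A W₁) (M₂ : WeakModule A W₂)
    (M₃ : WeakModule A W₃) where
  modes : ℂ → W₁ →ₗ[ℂ] W₂ →ₗ[ℂ] W₃
  truncation : ∀ (w : W₁) (u : W₂) (α : ℂ), ∃ N : ℤ, ∀ n : ℤ, N ≤ n → modes (α + n) w u = 0
  derivative : ∀ (n : ℂ) (w : W₁), modes n (M₁.L (-1) w) = (-n) • modes (n - 1) w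
  jacobi : JacobiIdentity M₁.Y M₂.Y M₃.Y (fun (n : ℂ) w u => modes n w u)

end Intertwining

section GeneralizedLeft

variable {W₁ W₂ : Type*} [AddCommGroup W₁] [Module ℂ W₁] [AddCommGroup W₂] [Module ℂ W₂]
  (M₁ : WeakModule A W₁) (M₂ : WeakModule A W₂)

/-- `Φ(z) = ∑_{n ∈ ℂ} Φ_n z^{-n-1}` is a generalized left intertwining operator from `W₁` to `W₂`:
truncation, `[L(-1),Φ(z)] = Φ'(z)`, and, for each `a`, the existence of a positive `k` with
`(z₁-z₂)^k Y(a,z₁)Φ(z₂) = (z₁-z₂)^k Φ(z₂)Y(a,z₁)` (coefficients of `z₁^{-m-1} z₂^{-n-1}`). -/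
def IsGeneralizedLeft (Φ : ℂ → W₁ →ₗ[ℂ] W₂) : Prop :=
  (∀ (α : ℂ) (u : W₁), ∃ N : ℤ, ∀ n : ℤ, N ≤ n → Φ (α + n) u = 0) ∧
  (∀ (n : ℂ) (u : W₁), M₂.L (-1) (Φ n u) - Φ n (M₁.L (-1) u) = (-n) • Φ (n - 1) u) ∧
  ∀ a : V, ∃ k : ℕ, 0 < k ∧ ∀ (m : ℤ) (n : ℂ) (u : W₁),
    ∑ i ∈ Finset.range (k + 1), ((-1 : ℤ) ^ i * (k.choose i : ℤ)) •
        M₂.mode a (m + k - i) (Φ (n + i) u)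
      = ∑ i ∈ Finset.range (k + 1), ((-1 : ℤ) ^ i * (k.choose i : ℤ)) •
        Φ (n + i) (M₁.mode a (m + k - i) u)

/-- `Φ(z)` is homogeneous of generalized weight `h`: each `Φ_n` maps the weight space of weight
`h₁` into that of weight `h₁ + h - n - 1`. -/
def IsHomogeneousSeries (h : ℂ) (Φ : ℂ → W₁ →ₗ[ℂ] W₂) : Prop :=
  ∀ (n h₁ : ℂ), ∀ u ∈ M₁.weightSpace h₁, Φ n u ∈ M₂.weightSpace (h - n - 1 + h₁)

/-- `G_l^o(W₁,W₂)`: the sum over `h ∈ ℂ` of the spaces of generalized left intertwining operators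
which are homogeneous of generalized weight `h`. -/
def homogeneousGeneralizedLeft : Submodule ℂ (ℂ → W₁ →ₗ[ℂ] W₂) :=
  Submodule.span ℂ {Φ | IsGeneralizedLeft M₁ M₂ Φ ∧ ∃ h : ℂ, IsHomogeneousSeries M₁ M₂ h Φ}

/-- The action
`a_m ∘_l Φ(z₂) = Res_{z₁} ((z₁-z₂)^m Y(a,z₁)Φ(z₂) - (-z₂+z₁)^m Φ(z₂)Y(a,z₁))`:
this is the coefficient of `z₂^{-n-1}`, applied to `u`. -/
def leftAction (a : V) (m : ℤ) (Φ : ℂ → W₁ →ₗ[ℂ] W₂) (n : ℂ) (u : W₁) : W₂ :=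
  ∑ᶠ i : ℕ, ((-1 : ℤ) ^ i * Ring.choose m i) •
    (M₂.mode a (m - i) (Φ (n + i) u)
      - (m.negOnePow : ℤ) • Φ (n + m - i) (M₁.mode a i u))

end GeneralizedLeft

end Modules

/-! A formal series in two variables with complex exponents is a function `c : ℂ → ℂ → ℂ`,
`c p q` being the coefficient of (first variable)^p (second variable)^q. -/

/-- Absolute convergence of `∑ c p q z₁^p z₂^q` in the domain `|z₁| > |z₂| > 0`, on all branches:
`z₁ = e^{t₁}` and `z₂ = e^{t₂}`. -/
def ConvergesInDomain (c : ℂ → ℂ → ℂ) : Prop :=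
  ∀ t₁ t₂ : ℂ, t₂.re < t₁.re →
    Summable fun x : ℂ × ℂ => c x.1 x.2 * (Complex.exp (x.1 * t₁) * Complex.exp (x.2 * t₂))

/-- The data `k, r_i, s_i, f_i` of a multi-valued function
`∑_{i=1}^k z₂^{r_i} z₀^{s_i} f_i(z₀/z₂)` on `|z₂| > |z₀| > 0`, the `f_i` being analytic on the open
unit disc. -/
structure ExpansionData where
  k : ℕ
  r : Fin k → ℂ
  s : Fin k → ℂ
  f : Fin k → ℂ → ℂ
  analytic : ∀ i, AnalyticOnNhd ℂ (f i) (Metric.ball 0 1)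

/-- The value at `z₂ = e^t`, `z₀ = e^t x`, on the branch `log z₂ = t`, `log z₀ = t + log x`. -/
def ExpansionData.value (D : ExpansionData) (t x : ℂ) : ℂ :=
  ∑ i, Complex.exp (D.r i * t) * Complex.exp (D.s i * (t + Complex.log x)) * D.f i x

/-- The formal series in `z₀, z₂` obtained from the Taylor expansions of the `f_i` at `0`:
the coefficient of `z₀^p z₂^q`. -/
def ExpansionData.series (D : ExpansionData) (p q : ℂ) : ℂ :=
  ∑ i, ∑ᶠ j : ℕ, open Classical in
    if D.s i + j = p ∧ D.r i - j = q then iteratedDeriv j (D.f i) 0 / (j.factorial : ℂ) else 0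

/-- The sum of the series `∑ c p q z₁^p z₂^q` on `|z₁| > |z₂| > 0` is extended analytically by
`∑ z₂^{r_i}(z₁-z₂)^{s_i} f_i((z₁-z₂)/z₂)` to `|z₂| > |z₁-z₂| > 0`: both agree on
the overlap `|z₁| > |z₂| > |z₁-z₂| > 0`. Here `z₂ = e^t`, `x = (z₁-z₂)/z₂`, and the branches are the
compatible ones `log z₁ = log z₂ + log (1+x)`, `log (z₁-z₂) = log z₂ + log x` with principal `log`s
of `1+x` and `x` (on the overlap neither is a negative real number), which are real for positive
real `z₁, z₂, z₁-z₂`. -/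
def ExtendsTo (c : ℂ → ℂ → ℂ) (D : ExpansionData) : Prop :=
  ∀ t x : ℂ, ‖x‖ < 1 → 1 < ‖1 + x‖ →
    HasSum (fun y : ℂ × ℂ => c y.1 y.2 *
      (Complex.exp (y.1 * (t + Complex.log (1 + x))) * Complex.exp (y.2 * t))) (D.value t x)

/-- The series `c` in `z₁, z₂` converges and has an analytic extension whose formal expansion, with
`z₁ - z₂ = z₀`, is the series `e` in `z₀, z₂`. -/
def HasExtension (c e : ℂ → ℂ → ℂ) : Prop :=
  ConvergesInDomain c ∧ ∃ D : ExpansionData, ExtendsTo c D ∧ e = D.series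

open Classical in
/-- `E₁₂ c |_{z₁ = z₀ + z₂}` as a formal series in `z₀, z₂` (zero if `c` has no extension). -/
def E12 (c : ℂ → ℂ → ℂ) : ℂ → ℂ → ℂ :=
  if h : ∃ e, HasExtension c e then h.choose else 0

section Products

variable {V : Type*} [AddCommGroup V] [Module ℂ V] {A : VertexOperatorAlgebra V}
  {W W₁ W₂ W₃ W₄ W₅ : Type*} [AddCommGroup W] [Module ℂ W] [AddCommGroup W₁] [Module ℂ W₁]
  [AddCommGroup W₂] [Module ℂ W₂] [AddCommGroup W₃] [Module ℂ W₃] [AddCommGroup W₄] [Module ℂ W₄]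
  [AddCommGroup W₅] [Module ℂ W₅]
  {M : WeakModule A W} {M₁ : WeakModule A W₁} {M₂ : WeakModule A W₂} {M₃ : WeakModule A W₃}
  {M₄ : WeakModule A W₄} {M₅ : WeakModule A W₅}

/-- `⟨w₄', Y₁(w₁,z₁) Y₂(w₂,z₂) w₃⟩`: the coefficient of `z₁^p z₂^q`. -/
def productSeries (Y₁ : IntertwiningOperator M₁ M₅ M₄) (Y₂ : IntertwiningOperator M₂ M₃ M₅)
    (φ : Module.Dual ℂ W₄) (w₁ : W₁) (w₂ : W₂) (w₃ : W₃) (p q : ℂ) : ℂ :=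
  φ (Y₁.modes (-p - 1) w₁ (Y₂.modes (-q - 1) w₂ w₃))

/-- `⟨w₄', Y₄(Y₃(w₁,z₀)w₂,z₂) w₃⟩`: the coefficient of `z₀^p z₂^q`. -/
def iterateSeries (Y₃ : IntertwiningOperator M₁ M₂ M) (Y₄ : IntertwiningOperator M M₃ M₄)
    (φ : Module.Dual ℂ W₄) (w₁ : W₁) (w₂ : W₂) (w₃ : W₃) (p q : ℂ) : ℂ :=
  φ (Y₄.modes (-q - 1) (Y₃.modes (-p - 1) w₁ w₂) w₃)

/-- The convergence and extension property for the product of `Y₁` and `Y₂`. -/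
def ConvergenceExtension (Y₁ : IntertwiningOperator M₁ M₅ M₄)
    (Y₂ : IntertwiningOperator M₂ M₃ M₅) : Prop :=
  ∃ N : ℤ, ∀ h₁ h₂ h₃ h₄ : ℂ, ∀ w₁ ∈ M₁.weightSpace h₁, ∀ w₂ ∈ M₂.weightSpace h₂,
    ∀ w₃ ∈ M₃.weightSpace h₃, ∀ φ : Module.Dual ℂ W₄, M₄.IsHomogeneousDual h₄ φ →
      ConvergesInDomain (productSeries Y₁ Y₂ φ w₁ w₂ w₃) ∧
      ∃ D : ExpansionData, (∀ i, (N : ℝ) < (h₁ + h₂ + D.s i).re) ∧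
        ExtendsTo (productSeries Y₁ Y₂ φ w₁ w₂ w₃) D

/-- `Φ(z₂)` is `ψ_n(w₁,w₂,z₂)`, the coefficient of `z₀^{-n-1}` in the series `ψ(w₁,w₂;z₀,z₂)`
defined by `⟨w₄', ψ(w₁,w₂;z₀,z₂)w₃⟩ = E₁₂⟨w₄', Y₁(w₁,z₁)Y₂(w₂,z₂)w₃⟩ |_{z₁ = z₀ + z₂}`. -/
def IsPsi (Y₁ : IntertwiningOperator M₁ M₅ M₄) (Y₂ : IntertwiningOperator M₂ M₃ M₅)
    (w₁ : W₁) (w₂ : W₂) (n : ℂ) (Φ : ℂ → W₃ →ₗ[ℂ] W₄) : Prop :=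
  ∀ (m : ℂ) (w₃ : W₃) (φ : Module.Dual ℂ W₄), M₄.InRestrictedDual φ →
    φ (Φ m w₃) = E12 (productSeries Y₁ Y₂ φ w₁ w₂ w₃) (-n - 1) (-m - 1)

/-- The span of all the `ψ_n(w₁,w₂,z₂)`. -/
def psiSpan (Y₁ : IntertwiningOperator M₁ M₅ M₄) (Y₂ : IntertwiningOperator M₂ M₃ M₅) :
    Submodule ℂ (ℂ → W₃ →ₗ[ℂ] W₄) :=
  Submodule.span ℂ {Φ | ∃ (w₁ : W₁) (w₂ : W₂) (n : ℂ), IsPsi Y₁ Y₂ w₁ w₂ n Φ}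

end Products

end VertexAssoc

end

open VertexAssoc

/-! Analytic continuation followed by formal expansion is a linear passage from series in `z₁, z₂`
to series in `z₀, z₂`. It is well defined, it turns multiplication by `z₁` into multiplication by
`z₀ + z₂`, and it leaves multiplication by powers of `z₂` alone. These properties, together with the
Jacobi identities of the two factors and the necessary truncations, already force a Jacobi identity
for the iterate. `AssociativitySystem` isolates them, and the algebra is done there once.

Well-definedness is `HasExtension.unique`, resting on `series_eq_zero`: if `∑ z₂^{r_i} z₀^{s_i}
f_i(z₀/z₂)` vanishes on all branches, independence of characters separates the summands by `r_i +
s_i` and by `s_i` modulo `ℤ`, and inside one class the identity theorem for power series applies.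

Existence of `ψ` needs more than coefficients, because weight spaces may be infinite-dimensional:
for fixed exponents the extension only gives a linear functional on the dual of `W₄`. But
convergence against every functional forces the products of a given weight to span a
finite-dimensional space (`finiteDimensional_span_of_summable`), and a functional on the dual that
ignores the annihilator of such a space is evaluation at one of its vectors (`exists_eq_eval`). The
integer `N` of the convergence property bounds the powers of `z₀` from below independently of `w₃`.

In an associativity system three facts are proved. The commutator formula `residueAction_iterate`
follows by moving a field through both factors, after clearing negative powers of `z₁ - z₂`. Weak
commutativity, `AssociativitySystem.locality`, follows since `(z - z₁)^K (z - z₂)^K` kills the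
commutator with the product, hence `(z - z₀ - z₂)^K (z - z₂)^K` kills the one with the iterate, and
truncation in `z₀` removes the first factor coefficient by coefficient. The Jacobi identity
`iterDefect_eq_zero` reduces, through the recursion `eq_zero_of_recursion`, to `l = 0` and one large
`m`; the latter is associativity.

The system is used twice: with complex modes for the two given operators, and with integer modes for
`Y(b, z₁)Φ(z₂)` and its residue action. The second use makes `W` a weak module
(`IsLocalSpace.weakModule`). The Jacobi identity of the evaluation map is weak commutativity, and
that of the map to `W` is the first use. For `L(-1)`, differentiation in `z₁` is termwise, and
differentiation in `z₂` is reduced to it by Euler's formula for homogeneous series. -/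

namespace VertexAssoc

open Filter

/-! ### Binomial sums and the Pascal recursion. -/

section BinomialSums

variable {X X' : Type*} [AddCommGroup X] [AddCommGroup X']

/-- A `finsum` over an infinite support is zero by convention, so the rules for binomial sums ask
for eventual vanishing of the summands; here that becomes finiteness. -/
theorem finite_support_of_eventually {f : ℕ → X} (hf : ∀ᶠ i in atTop, f i = 0) :
    (Function.support f).Finite := by
  obtain ⟨N, hN⟩ := eventually_atTop.1 hf
  refine (Finset.range N).finite_toSet.subset fun i hi => ?_
  by_contra h
  exact hi (hN i (by simpa using h))

theorem finsum_eq_sum_range {f : ℕ → X} {N : ℕ} (hf : ∀ i, N ≤ i → f i = 0) :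
    ∑ᶠ i, f i = ∑ i ∈ Finset.range N, f i :=
  finsum_eq_sum_of_support_subset _ fun i hi => by
    by_contra h
    exact hi (hf i (by simpa using h))

theorem finsum_comm_of_bound {F : ℕ → ℕ → X} {N : ℕ} (h : ∀ i j, N ≤ i ∨ N ≤ j → F i j = 0) :
    ∑ᶠ i, ∑ᶠ j, F i j = ∑ᶠ j, ∑ᶠ i, F i j := by
  have e1 : ∀ i, ∑ᶠ j, F i j = ∑ j ∈ Finset.range N, F i j := fun i =>
    finsum_eq_sum_range fun j hj => h i j (Or.inr hj)
  have e2 : ∀ j, ∑ᶠ i, F i j = ∑ i ∈ Finset.range N, F i j := fun j =>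
    finsum_eq_sum_range fun i hi => h i j (Or.inl hi)
  simp only [e1, e2]
  rw [finsum_eq_sum_range (N := N), finsum_eq_sum_range (N := N), Finset.sum_comm]
  · exact fun j hj => Finset.sum_eq_zero fun i _ => h i j (Or.inr hj)
  · exact fun i hi => Finset.sum_eq_zero fun j _ => h i j (Or.inl hi)

/-- `∑ C(l,i) f_i`, a finite sum for eventually vanishing `f`. -/
noncomputable def psum (l : ℤ) (f : ℕ → X) : X := ∑ᶠ i : ℕ, Ring.choose l i • f i

/-- `∑ (-1)^i C(l,i) f_i`, a finite sum for eventually vanishing `f`. -/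
noncomputable def bsum (l : ℤ) (f : ℕ → X) : X :=
  ∑ᶠ i : ℕ, ((-1 : ℤ) ^ i * Ring.choose l i) • f i

theorem bsum_eq_psum (l : ℤ) (f : ℕ → X) : bsum l f = psum l fun i => (-1 : ℤ) ^ i • f i := by
  unfold bsum psum
  exact finsum_congr fun i => by rw [smul_smul, mul_comm]

variable {f g : ℕ → X}

theorem eventually_smul {c : ℕ → ℤ} (hf : ∀ᶠ i in atTop, f i = 0) :
    ∀ᶠ i in atTop, c i • f i = 0 := hf.mono fun i hi => by rw [hi, smul_zero]

theorem eventually_succ (hf : ∀ᶠ i in atTop, f i = 0) : ∀ᶠ i in atTop, f (i + 1) = 0 :=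
  (tendsto_add_atTop_nat 1).eventually hf

theorem psum_eq_sum {N : ℕ} (l : ℤ) (hf : ∀ i, N ≤ i → f i = 0) :
    psum l f = ∑ i ∈ Finset.range N, Ring.choose l i • f i :=
  finsum_eq_sum_range fun i hi => by rw [hf i hi, smul_zero]

theorem bsum_eq_sum {N : ℕ} (l : ℤ) (hf : ∀ i, N ≤ i → f i = 0) :
    bsum l f = ∑ i ∈ Finset.range N, ((-1 : ℤ) ^ i * Ring.choose l i) • f i :=
  finsum_eq_sum_range fun i hi => by rw [hf i hi, smul_zero]

theorem psum_add (l : ℤ) (hf : ∀ᶠ i in atTop, f i = 0) (hg : ∀ᶠ i in atTop, g i = 0) :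
    psum l (fun i => f i + g i) = psum l f + psum l g := by
  unfold psum
  rw [← finsum_add_distrib (finite_support_of_eventually (eventually_smul hf))
    (finite_support_of_eventually (eventually_smul hg))]
  exact finsum_congr fun i => smul_add _ _ _

theorem psum_sub (l : ℤ) (hf : ∀ᶠ i in atTop, f i = 0) (hg : ∀ᶠ i in atTop, g i = 0) :
    psum l (fun i => f i - g i) = psum l f - psum l g := by
  unfold psum
  rw [← finsum_sub_distrib (finite_support_of_eventually (eventually_smul hf))
    (finite_support_of_eventually (eventually_smul hg))]
  exact finsum_congr fun i => smul_sub _ _ _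

theorem bsum_add (l : ℤ) (hf : ∀ᶠ i in atTop, f i = 0) (hg : ∀ᶠ i in atTop, g i = 0) :
    bsum l (fun i => f i + g i) = bsum l f + bsum l g := by
  simp only [bsum_eq_psum, smul_add]
  exact psum_add l (eventually_smul hf) (eventually_smul hg)

theorem bsum_sub (l : ℤ) (hf : ∀ᶠ i in atTop, f i = 0) (hg : ∀ᶠ i in atTop, g i = 0) :
    bsum l (fun i => f i - g i) = bsum l f - bsum l g := by
  simp only [bsum_eq_psum, smul_sub]
  exact psum_sub l (eventually_smul hf) (eventually_smul hg)

theorem map_psum {F : Type*} [FunLike F X X'] [AddMonoidHomClass F X X'] (φ : F) (l : ℤ)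
    (hf : ∀ᶠ i in atTop, f i = 0) : φ (psum l f) = psum l fun i => φ (f i) := by
  obtain ⟨N, hN⟩ := eventually_atTop.1 hf
  rw [psum_eq_sum l hN, psum_eq_sum (N := N) l (fun i hi => by rw [hN i hi, map_zero]), map_sum]
  exact Finset.sum_congr rfl fun i _ => map_zsmul _ _ _

theorem map_bsum {F : Type*} [FunLike F X X'] [AddMonoidHomClass F X X'] (φ : F) (l : ℤ)
    (hf : ∀ᶠ i in atTop, f i = 0) : φ (bsum l f) = bsum l fun i => φ (f i) := by
  simp only [bsum_eq_psum]
  rw [map_psum φ l (eventually_smul hf)]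
  simp only [map_zsmul]

theorem psum_smul {S : Type*} [DistribSMul S X] (c : S) (l : ℤ)
    (hf : ∀ᶠ i in atTop, f i = 0) : psum l (fun i => c • f i) = c • psum l f :=
  (map_psum (DistribSMul.toAddMonoidHom X c) l hf).symm

theorem bsum_smul {S : Type*} [DistribSMul S X] (c : S) (l : ℤ)
    (hf : ∀ᶠ i in atTop, f i = 0) : bsum l (fun i => c • f i) = c • bsum l f :=
  (map_bsum (DistribSMul.toAddMonoidHom X c) l hf).symm

@[simp] theorem psum_zero_left (f : ℕ → X) : psum 0 f = f 0 := by
  unfold psum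
  rw [finsum_eq_single _ 0 fun i hi => ?_]
  · simp
  · rw [Ring.choose_zero_pos ℤ (Nat.pos_of_ne_zero hi), zero_smul]

@[simp] theorem bsum_zero_left (f : ℕ → X) : bsum 0 f = f 0 := by
  rw [bsum_eq_psum, psum_zero_left]; simp

@[simp] theorem psum_zero_right (l : ℤ) : psum l (fun _ => (0 : X)) = 0 := by simp [psum]

@[simp] theorem bsum_zero_right (l : ℤ) : bsum l (fun _ => (0 : X)) = 0 := by simp [bsum]

/-- Pascal's rule, that is, splitting one factor off `(1 + x)^(l+1)`, with `f` playing the role of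
the powers of `x`. -/
theorem psum_succ (l : ℤ) (hf : ∀ᶠ i in atTop, f i = 0) :
    psum (l + 1) f = psum l f + psum l fun i => f (i + 1) := by
  obtain ⟨N, hN⟩ := eventually_atTop.1 hf
  rw [psum_eq_sum (N := N + 1) _ fun i hi => hN i (by omega),
    psum_eq_sum (N := N + 1) _ fun i hi => hN i (by omega),
    psum_eq_sum (N := N) _ fun i hi => hN _ (by omega),
    Finset.sum_range_succ', Finset.sum_range_succ' (fun i => Ring.choose l i • f i)]
  simp only [Ring.choose_succ_succ, add_smul, Finset.sum_add_distrib, Ring.choose_zero_right]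
  abel

theorem bsum_succ (l : ℤ) (hf : ∀ᶠ i in atTop, f i = 0) :
    bsum (l + 1) f = bsum l f - bsum l fun i => f (i + 1) := by
  simp only [bsum_eq_psum]
  rw [psum_succ l (eventually_smul hf), sub_eq_add_neg]
  congr 1
  have := psum_smul (-1 : ℤ) l (eventually_smul (c := fun i => (-1 : ℤ) ^ i) (eventually_succ hf))
  rw [neg_one_smul] at this
  rw [← this]
  exact congrArg _ (funext fun i => by rw [smul_smul, pow_succ']; )

theorem psum_natCast (k : ℕ) (f : ℕ → X) :
    psum (k : ℤ) f = ∑ i ∈ Finset.range (k + 1), (k.choose i : ℤ) • f i := by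
  unfold psum
  simp only [Ring.choose_natCast]
  exact finsum_eq_sum_range fun i hi => by
    rw [Nat.choose_eq_zero_of_lt (by omega), Nat.cast_zero, zero_smul]

theorem bsum_natCast (k : ℕ) (f : ℕ → X) :
    bsum (k : ℤ) f = ∑ i ∈ Finset.range (k + 1), ((-1 : ℤ) ^ i * (k.choose i : ℤ)) • f i := by
  rw [bsum_eq_psum, psum_natCast]
  exact Finset.sum_congr rfl fun i _ => by rw [smul_smul, mul_comm]

theorem choose_mul_choose (l : ℤ) (i j : ℕ) :
    Ring.choose l i * Ring.choose (l - i) j = ((i + j).choose i : ℤ) * Ring.choose l (i + j) := by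
  have := Ring.choose_smul_choose l (Nat.le_add_right i j)
  rw [nsmul_eq_mul, Nat.add_sub_cancel_left] at this
  exact this.symm

/-- Both products are the trinomial coefficient of `l` at `i` and `j`. This is what permits
interchanging nested binomial sums whose upper index depends on the outer variable. -/
theorem choose_mul_choose_comm (l : ℤ) (i j : ℕ) :
    Ring.choose l i * Ring.choose (l - i) j = Ring.choose l j * Ring.choose (l - j) i := by
  rw [choose_mul_choose, choose_mul_choose, Nat.choose_symm_add, add_comm i j]

/-- A function with the Pascal recursion which vanishes for large `l` and for one value of `m`
vanishes. -/
theorem eq_zero_of_recursion {Γ : Type*} [CommRing Γ] {d : ℤ → ℤ → Γ → X}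
    (hd : ∀ l m n, d (l + 1) m n = d l (m + 1) n - d l m (n + 1)) (L m₀ : ℤ)
    (hL : ∀ l, L ≤ l → ∀ m n, d l m n = 0) (hm : ∀ l n, d l m₀ n = 0) (l m : ℤ) (n : Γ) :
    d l m n = 0 := by
  rcases le_total L l with h | h
  · exact hL l h m n
  induction l, h using Int.leInductionDown generalizing m n with
  | base => exact hL L le_rfl m n
  | pred l _ ih =>
    -- Once level `l` vanishes, the values at level `l - 1` are constant along `(m + 1, n) ↔ (m, n +
    -- 1)`, so vanishing at `m₀` for all `n` spreads to every `m` in both directions.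
    have step : ∀ m n, d (l - 1) (m + 1) n = d (l - 1) m (n + 1) := fun m n => by
      have := hd (l - 1) m n
      rw [sub_add_cancel, ih] at this
      exact (sub_eq_zero.1 this.symm)
    rcases le_total m₀ m with h | h
    · induction m, h using Int.leInduction generalizing n with
      | base => exact hm _ _
      | succ m _ ihm => rw [step, ihm]
    · induction m, h using Int.leInductionDown generalizing n with
      | base => exact hm _ _
      | pred m _ ihm =>
        have := step (m - 1) (n - 1)
        rw [sub_add_cancel, sub_add_cancel] at this
        rw [← this, ihm]

end BinomialSums

end VertexAssoc

/-! ### Brackets of a field with a series; weak commutativity implies Jacobi. -/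

namespace VertexAssoc

set_option linter.unusedSectionVars false

open Filter

section Bracket

variable {Γ : Type*} [CommRing Γ] {U₁ U₂ U₃ : Type*} [AddCommGroup U₁] [Module ℂ U₁]
  [AddCommGroup U₂] [Module ℂ U₂] [AddCommGroup U₃] [Module ℂ U₃]

/-- The modes of a field: each vector is annihilated by all sufficiently large modes. -/
def TruncatedModes (α : ℤ → Module.End ℂ U₂) : Prop := ∀ u, ∃ N : ℤ, ∀ n, N ≤ n → α n u = 0

/-- Each vector is annihilated by the large modes of the series in each coset of `ℤ`. -/
def TruncatedSeries (Φ : Γ → U₂ →ₗ[ℂ] U₃) : Prop :=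
  ∀ (β : Γ) (u : U₂), ∃ N : ℤ, ∀ n : ℤ, N ≤ n → Φ (β + n) u = 0

theorem TruncatedModes.eventually {α : ℤ → Module.End ℂ U₂} (h : TruncatedModes α) (m : ℤ)
    (u : U₂) : ∀ᶠ i : ℕ in atTop, α (m + i) u = 0 := by
  obtain ⟨N, hN⟩ := h u
  exact eventually_atTop.2 ⟨(N - m).toNat, fun i hi => hN _ (by omega)⟩

theorem TruncatedModes.eventually' {α : ℤ → Module.End ℂ U₂} (h : TruncatedModes α)
    (u : U₂) : ∀ᶠ i : ℕ in atTop, α i u = 0 := by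
  simpa using h.eventually 0 u

theorem TruncatedSeries.eventually {Φ : Γ → U₂ →ₗ[ℂ] U₃} (h : TruncatedSeries Φ) (β : Γ)
    (u : U₂) : ∀ᶠ i : ℕ in atTop, Φ (β + i) u = 0 := by
  obtain ⟨N, hN⟩ := h β u
  refine eventually_atTop.2 ⟨N.toNat, fun i hi => ?_⟩
  have := hN i (by omega)
  rwa [Int.cast_natCast] at this

/-- The left-hand side of the Jacobi identity for a field acting as `α₂`, `α₃`, and a series
`Φ`. -/
noncomputable def bracketSum (α₂ : ℤ → Module.End ℂ U₂) (α₃ : ℤ → Module.End ℂ U₃)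
    (Φ : Γ → U₂ →ₗ[ℂ] U₃) (l m : ℤ) (n : Γ) (u : U₂) : U₃ :=
  bsum l fun i => α₃ (m + l - i) (Φ (n + (i : Γ)) u)
    - (l.negOnePow : ℤ) • Φ (n + (l : Γ) - (i : Γ)) (α₂ (m + i) u)

/-- The residue `Res ((z₁-z₂)^m α(z₁) Φ(z₂) - (-z₂+z₁)^m Φ(z₂) α(z₁))`. -/
noncomputable def residueAction (α₂ : ℤ → Module.End ℂ U₂) (α₃ : ℤ → Module.End ℂ U₃)
    (m : ℤ) (Φ : Γ → U₂ →ₗ[ℂ] U₃) (n : Γ) (u : U₂) : U₃ :=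
  bsum m fun i => α₃ (m - i) (Φ (n + (i : Γ)) u)
    - (m.negOnePow : ℤ) • Φ (n + (m : Γ) - (i : Γ)) (α₂ i u)

variable {α₂ : ℤ → Module.End ℂ U₂} {α₃ : ℤ → Module.End ℂ U₃} {Φ : Γ → U₂ →ₗ[ℂ] U₃}

theorem bracketSum_zero_middle (l : ℤ) (n : Γ) (u : U₂) :
    bracketSum α₂ α₃ Φ l 0 n u = residueAction α₂ α₃ l Φ n u := by
  simp [bracketSum, residueAction]

theorem eventually_left (hΦ : TruncatedSeries Φ) (M : ℕ → ℤ) (n : Γ) (u : U₂) :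
    ∀ᶠ i : ℕ in atTop, α₃ (M i) (Φ (n + (i : Γ)) u) = 0 :=
  (hΦ.eventually n u).mono fun i hi => by rw [hi, map_zero]

theorem eventually_right (hα : TruncatedModes α₂) (N : ℕ → Γ) (m : ℤ) (u : U₂) :
    ∀ᶠ i : ℕ in atTop, Φ (N i) (α₂ (m + i) u) = 0 :=
  (hα.eventually m u).mono fun i hi => by rw [hi, map_zero]

theorem bracketSum_eq_sub (hΦ : TruncatedSeries Φ) (hα : TruncatedModes α₂) (l m : ℤ) (n : Γ)
    (u : U₂) : bracketSum α₂ α₃ Φ l m n u =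
      bsum l (fun i => α₃ (m + l - i) (Φ (n + (i : Γ)) u))
      - (l.negOnePow : ℤ) • bsum l (fun i => Φ (n + (l : Γ) - (i : Γ)) (α₂ (m + i) u)) := by
  unfold bracketSum
  rw [bsum_sub l (eventually_left hΦ _ _ _) (eventually_smul (eventually_right hα _ _ _)),
    bsum_smul _ _ (eventually_right hα _ _ _)]

/-- The bracket consists of the coefficients of `(z₁-z₂)^l α₃(z₁)Φ(z₂) - (-z₂+z₁)^l Φ(z₂)α₂(z₁)`; a
further factor `z₁ - z₂` raises `m`, or `n` with a minus sign. -/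
theorem bracketSum_succ (hΦ : TruncatedSeries Φ) (hα : TruncatedModes α₂) (l m : ℤ) (n : Γ)
    (u : U₂) : bracketSum α₂ α₃ Φ (l + 1) m n u =
      bracketSum α₂ α₃ Φ l (m + 1) n u - bracketSum α₂ α₃ Φ l m (n + 1) u := by
  rw [bracketSum_eq_sub hΦ hα, bracketSum_eq_sub hΦ hα, bracketSum_eq_sub hΦ hα,
    bsum_succ l (eventually_left hΦ _ _ _), bsum_succ l (eventually_right hα _ _ _),
    Int.negOnePow_succ, Units.val_neg]
  have e1 : ∀ i : ℕ, m + (l + 1) - i = m + 1 + l - i := fun i => by ring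
  have e2 : ∀ i : ℕ, m + (l + 1) - (i + 1 : ℕ) = m + l - i := fun i => by push_cast; ring
  have e3 : ∀ i : ℕ, n + ((i + 1 : ℕ) : Γ) = n + 1 + i := fun i => by push_cast; ring
  have e4 : ∀ i : ℕ, n + ((l + 1 : ℤ) : Γ) - (i : Γ) = n + 1 + l - i := fun i => by
    push_cast; ring
  have e5 : ∀ i : ℕ, n + ((l + 1 : ℤ) : Γ) - ((i + 1 : ℕ) : Γ) = n + l - i := fun i => by
    push_cast; ring
  have e6 : ∀ i : ℕ, m + ((i + 1 : ℕ) : ℤ) = m + 1 + i := fun i => by push_cast; ring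
  simp only [e2, e3, e5, e6]
  simp only [e1, e4]
  module

/-- For a nonnegative exponent the two expansions are the same polynomial; reversing one sum aligns
the terms and gives the form in which weak commutativity is defined. -/
theorem bracketSum_natCast (k : ℕ) (m : ℤ) (n : Γ) (u : U₂) (hΦ : TruncatedSeries Φ)
    (hα : TruncatedModes α₂) :
    bracketSum α₂ α₃ Φ k m n u =
      ∑ i ∈ Finset.range (k + 1), ((-1 : ℤ) ^ i * (k.choose i : ℤ)) •
        (α₃ (m + k - i) (Φ (n + i) u) - Φ (n + i) (α₂ (m + k - i) u)) := by
  rw [bracketSum_eq_sub hΦ hα, bsum_natCast, bsum_natCast]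
  simp only [smul_sub, Finset.sum_sub_distrib]
  congr 1
  rw [← Finset.sum_range_reflect, Finset.smul_sum]
  refine Finset.sum_congr rfl fun i hi => ?_
  have hi : i ≤ k := by simpa [Nat.lt_succ_iff] using hi
  have h1 : k + 1 - 1 - i = k - i := by omega
  rw [h1, Nat.choose_symm hi, smul_smul]
  congr 1
  · have : ((k : ℤ).negOnePow : ℤ) = (-1) ^ k := by
      rw [Int.negOnePow_def]; simp
    rw [this, ← mul_assoc, ← pow_add]
    congr 1
    rw [show k + (k - i) = 2 * (k - i) + i by omega, pow_add, pow_mul]; simp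
  · rw [Nat.cast_sub hi, Int.cast_natCast, show n + (k : Γ) - (k - i) = n + i by ring,
      Nat.cast_sub hi, show m + ((k : ℤ) - i) = m + k - i by ring]

theorem bracketSum_eq_zero_of_le (hΦ : TruncatedSeries Φ) (hα : TruncatedModes α₂) {k : ℤ}
    (hk : ∀ m n u, bracketSum α₂ α₃ Φ k m n u = 0) {l : ℤ} (hl : k ≤ l) :
    ∀ m n u, bracketSum α₂ α₃ Φ l m n u = 0 := by
  induction l, hl using Int.leInduction with
  | base => exact hk
  | succ l _ ih => exact fun m n u => by rw [bracketSum_succ hΦ hα, ih, ih, sub_zero]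

theorem residueAction_eq_zero_of_le (hΦ : TruncatedSeries Φ) (hα : TruncatedModes α₂) {k : ℤ}
    (hk : ∀ m n u, bracketSum α₂ α₃ Φ k m n u = 0) {l : ℤ} (hl : k ≤ l) (n : Γ) (u : U₂) :
    residueAction α₂ α₃ l Φ n u = 0 := by
  rw [← bracketSum_zero_middle, bracketSum_eq_zero_of_le hΦ hα hk hl]

/-- The Jacobi identity, with the iterate given by the residue action, follows from truncation
and weak commutativity. -/
theorem bracketSum_eq_of_locality (hΦ : TruncatedSeries Φ) (hα : TruncatedModes α₂) {k : ℤ}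
    (hk : ∀ m n u, bracketSum α₂ α₃ Φ k m n u = 0) (l m : ℤ) (n : Γ) (u : U₂) :
    bracketSum α₂ α₃ Φ l m n u =
      psum m fun i => residueAction α₂ α₃ (l + i) Φ ((m : Γ) + n - (i : Γ)) u := by
  have hk' : ∀ l, k ≤ l → ∀ m n u, bracketSum α₂ α₃ Φ l m n u = 0 := fun l hl =>
    bracketSum_eq_zero_of_le hΦ hα hk hl
  have hact : ∀ l, k ≤ l → ∀ n u, residueAction α₂ α₃ l Φ n u = 0 := fun l hl =>
    residueAction_eq_zero_of_le hΦ hα hk hl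
  have hev : ∀ (l : ℤ) (N : ℕ → Γ),
      ∀ᶠ i : ℕ in atTop, residueAction α₂ α₃ (l + i) Φ (N i) u = 0 := fun l N =>
    eventually_atTop.2 ⟨(k - l).toNat, fun i hi => hact _ (by omega) _ _⟩
  rw [← sub_eq_zero]
  -- Both sides obey the same recursion, both vanish for `l ≥ k`, and at `m = 0` the right side has
  -- the single term `i = 0`, which is the residue on the left.
  refine eq_zero_of_recursion (d := fun l m n => bracketSum α₂ α₃ Φ l m n u -
    psum m fun i => residueAction α₂ α₃ (l + i) Φ ((m : Γ) + n - (i : Γ)) u) ?_ k 0 ?_ ?_ l m n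
  · intro l m n
    rw [bracketSum_succ hΦ hα, psum_succ m (hev _ _)]
    have e1 : ∀ i : ℕ, ((m + 1 : ℤ) : Γ) + n - i = m + (n + 1) - i := fun i => by
      push_cast; ring
    have e2 : ∀ i : ℕ, ((m + 1 : ℤ) : Γ) + n - (i + 1 : ℕ) = m + n - i := fun i => by
      push_cast; ring
    have e3 : ∀ i : ℕ, l + ((i + 1 : ℕ) : ℤ) = l + 1 + i := fun i => by push_cast; ring
    simp only [e2, e3]
    simp only [e1]
    abel
  · intro l hl m n
    have : (fun i : ℕ => residueAction α₂ α₃ (l + i) Φ ((m : Γ) + n - (i : Γ)) u) = fun _ => 0 :=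
      funext fun i => hact _ (by omega) _ _
    rw [this, psum_zero_right, hk' l hl, sub_zero]
  · intro l n
    simp [bracketSum_zero_middle]

end Bracket

end VertexAssoc

/-! ### Abstract associativity and the commutator formula for the iterate. -/

namespace VertexAssoc

open Filter

/-- Products of two intertwining maps `I₁`, `I₂` and a candidate `ψ` for the iterate, for the modes
`αᵢ` of one field. Matrix coefficients with functionals in `F` of product and iterate are
related by `R`, which is compatible with `z₁ ↦ z₀ + z₂`, `z₂ ↦ z₂`; in terms of modes,
multiplication by a variable raises the corresponding index by one. -/
structure AssociativitySystem (Γ U₁ U₂ U₃ U₄ U₅ : Type*) [CommRing Γ] [AddCommGroup U₁]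
    [Module ℂ U₁] [AddCommGroup U₂] [Module ℂ U₂] [AddCommGroup U₃] [Module ℂ U₃]
    [AddCommGroup U₄] [Module ℂ U₄] [AddCommGroup U₅] [Module ℂ U₅] where
  α₁ : ℤ → Module.End ℂ U₁
  α₂ : ℤ → Module.End ℂ U₂
  α₃ : ℤ → Module.End ℂ U₃
  α₄ : ℤ → Module.End ℂ U₄
  α₅ : ℤ → Module.End ℂ U₅
  trunc₁ : TruncatedModes α₁
  trunc₂ : TruncatedModes α₂
  trunc₃ : TruncatedModes α₃
  trunc₅ : TruncatedModes α₅
  I₁ : Γ → U₁ →ₗ[ℂ] U₅ →ₗ[ℂ] U₄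
  I₂ : ℂ → U₂ →ₗ[ℂ] U₃ →ₗ[ℂ] U₅
  I₁_trunc : ∀ w, TruncatedSeries fun n => I₁ n w
  I₂_trunc : ∀ w, TruncatedSeries fun n => I₂ n w
  jacobi₁ : ∀ w l m n u, bracketSum α₅ α₄ (fun n => I₁ n w) l m n u =
    psum m fun i => I₁ ((m : Γ) + n - (i : Γ)) (α₁ (l + i) w) u
  jacobi₂ : ∀ w l m n u, bracketSum α₃ α₅ (fun n => I₂ n w) l m n u =
    psum m fun i => I₂ ((m : ℂ) + n - (i : ℂ)) (α₂ (l + i) w) u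
  ψ : Γ → U₁ →ₗ[ℂ] U₂ →ₗ[ℂ] (ℂ → U₃ →ₗ[ℂ] U₄)
  ψ_trunc : ∀ w₁ w₂ (β : Γ), ∃ N : ℤ, ∀ k : ℤ, N ≤ k → ψ (β + k) w₁ w₂ = 0
  ψ_trunc' : ∀ n w₁ w₂, TruncatedSeries (ψ n w₁ w₂)
  F : Set (Module.Dual ℂ U₄)
  F_comp : ∀ φ ∈ F, ∀ m, φ ∘ₗ α₄ m ∈ F
  F_trunc : ∀ φ ∈ F, ∃ N : ℤ, ∀ m, m ≤ N → φ ∘ₗ α₄ m = 0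
  F_sep : ∀ v, (∀ φ ∈ F, φ v = 0) → v = 0
  R : Submodule ℂ ((Γ → ℂ → ℂ) × (Γ → ℂ → ℂ))
  R_shift₁ : ∀ c e, (c, e) ∈ R →
    ((fun n r => c (n + 1) r, fun n r => e (n + 1) r + e n (r + 1)) :
      (Γ → ℂ → ℂ) × (Γ → ℂ → ℂ)) ∈ R
  R_shift₂ : ∀ c e, (c, e) ∈ R → ∀ k : ℤ,
    ((fun n r => c n (r + k), fun n r => e n (r + k)) : (Γ → ℂ → ℂ) × (Γ → ℂ → ℂ)) ∈ R
  R_unique : ∀ e, (0, e) ∈ R → e = 0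
  rel : ∀ φ ∈ F, ∀ w₁ w₂ w₃, ((fun n r => φ (I₁ n w₁ (I₂ r w₂ w₃)),
    fun n r => φ (ψ n w₁ w₂ r w₃)) : (Γ → ℂ → ℂ) × (Γ → ℂ → ℂ)) ∈ R

section Operators

variable {Γ : Type*} [CommRing Γ]

/-- Multiplication by `z₁ - z₂` in terms of modes. -/
def diffOp : Module.End ℂ (Γ → ℂ → ℂ) where
  toFun c n r := c (n + 1) r - c n (r + 1)
  map_add' c d := by ext; simp; ring
  map_smul' a c := by ext; simp; ring

/-- Multiplication by the first variable in terms of modes. -/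
def firstShift : Module.End ℂ (Γ → ℂ → ℂ) where
  toFun c n r := c (n + 1) r
  map_add' _ _ := rfl
  map_smul' _ _ := rfl

theorem firstShift_pow (K : ℕ) (e : Γ → ℂ → ℂ) (n : Γ) (r : ℂ) :
    (firstShift ^ K) e n r = e (n + K) r := by
  induction K generalizing n with
  | zero => simp
  | succ K ih =>
    rw [pow_succ', Module.End.mul_apply]
    change (firstShift ^ K) e (n + 1) r = _
    rw [ih]; push_cast; ring_nf

/-- `(z₁ - z₂)^k c`, expanded in nonnegative powers of `z₂`. -/
noncomputable def binomialMul (k : ℤ) (f : Γ → ℂ → ℂ) (n : Γ) (r : ℂ) : ℂ :=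
  bsum k fun j => f (n + k - j) (r + j)

theorem binomialMul_zero (f : Γ → ℂ → ℂ) : binomialMul 0 f = f := by
  ext n r; simp [binomialMul]

/-- The truncation bound has to be uniform in the first index, because the summand moves both
indices at once. -/
theorem binomialMul_succ {f : Γ → ℂ → ℂ}
    (hf : ∀ r, ∃ J : ℕ, ∀ n, ∀ j : ℕ, J ≤ j → f n (r + j) = 0) (k : ℤ) :
    binomialMul (k + 1) f = diffOp (binomialMul k f) := by
  ext n r
  change binomialMul (k + 1) f n r = binomialMul k f (n + 1) r - binomialMul k f n (r + 1)
  unfold binomialMul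
  obtain ⟨J, hJ⟩ := hf r
  rw [bsum_succ _ (eventually_atTop.2 ⟨J, fun j hj => hJ _ j hj⟩)]
  congr 2 <;> ext j <;> push_cast <;> ring_nf

theorem binomialMul_add_nat {f : Γ → ℂ → ℂ}
    (hf : ∀ r, ∃ J : ℕ, ∀ n, ∀ j : ℕ, J ≤ j → f n (r + j) = 0) (k : ℤ) (K : ℕ) :
    binomialMul (k + K) f = (diffOp ^ K) (binomialMul k f) := by
  induction K with
  | zero => simp
  | succ K ih =>
    rw [pow_succ', Module.End.mul_apply, ← ih, ← binomialMul_succ hf]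
    push_cast; ring_nf

end Operators

namespace AssociativitySystem

variable {Γ U₁ U₂ U₃ U₄ U₅ : Type*} [CommRing Γ] [AddCommGroup U₁]
    [Module ℂ U₁] [AddCommGroup U₂] [Module ℂ U₂] [AddCommGroup U₃] [Module ℂ U₃]
    [AddCommGroup U₄] [Module ℂ U₄] [AddCommGroup U₅] [Module ℂ U₅]
    (S : AssociativitySystem Γ U₁ U₂ U₃ U₄ U₅)

/-- The matrix coefficient of the product. -/
def prodCoeff (φ : Module.Dual ℂ U₄) (w₁ : U₁) (w₂ : U₂) (w₃ : U₃) (n : Γ) (r : ℂ) : ℂ :=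
  φ (S.I₁ n w₁ (S.I₂ r w₂ w₃))

/-- The matrix coefficient of the iterate. -/
def iterCoeff (φ : Module.Dual ℂ U₄) (w₁ : U₁) (w₂ : U₂) (w₃ : U₃) (n : Γ) (r : ℂ) : ℂ :=
  φ (S.ψ n w₁ w₂ r w₃)

theorem rel' {φ : Module.Dual ℂ U₄} (hφ : φ ∈ S.F) (w₁ : U₁) (w₂ : U₂) (w₃ : U₃) :
    (S.prodCoeff φ w₁ w₂ w₃, S.iterCoeff φ w₁ w₂ w₃) ∈ S.R := S.rel φ hφ w₁ w₂ w₃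

/-- Under `z₁ = z₀ + z₂` the factor `z₁ - z₂` becomes `z₀`, a pure index shift. -/
theorem mem_diffOp {c e : Γ → ℂ → ℂ} (h : (c, e) ∈ S.R) : (diffOp c, firstShift e) ∈ S.R := by
  have h1 := S.R_shift₁ c e h
  have h2 := S.R_shift₂ c e h 1
  convert S.R.sub_mem h1 h2 using 1
  refine Prod.ext ?_ ?_ <;> funext n r
  · simp [diffOp]
  · simp [firstShift]

theorem mem_diffOp_pow {c e : Γ → ℂ → ℂ} (h : (c, e) ∈ S.R) (K : ℕ) :
    ((diffOp ^ K) c, (firstShift ^ K) e) ∈ S.R := by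
  induction K with
  | zero => simpa using h
  | succ K ih => simpa only [pow_succ', Module.End.mul_apply] using S.mem_diffOp ih

/-- The relation `R` up to multiplication by a power of `z₁ - z₂`. -/
def localR : Submodule ℂ ((Γ → ℂ → ℂ) × (Γ → ℂ → ℂ)) where
  carrier := {x | ∃ K : ℕ, ((diffOp ^ K) x.1, (firstShift ^ K) x.2) ∈ S.R}
  zero_mem' := ⟨0, by
    simp only [map_zero, Prod.fst_zero, Prod.snd_zero]
    exact S.R.zero_mem⟩
  add_mem' := by
    rintro x y ⟨K, hK⟩ ⟨L, hL⟩
    refine ⟨K + L, ?_⟩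
    have h1 := S.mem_diffOp_pow hK L
    have h2 := S.mem_diffOp_pow hL K
    rw [← Module.End.mul_apply, ← Module.End.mul_apply, ← pow_add, ← pow_add] at h1 h2
    rw [add_comm L K] at h1
    simpa using S.R.add_mem h1 h2
  smul_mem' := by
    rintro a x ⟨K, hK⟩
    exact ⟨K, by simpa using S.R.smul_mem a hK⟩

theorem mem_localR {x : (Γ → ℂ → ℂ) × (Γ → ℂ → ℂ)} (h : x ∈ S.R) : x ∈ S.localR :=
  ⟨0, by simpa using h⟩

/-- Multiplication by `z₀` translates the first index, which is invertible, so clearing denominators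
loses nothing on the iterate side. -/
theorem localR_unique {e : Γ → ℂ → ℂ} (h : (0, e) ∈ S.localR) : e = 0 := by
  obtain ⟨K, hK⟩ := h
  rw [map_zero] at hK
  have := S.R_unique _ hK
  ext n r
  have h2 := congrFun (congrFun this (n - K)) r
  rwa [firstShift_pow, sub_add_cancel] at h2

/-- Negative powers of `z₁ - z₂` do not act within `R`, but multiplying by a high enough power
returns to `mem_diffOp_pow`. This is the purpose of `localR`. -/
theorem binomialMul_mem_localR {c e : Γ → ℂ → ℂ} (h : (c, e) ∈ S.R)
    (hc : ∀ r, ∃ J : ℕ, ∀ n, ∀ j : ℕ, J ≤ j → c n (r + j) = 0) (k : ℤ) :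
    (binomialMul k c, fun n r => e (n + k) r) ∈ S.localR := by
  refine ⟨(-k).toNat, ?_⟩
  -- The cleared exponent is nonnegative; it is zero when `k` is negative and `k` itself otherwise.
  have hk : k + ((-k).toNat : ℤ) = (k.toNat : ℤ) := by omega
  have h1 := S.mem_diffOp_pow h k.toNat
  simp only
  rw [← binomialMul_add_nat hc, hk, ← zero_add (k.toNat : ℤ), binomialMul_add_nat hc,
    binomialMul_zero]
  convert h1 using 2
  ext n r
  rw [firstShift_pow, firstShift_pow]
  have := congrArg (Int.cast : ℤ → Γ) hk
  push_cast at this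
  rw [← this]; ring_nf

theorem prodCoeff_trunc (φ : Module.Dual ℂ U₄) (w₁ : U₁) (w₂ : U₂) (w₃ : U₃) (r : ℂ) :
    ∃ J : ℕ, ∀ n, ∀ j : ℕ, J ≤ j → S.prodCoeff φ w₁ w₂ w₃ n (r + j) = 0 := by
  obtain ⟨J, hJ⟩ := eventually_atTop.1 ((S.I₂_trunc w₂).eventually r w₃)
  exact ⟨J, fun n j hj => by simp only [prodCoeff]; rw [hJ j hj, map_zero, map_zero]⟩

/-- The commutator formula for `I₁`. -/
theorem commutator₁ (w : U₁) (m : ℤ) (n : Γ) (v : U₅) :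
    S.α₄ m (S.I₁ n w v) = S.I₁ n w (S.α₅ m v) +
      psum m fun i => S.I₁ ((m : Γ) + n - (i : Γ)) (S.α₁ i w) v := by
  have := S.jacobi₁ w 0 m n v
  simp only [bracketSum, bsum_zero_left, zero_add] at this
  rw [← this]
  simp

theorem residueAction₂ (w : U₂) (m : ℤ) (n : ℂ) (v : U₃) :
    residueAction S.α₃ S.α₅ m (fun n => S.I₂ n w) n v = S.I₂ n (S.α₂ m w) v := by
  rw [← bracketSum_zero_middle, S.jacobi₂]
  simp

/-- The coefficients agree by the symmetry of the trinomial coefficient, and the common bound makes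
both double sums finite. -/
theorem bsum_psum_comm {X : Type*} [AddCommGroup X] (m : ℤ) {F : ℕ → ℕ → X} {N : ℕ}
    (h : ∀ i j, N ≤ i ∨ N ≤ j → F i j = 0) :
    bsum m (fun j => psum (m - j) fun i => F i j) =
      psum m fun i => bsum (m - i) fun j => F i j := by
  unfold bsum psum
  have h1 : ∀ j, (((-1 : ℤ) ^ j * Ring.choose m j) • ∑ᶠ i, Ring.choose (m - j) i • F i j) =
      ∑ᶠ i, ((-1 : ℤ) ^ j * (Ring.choose m j * Ring.choose (m - j) i)) • F i j := fun j => by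
    rw [finsum_eq_sum_range (N := N) fun i hi => by rw [h i j (Or.inl hi), smul_zero],
      finsum_eq_sum_range (N := N) fun i hi => by rw [h i j (Or.inl hi), smul_zero],
      Finset.smul_sum]
    exact Finset.sum_congr rfl fun i _ => by rw [smul_smul, mul_assoc]
  have h2 : ∀ i, (Ring.choose m i • ∑ᶠ j, ((-1 : ℤ) ^ j * Ring.choose (m - i) j) • F i j) =
      ∑ᶠ j, ((-1 : ℤ) ^ j * (Ring.choose m j * Ring.choose (m - j) i)) • F i j := fun i => by
    rw [finsum_eq_sum_range (N := N) fun j hj => by rw [h i j (Or.inr hj), smul_zero],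
      finsum_eq_sum_range (N := N) fun j hj => by rw [h i j (Or.inr hj), smul_zero],
      Finset.smul_sum]
    exact Finset.sum_congr rfl fun j _ => by
      rw [smul_smul, ← choose_mul_choose_comm m i j]; ring_nf
  simp only [h1, h2]
  exact finsum_comm_of_bound (N := N) fun j i hji => by rw [h i j hji.symm, smul_zero]

/-- The residue action on the product. -/
theorem residueAction_product (w₁ : U₁) (w₂ : U₂) (w₃ : U₃) (m : ℤ) (n : Γ) (r : ℂ) :
    residueAction S.α₃ S.α₄ m (fun r => S.I₁ n w₁ ∘ₗ S.I₂ r w₂) r w₃ =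
      S.I₁ n w₁ (S.I₂ r (S.α₂ m w₂) w₃) +
      psum m fun i => bsum (m - i) fun j =>
        S.I₁ (n + ((m - i : ℤ) : Γ) - j) (S.α₁ i w₁) (S.I₂ (r + j) w₂ w₃) := by
  obtain ⟨N₁, hN₁⟩ := eventually_atTop.1 ((S.I₂_trunc w₂).eventually r w₃)
  obtain ⟨N₂, hN₂⟩ := eventually_atTop.1 (S.trunc₁.eventually' w₁)
  obtain ⟨N₃, hN₃⟩ := eventually_atTop.1 (S.trunc₃.eventually' w₃)
  have hF : ∀ i j : ℕ, max N₁ N₂ ≤ i ∨ max N₁ N₂ ≤ j →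
      S.I₁ (n + ((m - i : ℤ) : Γ) - j) (S.α₁ i w₁) (S.I₂ (r + j) w₂ w₃) = 0 := by
    rintro i j (h | h)
    · rw [hN₂ i (le_trans (le_max_right _ _) h)]; simp
    · rw [hN₁ j (le_trans (le_max_left _ _) h), map_zero]
  -- Each `α₄` is moved past `I₁` by the commutator formula. The resulting `α₅` terms and the `α₃`
  -- terms form the residue action on `I₂`; the commutators form the double sum.
  rw [← bsum_psum_comm m hF, ← S.residueAction₂]
  unfold residueAction
  rw [map_bsum, ← bsum_add]
  · congr 1
    funext j
    simp only [LinearMap.comp_apply, commutator₁, map_sub, map_zsmul]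
    have : ∀ i : ℕ, (((m - j : ℤ) : Γ) + n - i) = n + ((m - i : ℤ) : Γ) - j := fun i => by
      push_cast; ring
    simp only [this]
    abel
  · refine eventually_atTop.2 ⟨max N₁ N₃, fun j hj => ?_⟩
    rw [hN₁ j (le_trans (le_max_left _ _) hj), hN₃ j (le_trans (le_max_right _ _) hj)]
    simp
  · refine eventually_atTop.2 ⟨N₁, fun j hj => ?_⟩
    rw [hN₁ j hj]
    simp
  · refine eventually_atTop.2 ⟨max N₁ N₃, fun j hj => ?_⟩
    rw [hN₁ j (le_trans (le_max_left _ _) hj), hN₃ j (le_trans (le_max_right _ _) hj)]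
    simp

theorem exists_trunc_comp {φ : Module.Dual ℂ U₄} (hφ : φ ∈ S.F) (m : ℤ) :
    ∃ N : ℕ, ∀ j : ℕ, N ≤ j → φ ∘ₗ S.α₄ (m - j) = 0 := by
  obtain ⟨N, hN⟩ := S.F_trunc φ hφ
  exact ⟨(m - N).toNat, fun j hj => hN _ (by omega)⟩

/-- Truncation of `φ ∘ α₄` and of `α₃` on `w₃` bounds the residue by a number of terms independent
of `n` and `r`, so it is one finite combination of related pairs and stays in `R`. -/
theorem residue_mem {φ : Module.Dual ℂ U₄} (hφ : φ ∈ S.F) (w₁ : U₁) (w₂ : U₂) (w₃ : U₃)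
    (m : ℤ) :
    ((fun n r => φ (residueAction S.α₃ S.α₄ m (fun r => S.I₁ n w₁ ∘ₗ S.I₂ r w₂) r w₃),
      fun n r => φ (residueAction S.α₃ S.α₄ m (S.ψ n w₁ w₂) r w₃)) :
        (Γ → ℂ → ℂ) × (Γ → ℂ → ℂ)) ∈ S.R := by
  obtain ⟨N₁, hN₁⟩ := S.exists_trunc_comp hφ m
  obtain ⟨N₂, hN₂⟩ := eventually_atTop.1 (S.trunc₃.eventually' w₃)
  have key : ∀ Φ : ℂ → U₃ →ₗ[ℂ] U₄, TruncatedSeries Φ → ∀ r,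
      φ (residueAction S.α₃ S.α₄ m Φ r w₃) = ∑ j ∈ Finset.range (max N₁ N₂),
        ((-1 : ℤ) ^ j * Ring.choose m j) • ((φ ∘ₗ S.α₄ (m - j)) (Φ (r + (j : ℤ)) w₃)
          - (m.negOnePow : ℤ) • φ (Φ (r + ((m - j : ℤ) : ℂ)) (S.α₃ j w₃))) := by
    intro Φ hΦ r
    unfold residueAction
    rw [map_bsum, bsum_eq_sum (N := max N₁ N₂)]
    · refine Finset.sum_congr rfl fun j _ => ?_
      rw [map_sub, map_zsmul, LinearMap.comp_apply]
      push_cast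
      rw [add_sub_assoc]
    · intro j hj
      have := LinearMap.congr_fun (hN₁ j (le_trans (le_max_left _ _) hj)) (Φ (r + j) w₃)
      rw [LinearMap.comp_apply] at this
      rw [map_sub, this, hN₂ j (le_trans (le_max_right _ _) hj)]
      simp
    · filter_upwards [hΦ.eventually r w₃, S.trunc₃.eventually' w₃] with j h1 h2
      rw [h1, h2]; simp
  have hc : ∀ n, TruncatedSeries fun r => S.I₁ n w₁ ∘ₗ S.I₂ r w₂ := fun n β u => by
    obtain ⟨N, hN⟩ := S.I₂_trunc w₂ β u
    exact ⟨N, fun k hk => by simp only [LinearMap.comp_apply]; rw [hN k hk, map_zero]⟩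
  simp only [key _ (hc _), key _ (S.ψ_trunc' _ w₁ w₂)]
  have := S.R.sum_mem (t := Finset.range (max N₁ N₂)) fun j _ =>
    zsmul_mem (sub_mem (S.R_shift₂ _ _ (S.rel' (S.F_comp φ hφ (m - j)) w₁ w₂ w₃) j)
      (zsmul_mem (S.R_shift₂ _ _ (S.rel' hφ w₁ w₂ (S.α₃ j w₃)) (m - j)) (m.negOnePow : ℤ)))
      ((-1 : ℤ) ^ j * Ring.choose m j)
  convert this using 1
  refine Prod.ext ?_ ?_ <;> funext n r
  · simp [prodCoeff, Prod.fst_sum, Finset.sum_apply]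
  · simp [iterCoeff, Prod.snd_sum, Finset.sum_apply]

/-- The commutator formula for the iterate: the residue action on the modes of `ψ`. -/
theorem residueAction_iterate (w₁ : U₁) (w₂ : U₂) (w₃ : U₃) (m : ℤ) (n : Γ) (r : ℂ) :
    residueAction S.α₃ S.α₄ m (S.ψ n w₁ w₂) r w₃ =
      S.ψ n w₁ (S.α₂ m w₂) r w₃ +
      psum m fun i => S.ψ (n + ((m - i : ℤ) : Γ)) (S.α₁ i w₁) w₂ r w₃ := by
  rw [← sub_eq_zero]
  refine S.F_sep _ fun φ hφ => ?_
  obtain ⟨N, hN⟩ := eventually_atTop.1 (S.trunc₁.eventually' w₁)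
  have h1 := S.mem_localR (S.residue_mem hφ w₁ w₂ w₃ m)
  have h2 := S.mem_localR (S.rel' hφ w₁ (S.α₂ m w₂) w₃)
  have h3 := S.localR.sum_mem (t := Finset.range N) fun i _ => zsmul_mem
    (S.binomialMul_mem_localR (S.rel' hφ (S.α₁ i w₁) w₂ w₃)
      (S.prodCoeff_trunc φ (S.α₁ i w₁) w₂ w₃) (m - i)) (Ring.choose m i)
  have h4 := sub_mem h1 (add_mem h2 h3)
  have hev : ∀ X : ℕ → U₄, (∀ i, N ≤ i → X i = 0) →
      φ (psum m X) = ∑ i ∈ Finset.range N, Ring.choose m i • φ (X i) := fun X hX => by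
    rw [psum_eq_sum m hX, map_sum]
    exact Finset.sum_congr rfl fun i _ => map_zsmul _ _ _
  -- The product partner of this defect is zero by `residueAction_product`: each inner sum there is
  -- `(z₁-z₂)^(m-i)` times a product, whose iterate partner is shifted by `m - i` in `z₀`.
  have h5 := S.localR_unique (e := fun n r => φ (residueAction S.α₃ S.α₄ m (S.ψ n w₁ w₂) r w₃ -
    (S.ψ n w₁ (S.α₂ m w₂) r w₃ +
      psum m fun i => S.ψ (n + ((m - i : ℤ) : Γ)) (S.α₁ i w₁) w₂ r w₃))) (by
    convert h4 using 1
    refine Prod.ext ?_ ?_ <;> funext n r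
    · simp only [residueAction_product, Pi.zero_apply, Prod.fst_sub, Prod.fst_add, Prod.fst_sum,
        Pi.sub_apply, Pi.add_apply, Finset.sum_apply, Prod.smul_fst, Pi.smul_apply]
      rw [map_add, hev _ fun i hi => by rw [hN i hi]; simp]
      simp only [prodCoeff, binomialMul]
      rw [eq_comm, sub_eq_zero]
      congr 1
      refine Finset.sum_congr rfl fun i _ => ?_
      rw [map_bsum]
      filter_upwards [(S.I₂_trunc w₂).eventually r w₃] with j hj
      rw [hj, map_zero]
    · simp only [Prod.snd_sub, Prod.snd_add, Prod.snd_sum,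
        Pi.sub_apply, Pi.add_apply, Finset.sum_apply, Prod.smul_snd, Pi.smul_apply]
      rw [map_sub, map_add, hev _ fun i hi => by rw [hN i hi]; simp]
      simp [iterCoeff])
  exact congrFun (congrFun h5 n) r

end AssociativitySystem

end VertexAssoc

/-! ### The substitution `z₁ = z₀ + z₂` and rearrangements of double sums. -/

namespace VertexAssoc

set_option linter.unusedSectionVars false

open Filter

section Shifts

variable {Γ : Type*} [CommRing Γ]

/-- Multiplication by the second variable in terms of modes. -/
def secondShift : Module.End ℂ (Γ → ℂ → ℂ) where
  toFun c n r := c n (r + 1)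
  map_add' _ _ := rfl
  map_smul' _ _ := rfl

theorem secondShift_pow (K : ℕ) (e : Γ → ℂ → ℂ) (n : Γ) (r : ℂ) :
    (secondShift ^ K) e n r = e n (r + K) := by
  induction K generalizing r with
  | zero => simp
  | succ K ih =>
    rw [pow_succ', Module.End.mul_apply]
    change (secondShift ^ K) e n (r + 1) = _
    rw [ih]; push_cast; ring_nf

theorem commute_shifts : Commute (firstShift : Module.End ℂ (Γ → ℂ → ℂ)) secondShift := rfl

/-- The substitution `z₁ ↦ z₀ + z₂` for multiplication by the first variable. -/
def sumShift : Module.End ℂ (Γ → ℂ → ℂ) := firstShift + secondShift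

theorem shift_add_pow (j : ℕ) (e : Γ → ℂ → ℂ) (n : Γ) (r : ℂ) :
    (sumShift ^ j) e n r =
      ∑ i ∈ Finset.range (j + 1), (j.choose i : ℤ) • e (n + i) (r + (j - i : ℕ)) := by
  rw [sumShift, commute_shifts.add_pow, LinearMap.sum_apply, Finset.sum_apply, Finset.sum_apply]
  refine Finset.sum_congr rfl fun i _ => ?_
  rw [mul_assoc, ← (Nat.cast_commute (j.choose i) _).eq, ← nsmul_eq_mul, mul_smul_comm,
    LinearMap.smul_apply, Pi.smul_apply, Pi.smul_apply, Module.End.mul_apply, firstShift_pow,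
    secondShift_pow, natCast_zsmul]

/-- The binomial theorem for `((z₀ + z₂) - z₂)^m = z₀^m`, with `(z₀ + z₂)^p` carried along. -/
theorem alternating_shift (m p : ℕ) (f : Γ → ℂ → ℂ) (n : Γ) (r : ℂ) :
    ∑ i ∈ Finset.range (m + 1), ((-1 : ℤ) ^ i * (m.choose i : ℤ)) •
      (sumShift ^ (m - i + p)) f n (r + i) =
    (sumShift ^ p) f (n + m) r := by
  have h : (-secondShift (Γ := Γ) + sumShift) ^ m * sumShift ^ p =
      firstShift ^ m * (sumShift ^ p : Module.End ℂ (Γ → ℂ → ℂ)) := by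
    congr 2; rw [sumShift]; abel
  have hc : Commute (-secondShift : Module.End ℂ (Γ → ℂ → ℂ)) sumShift :=
    ((commute_shifts (Γ := Γ)).symm.add_right (Commute.refl _)).neg_left
  have h' := congrFun (congrFun (LinearMap.congr_fun h f) n) r
  rw [hc.add_pow, Finset.sum_mul, LinearMap.sum_apply, Finset.sum_apply, Finset.sum_apply,
    Module.End.mul_apply, firstShift_pow] at h'
  rw [← h']
  refine Finset.sum_congr rfl fun i _ => ?_
  have h1 : (-secondShift (Γ := Γ)) ^ i = ((-1 : ℤ) ^ i) • secondShift ^ i := by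
    rw [← neg_one_smul ℤ (secondShift (Γ := Γ)), smul_pow]
  have h2 : (-secondShift (Γ := Γ)) ^ i * sumShift ^ (m - i) * (m.choose i : Module.End ℂ _) *
      sumShift ^ p = ((-1 : ℤ) ^ i * (m.choose i : ℤ)) •
        (secondShift ^ i * sumShift ^ (m - i + p)) := by
    rw [h1, ← (Nat.cast_commute (m.choose i) _).eq, mul_smul, natCast_zsmul, nsmul_eq_mul, pow_add]
    simp only [smul_mul_assoc, mul_assoc, mul_smul_comm]
  rw [h2, LinearMap.smul_apply, Pi.smul_apply, Pi.smul_apply, Module.End.mul_apply,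
    secondShift_pow]

end Shifts

section Sums

variable {X : Type*} [AddCommGroup X]

theorem bsum_finset_sum {ι : Type*} (s : Finset ι) (l : ℤ) {f : ι → ℕ → X}
    (hf : ∀ b ∈ s, ∀ᶠ i in atTop, f b i = 0) :
    bsum l (fun i => ∑ b ∈ s, f b i) = ∑ b ∈ s, bsum l (f b) := by
  unfold bsum
  simp only [Finset.smul_sum]
  exact finsum_sum_comm s _ fun b hb => finite_support_of_eventually (eventually_smul (hf b hb))

/-- Two expansions of `(1 - x - y)^l`: in `x` and then `y`, or in `x + y`. The sum is regrouped
along the diagonals `i + i' = j`. -/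
theorem bsum_bsum_eq (l : ℤ) {G : ℕ → ℕ → X} {N : ℕ} (hG : ∀ i i', N ≤ i + i' → G i i' = 0) :
    bsum l (fun i => bsum (l - i) fun i' => G i i') =
      ∑ j ∈ Finset.range N, ((-1 : ℤ) ^ j * Ring.choose l j) •
        ∑ i ∈ Finset.range (j + 1), (j.choose i : ℤ) • G i (j - i) := by
  have h1 := Finset.sum_range_diag_flip N fun i i' =>
    ((-1 : ℤ) ^ (i + i') * Ring.choose l (i + i') * ((i + i').choose i : ℤ)) • G i i'
  have h2 : ∀ j ∈ Finset.range N, ((-1 : ℤ) ^ j * Ring.choose l j) •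
        ∑ i ∈ Finset.range (j + 1), (j.choose i : ℤ) • G i (j - i) =
      ∑ i ∈ Finset.range (j + 1), ((-1 : ℤ) ^ (i + (j - i)) * Ring.choose l (i + (j - i)) *
        ((i + (j - i)).choose i : ℤ)) • G i (j - i) := fun j _ => by
    rw [Finset.smul_sum]
    refine Finset.sum_congr rfl fun i hi => ?_
    rw [smul_smul, Nat.add_sub_cancel' (Nat.lt_succ_iff.1 (Finset.mem_range.1 hi))]
  rw [Finset.sum_congr rfl h2, h1, bsum_eq_sum (N := N)]
  · refine Finset.sum_congr rfl fun i _ => ?_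
    rw [bsum_eq_sum (N := N - i) _ fun i' hi' => hG _ _ (by omega), Finset.smul_sum]
    refine Finset.sum_congr rfl fun i' _ => ?_
    rw [smul_smul]
    congr 1
    rw [pow_add]
    linear_combination ((-1 : ℤ) ^ i * (-1) ^ i') * choose_mul_choose l i i'
  · intro i hi
    have : (fun i' => G i i') = fun _ => 0 := funext fun i' => hG _ _ (by omega)
    rw [this, bsum_zero_right]

/-- Two expansions of `(1 + x + y)^M`, as a power of `1 + (x + y)` and of `x + (1 + y)`. -/
theorem sum_choose_diag (M : ℕ) (G : ℕ → ℕ → X) :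
    ∑ j ∈ Finset.range (M + 1), (M.choose j : ℤ) •
      ∑ k ∈ Finset.range (j + 1), (j.choose k : ℤ) • G k (j - k) =
    ∑ k ∈ Finset.range (M + 1), (M.choose k : ℤ) •
      ∑ i ∈ Finset.range (M - k + 1), ((M - k).choose i : ℤ) • G k i := by
  have h1 := Finset.sum_range_diag_flip (M + 1) fun k i =>
    ((M.choose (k + i) : ℤ) * ((k + i).choose k : ℤ)) • G k i
  have h2 : ∀ j ∈ Finset.range (M + 1), (M.choose j : ℤ) •
      ∑ k ∈ Finset.range (j + 1), (j.choose k : ℤ) • G k (j - k) =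
      ∑ k ∈ Finset.range (j + 1), ((M.choose (k + (j - k)) : ℤ) *
        ((k + (j - k)).choose k : ℤ)) • G k (j - k) := fun j _ => by
    rw [Finset.smul_sum]
    refine Finset.sum_congr rfl fun i hi => ?_
    rw [smul_smul, Nat.add_sub_cancel' (Nat.lt_succ_iff.1 (Finset.mem_range.1 hi))]
  rw [Finset.sum_congr rfl h2, h1]
  refine Finset.sum_congr rfl fun k hk => ?_
  have hk : k ≤ M := Nat.lt_succ_iff.1 (Finset.mem_range.1 hk)
  rw [Finset.smul_sum, Nat.succ_sub hk]
  refine Finset.sum_congr rfl fun i hi => ?_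
  have hi : i ≤ M - k := Nat.lt_succ_iff.1 (Finset.mem_range.1 hi)
  rw [smul_smul, ← Nat.cast_mul, ← Nat.cast_mul, Nat.choose_mul
    (Nat.le_add_right k i), Nat.add_sub_cancel_left]

end Sums

end VertexAssoc

/-! ### The Jacobi identity for the iterate. -/

namespace VertexAssoc

set_option linter.unusedSectionVars false

open Filter

namespace AssociativitySystem

variable {Γ U₁ U₂ U₃ U₄ U₅ : Type*} [CommRing Γ] [AddCommGroup U₁]
    [Module ℂ U₁] [AddCommGroup U₂] [Module ℂ U₂] [AddCommGroup U₃] [Module ℂ U₃]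
    [AddCommGroup U₄] [Module ℂ U₄] [AddCommGroup U₅] [Module ℂ U₅]
    (S : AssociativitySystem Γ U₁ U₂ U₃ U₄ U₅)

/-- The difference of the two sides of the Jacobi identity for `ψ`. -/
noncomputable def iterDefect (w₁ : U₁) (w₂ : U₂) (r : ℂ) (u : U₃) (l m : ℤ) (n : Γ) : U₄ :=
  bsum l (fun i => residueAction S.α₃ S.α₄ (m + l - i) (S.ψ (n + (i : Γ)) w₁ w₂) r u
    - (l.negOnePow : ℤ) • S.ψ (n + (l : Γ) - (i : Γ)) w₁ (S.α₂ (m + i) w₂) r u)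
  - psum m fun i => S.ψ ((m : Γ) + n - (i : Γ)) (S.α₁ (l + i) w₁) w₂ r u

@[simp] theorem residueAction_zero (m : ℤ) (r : ℂ) (u : U₃) :
    residueAction S.α₃ S.α₄ m (0 : ℂ → U₃ →ₗ[ℂ] U₄) r u = 0 := by
  simp [residueAction]

theorem eventually_ψ (w₁ : U₁) (w₂ : U₂) (n : Γ) :
    ∀ᶠ i : ℕ in atTop, S.ψ (n + (i : Γ)) w₁ w₂ = 0 := by
  obtain ⟨N, hN⟩ := S.ψ_trunc w₁ w₂ n
  refine eventually_atTop.2 ⟨N.toNat, fun i hi => ?_⟩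
  have := hN i (by omega)
  rwa [Int.cast_natCast] at this

theorem eventually_residue (w₁ : U₁) (w₂ : U₂) (r : ℂ) (u : U₃) (M : ℕ → ℤ) (n : Γ) :
    ∀ᶠ i : ℕ in atTop, residueAction S.α₃ S.α₄ (M i) (S.ψ (n + (i : Γ)) w₁ w₂) r u = 0 :=
  (S.eventually_ψ w₁ w₂ n).mono fun i hi => by rw [hi, residueAction_zero]

theorem eventually_snd (w₁ : U₁) (w₂ : U₂) (r : ℂ) (u : U₃) (m : ℤ) (N : ℕ → Γ) :
    ∀ᶠ i : ℕ in atTop, S.ψ (N i) w₁ (S.α₂ (m + i) w₂) r u = 0 :=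
  (S.trunc₂.eventually m w₂).mono fun i hi => by rw [hi]; simp

theorem eventually_fst (w₁ : U₁) (w₂ : U₂) (r : ℂ) (u : U₃) (m : ℤ) (N : ℕ → Γ) :
    ∀ᶠ i : ℕ in atTop, S.ψ (N i) (S.α₁ (m + i) w₁) w₂ r u = 0 :=
  (S.trunc₁.eventually m w₁).mono fun i hi => by rw [hi]; simp

theorem iterDefect_eq (w₁ : U₁) (w₂ : U₂) (r : ℂ) (u : U₃) (l m : ℤ) (n : Γ) :
    S.iterDefect w₁ w₂ r u l m n =
      bsum l (fun i => residueAction S.α₃ S.α₄ (m + l - i) (S.ψ (n + (i : Γ)) w₁ w₂) r u)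
      - (l.negOnePow : ℤ) •
        bsum l (fun i => S.ψ (n + (l : Γ) - (i : Γ)) w₁ (S.α₂ (m + i) w₂) r u)
      - psum m fun i => S.ψ ((m : Γ) + n - (i : Γ)) (S.α₁ (l + i) w₁) w₂ r u := by
  unfold iterDefect
  rw [bsum_sub l (S.eventually_residue _ _ _ _ _ _) (eventually_smul (S.eventually_snd _ _ _ _ _ _)),
    bsum_smul _ _ (S.eventually_snd _ _ _ _ _ _)]

/-- Pascal's rule in all three sums at once, which makes `eq_zero_of_recursion` available. -/
theorem iterDefect_succ (w₁ : U₁) (w₂ : U₂) (r : ℂ) (u : U₃) (l m : ℤ) (n : Γ) :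
    S.iterDefect w₁ w₂ r u (l + 1) m n =
      S.iterDefect w₁ w₂ r u l (m + 1) n - S.iterDefect w₁ w₂ r u l m (n + 1) := by
  simp only [iterDefect_eq]
  rw [bsum_succ l (S.eventually_residue _ _ _ _ _ _), bsum_succ l (S.eventually_snd _ _ _ _ _ _),
    psum_succ m (S.eventually_fst _ _ _ _ _ _), Int.negOnePow_succ, Units.val_neg]
  have e1 : ∀ i : ℕ, m + (l + 1) - i = m + 1 + l - i := fun i => by ring
  have e2 : ∀ i : ℕ, m + (l + 1) - (i + 1 : ℕ) = m + l - i := fun i => by push_cast; ring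
  have e3 : ∀ i : ℕ, n + ((i + 1 : ℕ) : Γ) = n + 1 + i := fun i => by push_cast; ring
  have e4 : ∀ i : ℕ, n + ((l + 1 : ℤ) : Γ) - (i : Γ) = n + 1 + l - i := fun i => by
    push_cast; ring
  have e5 : ∀ i : ℕ, n + ((l + 1 : ℤ) : Γ) - ((i + 1 : ℕ) : Γ) = n + l - i := fun i => by
    push_cast; ring
  have e6 : ∀ i : ℕ, m + ((i + 1 : ℕ) : ℤ) = m + 1 + i := fun i => by push_cast; ring
  have e7 : ∀ i : ℕ, ((m + 1 : ℤ) : Γ) + n - i = m + (n + 1) - i := fun i => by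
    push_cast; ring
  have e8 : ∀ i : ℕ, ((m + 1 : ℤ) : Γ) + n - (i + 1 : ℕ) = m + n - i := fun i => by
    push_cast; ring
  have e9 : ∀ i : ℕ, l + ((i + 1 : ℕ) : ℤ) = l + 1 + i := fun i => by push_cast; ring
  simp only [e2, e3, e5, e6, e8, e9]
  simp only [e1, e4, e7]
  module

theorem mem_sumShift_pow {c e : Γ → ℂ → ℂ} (h : (c, e) ∈ S.R) (j : ℕ) :
    ((fun n r => c (n + j) r, (sumShift ^ j) e) : (Γ → ℂ → ℂ) × (Γ → ℂ → ℂ)) ∈ S.R := by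
  have : ((firstShift ^ j) c, (sumShift ^ j) e) ∈ S.R := by
    induction j with
    | zero => simpa using h
    | succ j ih =>
      rw [pow_succ', pow_succ', Module.End.mul_apply, Module.End.mul_apply]
      exact S.R_shift₁ _ _ ih
  convert this using 2
  ext n r
  rw [firstShift_pow]

/-- The product side of the associativity relation. -/
theorem product_side (w₁ : U₁) (l : ℤ) (M : ℕ) (n : Γ) (v : U₅) :
    bsum l (fun j => S.α₄ (M + l - j) (S.I₁ (n + (j : Γ)) w₁ v)) -
      psum M (fun k => S.I₁ (((M : ℤ) : Γ) + n - (k : Γ)) (S.α₁ (l + k) w₁) v) =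
    (l.negOnePow : ℤ) • bsum l fun j => S.I₁ (n + (l : Γ) - (j : Γ)) w₁ (S.α₅ (M + j) v) := by
  rw [← S.jacobi₁, bracketSum_eq_sub (S.I₁_trunc w₁) S.trunc₅]
  abel

/-- The series whose vanishing after multiplication by a power of `z₂` expresses
associativity. -/
theorem associator_mem {φ : Module.Dual ℂ U₄} (hφ : φ ∈ S.F) (w₁ : U₁) (w₂ : U₂) (w₃ : U₃)
    (l : ℤ) (M N : ℕ) (hN : ∀ j : ℕ, N ≤ j → φ ∘ₗ S.α₄ (M + l - j) = 0) :
    ((fun n r => φ ((l.negOnePow : ℤ) • bsum l fun j =>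
        S.I₁ (n + (l : Γ) - (j : Γ)) w₁ (S.α₅ (M + j) (S.I₂ r w₂ w₃))),
      fun n r => (∑ j ∈ Finset.range N, ((-1 : ℤ) ^ j * Ring.choose l j) •
        (sumShift ^ j) (S.iterCoeff (φ ∘ₗ S.α₄ (M + l - j)) w₁ w₂ w₃) n r) -
        ∑ k ∈ Finset.range (M + 1), (M.choose k : ℤ) •
          (sumShift ^ (M - k)) (S.iterCoeff φ (S.α₁ (l + k) w₁) w₂ w₃) n r) :
        (Γ → ℂ → ℂ) × (Γ → ℂ → ℂ)) ∈ S.R := by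
  have h := sub_mem
    (S.R.sum_mem (t := Finset.range N) fun j _ => zsmul_mem
      (S.mem_sumShift_pow (S.rel' (S.F_comp φ hφ (M + l - j)) w₁ w₂ w₃) j)
      ((-1 : ℤ) ^ j * Ring.choose l j))
    (S.R.sum_mem (t := Finset.range (M + 1)) fun k _ => zsmul_mem
      (S.mem_sumShift_pow (S.rel' hφ (S.α₁ (l + k) w₁) w₂ w₃) (M - k)) (M.choose k : ℤ))
  convert h using 1
  refine Prod.ext ?_ ?_ <;> funext n r
  · change φ ((l.negOnePow : ℤ) • bsum l fun j =>
      S.I₁ (n + (l : Γ) - (j : Γ)) w₁ (S.α₅ (M + j) (S.I₂ r w₂ w₃))) = _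
    rw [← S.product_side, map_sub, map_bsum, psum_natCast, map_sum, bsum_eq_sum (N := N)]
    · simp only [Prod.fst_sub, Prod.fst_sum, Pi.sub_apply, Finset.sum_apply, Prod.smul_fst,
        Pi.smul_apply, prodCoeff, LinearMap.comp_apply, map_zsmul]
      congr 1
      refine Finset.sum_congr rfl fun k hk => ?_
      have hk : k ≤ M := Nat.lt_succ_iff.1 (Finset.mem_range.1 hk)
      rw [Nat.cast_sub hk, Int.cast_natCast]
      congr 3
      ring_nf
    · intro j hj
      exact LinearMap.congr_fun (hN j hj) _
    · filter_upwards [(S.I₁_trunc w₁).eventually n (S.I₂ r w₂ w₃)] with j hj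
      rw [hj, map_zero]
  · simp only [Prod.snd_sub, Prod.snd_sum, Pi.sub_apply, Finset.sum_apply, Prod.smul_snd,
        Pi.smul_apply]

/-- The iterate side of the associativity relation, for `M` so large that no term with `α₃`
survives. -/
theorem iterate_side {φ : Module.Dual ℂ U₄} (w₁ : U₁) (w₂ : U₂) (w₃ : U₃)
    (l : ℤ) (M N : ℕ) (hN : ∀ j : ℕ, N ≤ j → φ ∘ₗ S.α₄ (M + l - j) = 0)
    (hM : ∀ i : ℕ, S.α₃ (M + i) w₃ = 0)
    (hloc : ∀ n w₁ w₂, ∃ k : ℤ, ∀ m r u, bracketSum S.α₃ S.α₄ (S.ψ n w₁ w₂) k m r u = 0)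
    (n : Γ) (r : ℂ) :
    (∑ j ∈ Finset.range N, ((-1 : ℤ) ^ j * Ring.choose l j) •
        (sumShift ^ j) (S.iterCoeff (φ ∘ₗ S.α₄ (M + l - j)) w₁ w₂ w₃) n r) -
        ∑ k ∈ Finset.range (M + 1), (M.choose k : ℤ) •
          (sumShift ^ (M - k)) (S.iterCoeff φ (S.α₁ (l + k) w₁) w₂ w₃) n r =
      (sumShift ^ M) (fun (j : ℤ) r => φ (bsum l (fun i =>
        residueAction S.α₃ S.α₄ (j + l - i) (S.ψ (n + (i : Γ)) w₁ w₂) r w₃) -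
        psum j fun i => S.ψ ((j : Γ) + n - (i : Γ)) (S.α₁ (l + i) w₁) w₂ r w₃)) 0 r := by
  simp only [shift_add_pow, zero_add, map_sub, smul_sub, Finset.sum_sub_distrib]
  congr 1
  · have hG : ∀ i i' : ℕ, N ≤ i + i' →
        φ (S.α₄ (M + l - i - i') (S.ψ (n + (i : Γ)) w₁ w₂ (r + i') w₃)) = 0 := fun i i' h => by
      have := LinearMap.congr_fun (hN (i + i') h) (S.ψ (n + (i : Γ)) w₁ w₂ (r + i') w₃)
      rw [Nat.cast_add, ← sub_sub] at this
      exact this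
    -- The powers `(z₀ + z₂)^j` are regrouped so that, for each fixed `z₀` mode, the sum over `i'`
    -- is a bracket of `ψ`.
    have h1 := bsum_bsum_eq l hG
    have h2 : ∀ i : ℕ, (bsum (l - i) fun i' : ℕ =>
        φ (S.α₄ (M + l - i - i') (S.ψ (n + (i : Γ)) w₁ w₂ (r + i') w₃))) =
        ∑ j ∈ Finset.range (M + 1), (M.choose j : ℤ) •
          φ (residueAction S.α₃ S.α₄ (j + l - i) (S.ψ (n + (i : Γ)) w₁ w₂)
            (r + (M - j : ℕ)) w₃) := fun i => by
      obtain ⟨k, hk⟩ := hloc (n + i) w₁ w₂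
      -- Weak commutativity gives the Jacobi identity with outer order `l - i` and middle index `M`;
      -- by the choice of `M` the reversed product is absent, and only residue actions remain.
      have := bracketSum_eq_of_locality (S.ψ_trunc' (n + i) w₁ w₂) S.trunc₃ hk (l - i) M r w₃
      rw [bracketSum_eq_sub (S.ψ_trunc' (n + i) w₁ w₂) S.trunc₃] at this
      have h0 : (fun i_1 : ℕ => S.ψ (n + (i : Γ)) w₁ w₂ (r + ((l - i : ℤ) : ℂ) - i_1)
          (S.α₃ (M + i_1) w₃)) = fun _ => 0 := funext fun j => by rw [hM, map_zero]
      rw [h0, bsum_zero_right, smul_zero, sub_zero, psum_natCast] at this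
      have h3 := congrArg φ this
      rw [map_bsum φ _ (eventually_left (S.ψ_trunc' _ _ _) _ _ _), map_sum] at h3
      simp only [map_zsmul] at h3
      simp only [← add_sub_assoc] at h3
      rw [h3]
      refine Finset.sum_congr rfl fun j hj => ?_
      have hj : j ≤ M := Nat.lt_succ_iff.1 (Finset.mem_range.1 hj)
      rw [Nat.cast_sub hj, Int.cast_natCast]
      ring_nf
    simp only [h2] at h1
    simp only [iterCoeff, LinearMap.comp_apply]
    have h4 : ∀ j ∈ Finset.range N, ((-1 : ℤ) ^ j * Ring.choose l j) •
        ∑ i ∈ Finset.range (j + 1), (j.choose i : ℤ) •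
          φ (S.α₄ (M + l - j) (S.ψ (n + (i : Γ)) w₁ w₂ (r + (j - i : ℕ)) w₃)) =
        ((-1 : ℤ) ^ j * Ring.choose l j) •
        ∑ i ∈ Finset.range (j + 1), (j.choose i : ℤ) •
          φ (S.α₄ (M + l - i - (j - i : ℕ)) (S.ψ (n + (i : Γ)) w₁ w₂ (r + (j - i : ℕ)) w₃)) :=
      fun j _ => by
        congr 1
        refine Finset.sum_congr rfl fun i hi => ?_
        have hi : i ≤ j := Nat.lt_succ_iff.1 (Finset.mem_range.1 hi)
        rw [show (M : ℤ) + l - i - (j - i : ℕ) = M + l - j by omega]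
    rw [Finset.sum_congr rfl h4, ← h1, bsum_finset_sum]
    · refine Finset.sum_congr rfl fun j _ => ?_
      rw [bsum_smul, map_bsum]
      · exact S.eventually_residue _ _ _ _ _ _
      · filter_upwards [S.eventually_residue w₁ w₂ (r + (M - j : ℕ)) w₃ (fun i => j + l - i) n]
          with i hi
        rw [hi, map_zero]
    · intro j _
      filter_upwards [S.eventually_residue w₁ w₂ (r + (M - j : ℕ)) w₃ (fun i => j + l - i) n]
          with i hi
      rw [hi, map_zero, smul_zero]
  · have h1 := sum_choose_diag M fun k i : ℕ =>
      φ (S.ψ (n + (i : Γ)) (S.α₁ (l + k) w₁) w₂ (r + (M - k - i : ℕ)) w₃)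
    simp only [iterCoeff]
    rw [← h1]
    refine Finset.sum_congr rfl fun j hj => ?_
    rw [psum_natCast, map_sum]
    congr 1
    refine Finset.sum_congr rfl fun i hi => ?_
    have hi : i ≤ j := Nat.lt_succ_iff.1 (Finset.mem_range.1 hi)
    have hj : j ≤ M := Nat.lt_succ_iff.1 (Finset.mem_range.1 hj)
    rw [map_zsmul, Nat.cast_sub hi, Int.cast_natCast, show M - i - (j - i) = M - j by omega,
      show (j : Γ) + n - i = n + (j - i) by ring]

/-- The Jacobi identity for the iterate. -/
theorem iterDefect_eq_zero
    (hloc : ∀ n w₁ w₂, ∃ k : ℤ, ∀ m r u, bracketSum S.α₃ S.α₄ (S.ψ n w₁ w₂) k m r u = 0)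
    (w₁ : U₁) (w₂ : U₂) (r : ℂ) (w₃ : U₃) (l m : ℤ) (n : Γ) :
    S.iterDefect w₁ w₂ r w₃ l m n = 0 := by
  obtain ⟨m₀, hm₀⟩ := eventually_atTop.1 (S.trunc₂.eventually' w₂)
  obtain ⟨p, hp⟩ := eventually_atTop.1 (S.trunc₃.eventually' w₃)
  -- At `l = 0` the identity is the commutator formula, and the recursion extends it to `l ≥ 0`. For
  -- general `l` a single middle index `m₀`, beyond which `α₂` kills `w₂`, suffices.
  refine eq_zero_of_recursion (d := S.iterDefect w₁ w₂ r w₃) (S.iterDefect_succ w₁ w₂ r w₃) 0 m₀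
    ?_ ?_ l m n
  · intro l hl
    induction l, hl using Int.leInduction with
    | base =>
      intro m n
      rw [iterDefect_eq]
      simp only [bsum_zero_left, Int.negOnePow_zero, Units.val_one, one_smul, add_zero,
        Nat.cast_zero, sub_zero, Int.cast_zero, zero_add]
      rw [residueAction_iterate, sub_sub, sub_eq_zero]
      congr 2
      funext i
      push_cast
      ring_nf
    | succ l _ ih => intro m n; rw [iterDefect_succ, ih, ih, sub_zero]
  · intro l n
    have hF : ∀ m : ℕ, m₀ ≤ m → ∀ r, S.iterDefect w₁ w₂ r w₃ l m n =
        bsum l (fun i => residueAction S.α₃ S.α₄ (m + l - i) (S.ψ (n + (i : Γ)) w₁ w₂) r w₃) -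
          psum m fun i => S.ψ (((m : ℤ) : Γ) + n - (i : Γ)) (S.α₁ (l + i) w₁) w₂ r w₃ := by
      intro m hm r
      rw [iterDefect_eq]
      have : (fun i : ℕ => S.ψ (n + (l : Γ) - (i : Γ)) w₁ (S.α₂ (m + i) w₂) r w₃) =
          fun _ => 0 := funext fun i => by
        rw [← Nat.cast_add, hm₀ _ (by omega)]; simp
      rw [this, bsum_zero_right, smul_zero, sub_zero]
    -- For very large `m` each term vanishes: residue actions of high order by weak commutativity,
    -- the `ψ` terms by truncation in `z₀`.
    have hbig : ∃ B : ℕ, ∀ m : ℕ, B ≤ m → m₀ ≤ m → ∀ r, S.iterDefect w₁ w₂ r w₃ l m n = 0 := by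
      obtain ⟨N₁, hN₁⟩ := eventually_atTop.1 (S.eventually_ψ w₁ w₂ n)
      have hk : ∀ i : ℕ, ∃ K : ℤ, ∀ l', K ≤ l' → ∀ r u,
          residueAction S.α₃ S.α₄ l' (S.ψ (n + (i : Γ)) w₁ w₂) r u = 0 := fun i => by
        obtain ⟨k, hk⟩ := hloc (n + i) w₁ w₂
        exact ⟨k, fun l' hl' => residueAction_eq_zero_of_le (S.ψ_trunc' _ _ _) S.trunc₃ hk hl'⟩
      choose K hK using hk
      obtain ⟨N₂, hN₂⟩ := eventually_atTop.1 (S.trunc₁.eventually l w₁)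
      have hk' : ∀ i : ℕ, ∃ B : ℤ, ∀ k : ℤ, B ≤ k →
          S.ψ (n - (i : Γ) + k) (S.α₁ (l + i) w₁) w₂ = 0 := fun i => S.ψ_trunc _ _ _
      choose B hB using hk'
      -- Only finitely many `i` contribute, each with its own threshold; the sum of the thresholds
      -- dominates every one of them.
      refine ⟨(∑ i ∈ Finset.range N₁, (K i - l + i).toNat) +
        ∑ i ∈ Finset.range N₂, (B i).toNat, fun m hm hm' r => ?_⟩
      rw [hF m hm']
      have h1 : (fun i : ℕ => residueAction S.α₃ S.α₄ (m + l - i)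
          (S.ψ (n + (i : Γ)) w₁ w₂) r w₃) = fun _ => 0 := funext fun i => by
        rcases lt_or_ge i N₁ with hi | hi
        · refine hK i _ ?_ _ _
          have := Finset.single_le_sum (f := fun i : ℕ => (K i - l + i).toNat)
            (fun _ _ => Nat.zero_le _) (Finset.mem_range.2 hi)
          omega
        · rw [hN₁ i hi, residueAction_zero]
      have h2 : (fun i : ℕ => S.ψ (((m : ℤ) : Γ) + n - (i : Γ)) (S.α₁ (l + i) w₁) w₂ r w₃) =
          fun _ => 0 := funext fun i => by
        rcases lt_or_ge i N₂ with hi | hi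
        · have := Finset.single_le_sum (f := fun i : ℕ => (B i).toNat)
            (fun _ _ => Nat.zero_le _) (Finset.mem_range.2 hi)
          have h3 := hB i m (by omega)
          rw [show ((m : ℤ) : Γ) + n - (i : Γ) = n - (i : Γ) + ((m : ℤ) : Γ) by ring, h3]
          simp
        · rw [hN₂ i hi]; simp
      rw [h1, h2, bsum_zero_right, psum_zero_right, sub_zero]
    -- Associativity: `p` annihilating order of `α₃` on `w₃` gives a factor that is a `p`-th power
    -- of a sum of two shifts, and the defect vanishes after this multiplication. It ties the defect
    -- at `m` to those at `m + 1, …, m + p`.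
    have hsum : ∀ φ ∈ S.F, ∀ m : ℕ, m₀ ≤ m → ∀ r,
        ∑ j ∈ Finset.range (p + 1), (p.choose j : ℤ) •
          φ (S.iterDefect w₁ w₂ (r + (p - j : ℕ)) w₃ l ((m + j : ℕ) : ℤ) n) = 0 := by
      intro φ hφ m hm r
      have hN : ∃ N : ℕ, ∀ M : ℕ, M ≤ m + p → ∀ j : ℕ, N ≤ j →
          φ ∘ₗ S.α₄ (M + l - j) = 0 := by
        obtain ⟨N, hN⟩ := S.F_trunc φ hφ
        exact ⟨(m + p + l - N).toNat, fun M hM j hj => hN _ (by omega)⟩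
      obtain ⟨N, hN⟩ := hN
      -- Signed binomial weights, together with multiplication by `z₂^i`, imitate a factor of
      -- difference type to the power `m`. On the product side this produces the bracket of `I₂` of
      -- order `m`.
      have h := S.R.sum_mem (t := Finset.range (m + 1)) fun i _ => zsmul_mem
        (S.R_shift₂ _ _ (S.associator_mem hφ w₁ w₂ w₃ l (m - i + p) N (hN _ (by omega))) i)
        ((-1 : ℤ) ^ i * (m.choose i : ℤ))
      have hz : ∀ i, ∀ n r, _ := fun i n r => S.iterate_side (φ := φ) w₁ w₂ w₃ l (m - i + p) N
        (hN _ (by omega)) (fun i' => by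
          rw [← Nat.cast_add]; exact hp _ (by omega)) hloc n r
      simp only [hz] at h
      have h' := S.R_unique (fun n r => ∑ i ∈ Finset.range (m + 1),
          ((-1 : ℤ) ^ i * (m.choose i : ℤ)) • (sumShift ^ (m - i + p)) (fun (j : ℤ) r =>
          φ (bsum l (fun i =>
            residueAction S.α₃ S.α₄ (j + l - i) (S.ψ (n + (i : Γ)) w₁ w₂) r w₃) -
          psum j fun i => S.ψ ((j : Γ) + n - (i : Γ)) (S.α₁ (l + i) w₁) w₂ r w₃)) 0 (r + i)) (by
        convert h using 1
        refine Prod.ext ?_ ?_ <;> funext n r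
        · simp only [Prod.fst_sum, Finset.sum_apply, Prod.smul_fst, Pi.smul_apply,
            Pi.zero_apply]
          have h0 : ∀ j : ℕ, ∑ i ∈ Finset.range (m + 1), ((-1 : ℤ) ^ i * (m.choose i : ℤ)) •
              S.I₁ (n + (l : Γ) - (j : Γ)) w₁
                (S.α₅ ((m - i + p : ℕ) + j) (S.I₂ (r + (i : ℤ)) w₂ w₃)) = 0 := fun j => by
            -- With order `m ≥ m₀` and middle index at least `p`, both the `α₂` and the `α₃` terms
            -- vanish, so the product side is zero.
            have h1 := S.jacobi₂ w₂ m (p + j) r w₃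
            rw [bracketSum_eq_sub (S.I₂_trunc w₂) S.trunc₃] at h1
            have e1 : (fun i : ℕ => S.I₂ (r + ((m : ℤ) : ℂ) - i) w₂ (S.α₃ (p + j + i) w₃)) =
                fun _ => 0 := funext fun i => by
              rw [← Nat.cast_add, ← Nat.cast_add, hp _ (by omega), map_zero]
            have e2 : (fun i : ℕ => S.I₂ (((p + j : ℤ) : ℂ) + r - i) (S.α₂ (m + i) w₂) w₃) =
                fun _ => 0 := funext fun i => by
              have := hm₀ (m + i) (by omega)
              rw [Nat.cast_add] at this
              rw [this]; simp
            rw [e1, e2, bsum_zero_right, psum_zero_right, smul_zero, sub_zero, bsum_natCast] at h1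
            have h2 := congrArg (S.I₁ (n + (l : Γ) - (j : Γ)) w₁) h1
            rw [map_zero, map_sum] at h2
            rw [← h2]
            refine Finset.sum_congr rfl fun i hi => ?_
            have hi : i ≤ m := Nat.lt_succ_iff.1 (Finset.mem_range.1 hi)
            rw [map_zsmul, Int.cast_natCast]
            congr 4
            omega
          simp only [← map_zsmul]
          rw [← map_sum]
          simp only [smul_comm _ (l.negOnePow : ℤ)]
          rw [← Finset.smul_sum]
          have h3 : ∑ i ∈ Finset.range (m + 1), ((-1 : ℤ) ^ i * (m.choose i : ℤ)) •
              (bsum l fun j : ℕ => S.I₁ (n + (l : Γ) - (j : Γ)) w₁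
                (S.α₅ ((m - i + p : ℕ) + j) (S.I₂ (r + (i : ℤ)) w₂ w₃))) = 0 := by
            have hev : ∀ i : ℕ, ∀ᶠ j : ℕ in atTop, S.I₁ (n + (l : Γ) - (j : Γ)) w₁
                (S.α₅ ((m - i + p : ℕ) + j) (S.I₂ (r + (i : ℤ)) w₂ w₃)) = 0 := fun i =>
              eventually_right (Φ := fun n => S.I₁ n w₁) S.trunc₅ _ _ _
            simp only [← bsum_smul _ l (hev _)]
            rw [← bsum_finset_sum _ _ fun i _ => eventually_smul (hev i)]
            simp only [h0, bsum_zero_right]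
          rw [h3, smul_zero, map_zero]
        · simp only [Prod.snd_sum, Finset.sum_apply, Prod.smul_snd, Pi.smul_apply,
            Int.cast_natCast])
      have h2 := congrFun (congrFun h' n) r
      simp only [alternating_shift, zero_add, Pi.zero_apply] at h2
      rw [shift_add_pow] at h2
      rw [← h2]
      refine Finset.sum_congr rfl fun j _ => ?_
      rw [hF (m + j) (by omega), Nat.cast_add]
    obtain ⟨B, hB⟩ := hbig
    -- Descending induction from `B`: in `hsum` only the `j = 0` term, with coefficient one, is not
    -- yet known to vanish.
    have hfin : ∀ m : ℕ, m₀ ≤ m → ∀ r, S.iterDefect w₁ w₂ r w₃ l m n = 0 := by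
      intro m hm
      induction h : B - m using Nat.strong_induction_on generalizing m with
      | _ t ih =>
        intro r
        rcases le_or_gt B m with hBm | hBm
        · exact hB m hBm hm r
        refine S.F_sep _ fun φ hφ => ?_
        -- The `j = 0` term sits at index `r + p`, hence the translation by `-p`.
        have h1 := hsum φ hφ m hm (r - p)
        rw [Finset.sum_range_succ', Finset.sum_eq_zero] at h1
        · simpa using h1
        · intro j _
          rw [ih (B - (m + (j + 1))) (by omega) (m + (j + 1)) (by omega) rfl, map_zero, smul_zero]
    exact hfin m₀ le_rfl r

end AssociativitySystem

end VertexAssoc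

/-! ### Weak commutativity of the modes of the iterate. -/

namespace VertexAssoc

set_option linter.unusedSectionVars false

open Filter

section ThreeVariables

variable {Γ X X' : Type*} [CommRing Γ] [AddCommGroup X] [Module ℂ X] [AddCommGroup X'] [Module ℂ X']

/-- Multiplication by `z - z₂` for series in `z, z₁, z₂`, in terms of modes. -/
def diffOp₀₂ : Module.End ℂ (ℤ → Γ → ℂ → X) where
  toFun F m n r := F (m + 1) n r - F m n (r + 1)
  map_add' F G := by ext; simp; abel
  map_smul' a F := by ext; simp [smul_sub]

/-- Multiplication by `z - z₁` for series in `z, z₁, z₂`, in terms of modes. -/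
def diffOp₀₁ : Module.End ℂ (ℤ → Γ → ℂ → X) where
  toFun F m n r := F (m + 1) n r - F m (n + 1) r
  map_add' F G := by ext; simp; abel
  map_smul' a F := by ext; simp [smul_sub]

/-- Multiplication by `z₁` for series in `z, z₁, z₂`, in terms of modes. -/
def shiftOp₁ : Module.End ℂ (ℤ → Γ → ℂ → X) where
  toFun F m n r := F m (n + 1) r
  map_add' _ _ := rfl
  map_smul' _ _ := rfl

theorem commute_diffOps : Commute (diffOp₀₁ : Module.End ℂ (ℤ → Γ → ℂ → X)) diffOp₀₂ := by
  refine LinearMap.ext fun F => ?_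
  ext m n r
  simp [diffOp₀₁, diffOp₀₂]
  abel

theorem commute_diffOp_shiftOp :
    Commute (diffOp₀₂ : Module.End ℂ (ℤ → Γ → ℂ → X)) shiftOp₁ := rfl

theorem map_op_pow (f : X →ₗ[ℂ] X') (F : ℤ → Γ → ℂ → X) (k : ℕ) (m : ℤ) (n : Γ) (r : ℂ) :
    f ((diffOp₀₂ ^ k) F m n r) = (diffOp₀₂ ^ k) (fun m n r => f (F m n r)) m n r := by
  induction k generalizing m n r with
  | zero => rfl
  | succ k ih =>
    rw [pow_succ', pow_succ', Module.End.mul_apply, Module.End.mul_apply]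
    simp only [diffOp₀₂, LinearMap.coe_mk, AddHom.coe_mk, map_sub] at ih ⊢
    rw [ih, ih]

theorem map_op_pow' (f : X →ₗ[ℂ] X') (F : ℤ → Γ → ℂ → X) (k : ℕ) (m : ℤ) (n : Γ) (r : ℂ) :
    f (((diffOp₀₂ - shiftOp₁) ^ k : Module.End ℂ _) F m n r) =
      ((diffOp₀₂ - shiftOp₁) ^ k : Module.End ℂ _) (fun m n r => f (F m n r)) m n r := by
  induction k generalizing m n r with
  | zero => rfl
  | succ k ih =>
    rw [pow_succ', pow_succ', Module.End.mul_apply, Module.End.mul_apply]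
    simp only [diffOp₀₂, shiftOp₁, LinearMap.coe_mk, AddHom.coe_mk, map_sub, LinearMap.sub_apply,
      Pi.sub_apply] at ih ⊢
    rw [ih, ih, ih]

/-- If `(z-z₁-z₂)^K (z-z₂)^K G = 0` and `G` is truncated in `z₁`, then each coefficient of `G` in
`z₁` is killed by a power of `z-z₂`. -/
theorem exists_pow_eq_zero (G : ℤ → Γ → ℂ → X) (K : ℕ)
    (hG : ((diffOp₀₂ - shiftOp₁) ^ K : Module.End ℂ _) ((diffOp₀₂ ^ K) G) = 0) (n : Γ)
    (hn : ∃ N : ℕ, ∀ i : ℕ, N ≤ i → ∀ m r, G m (n + i) r = 0) :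
    ∃ k : ℕ, ∀ m r, (diffOp₀₂ ^ k) G m n r = 0 := by
  -- Working modulo series whose coefficients vanish from index `n` upward, the `z₁`-shift becomes
  -- negligible once it lands in `Z`, and `z - z₁ - z₂` then acts as `z - z₂`.
  let Z : Submodule ℂ (ℤ → Γ → ℂ → X) :=
    { carrier := {F | ∀ (i : ℕ) m r, F m (n + i) r = 0}
      zero_mem' := fun _ _ _ => rfl
      add_mem' := fun hF hF' i m r => by simp [hF i m r, hF' i m r]
      smul_mem' := fun a F hF i m r => by simp [hF i m r] }
  have hA : ∀ F ∈ Z, diffOp₀₂ F ∈ Z := fun F hF i m r => by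
    simp [diffOp₀₂, hF i]
  have hB : ∀ F ∈ Z, shiftOp₁ F ∈ Z := fun F hF i m r => by
    have := hF (i + 1) m r
    push_cast at this
    rw [← add_assoc] at this
    exact this
  have hApow : ∀ k : ℕ, ∀ F ∈ Z, (diffOp₀₂ ^ k) F ∈ Z := fun k F hF => by
    induction k with
    | zero => exact hF
    | succ k ih => rw [pow_succ', Module.End.mul_apply]; exact hA _ ih
  have hcong : ∀ k : ℕ, ∀ F, shiftOp₁ F ∈ Z →
      ((diffOp₀₂ - shiftOp₁) ^ k : Module.End ℂ _) F - (diffOp₀₂ ^ k) F ∈ Z := fun k F hF => by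
    induction k with
    | zero => simp
    | succ k ih =>
      rw [pow_succ', pow_succ', Module.End.mul_apply, Module.End.mul_apply]
      set P := ((diffOp₀₂ - shiftOp₁) ^ k : Module.End ℂ (ℤ → Γ → ℂ → X)) F
      set Q := (diffOp₀₂ ^ k) F with hQ
      have h1 : shiftOp₁ Q ∈ Z := by
        have : shiftOp₁ Q = (diffOp₀₂ ^ k) (shiftOp₁ F) := by
          rw [hQ, ← Module.End.mul_apply, ← (commute_diffOp_shiftOp.pow_left k).eq,
            Module.End.mul_apply]
        rw [this]
        exact hApow k _ hF
      have h2 : (diffOp₀₂ - shiftOp₁ : Module.End ℂ (ℤ → Γ → ℂ → X)) P - diffOp₀₂ Q =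
          diffOp₀₂ (P - Q) - shiftOp₁ (P - Q) - shiftOp₁ Q := by
        simp only [LinearMap.sub_apply, map_sub]; abel
      rw [h2]
      exact Z.sub_mem (Z.sub_mem (hA _ ih) (hB _ ih)) h1
  obtain ⟨N, hN⟩ := hn
  have hBpow : ∀ (j : ℕ) (F : ℤ → Γ → ℂ → X) m n r, (shiftOp₁ ^ j) F m n r = F m (n + j) r := by
    intro j
    induction j with
    | zero => intro F m n r; simp
    | succ j ih =>
      intro F m n r
      rw [pow_succ', Module.End.mul_apply]
      change (shiftOp₁ ^ j) F m (n + 1) r = _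
      rw [ih]; push_cast; ring_nf
  -- Descent from the truncation bound `n + N` to `n`, one coefficient at a time; the exponent of `z
  -- - z₂` grows at each stage.
  have claim : ∀ j : ℕ, j ≤ N → ∃ k : ℕ, (diffOp₀₂ ^ k) ((shiftOp₁ ^ (N - j)) G) ∈ Z := by
    intro j
    induction j with
    | zero =>
      refine fun _ => ⟨0, fun i m r => ?_⟩
      simp only [pow_zero, Module.End.one_apply, Nat.sub_zero, hBpow]
      have := hN (i + N) (by omega) m r
      push_cast at this
      rwa [← add_assoc] at this
    | succ j ih =>
      intro hj
      obtain ⟨k, hk⟩ := ih (by omega)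
      refine ⟨K + (k + K), ?_⟩
      set G' := (diffOp₀₂ ^ (k + K)) ((shiftOp₁ ^ (N - (j + 1))) G) with hG'
      have h1 : shiftOp₁ G' ∈ Z := by
        have : shiftOp₁ G' = (diffOp₀₂ ^ K) ((diffOp₀₂ ^ k) ((shiftOp₁ ^ (N - j)) G)) := by
          rw [hG', ← Module.End.mul_apply, ← Module.End.mul_apply, ← Module.End.mul_apply,
            ← Module.End.mul_apply, ← pow_add, ← (commute_diffOp_shiftOp.pow_left _).eq,
            mul_assoc, ← pow_succ', add_comm K k, show N - j = N - (j + 1) + 1 by omega]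
        rw [this]
        exact hApow _ _ hk
      have h2 : ((diffOp₀₂ - shiftOp₁) ^ K : Module.End ℂ _) G' = 0 := by
        have hc : Commute (diffOp₀₂ - shiftOp₁ : Module.End ℂ (ℤ → Γ → ℂ → X)) diffOp₀₂ :=
          (Commute.refl _).sub_left commute_diffOp_shiftOp.symm
        have hc' : Commute (diffOp₀₂ - shiftOp₁ : Module.End ℂ (ℤ → Γ → ℂ → X)) shiftOp₁ :=
          commute_diffOp_shiftOp.sub_left (Commute.refl _)
        have hc1 : Commute ((diffOp₀₂ - shiftOp₁) ^ K * diffOp₀₂ ^ K :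
            Module.End ℂ (ℤ → Γ → ℂ → X)) (diffOp₀₂ ^ k * shiftOp₁ ^ (N - (j + 1))) :=
          ((hc.pow_pow _ _).mul_right (hc'.pow_pow _ _)).mul_left
            (((Commute.refl _).pow_pow _ _).mul_right (commute_diffOp_shiftOp.pow_pow _ _))
        have h3 := LinearMap.congr_fun hc1.eq G
        simp only [Module.End.mul_apply] at h3
        rw [hG, map_zero, map_zero] at h3
        rw [hG', add_comm k K, pow_add, Module.End.mul_apply]
        exact h3
      have h4 := hcong K G' h1
      rw [h2, zero_sub] at h4
      have h5 := Z.neg_mem h4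
      rwa [neg_neg, hG', ← Module.End.mul_apply, ← pow_add] at h5
  obtain ⟨k, hk⟩ := claim N le_rfl
  rw [Nat.sub_self, pow_zero, Module.End.one_apply] at hk
  exact ⟨k, fun m r => by simpa using hk 0 m r⟩

end ThreeVariables

/-- The bracket of order zero is the commutator, and each further order multiplies by `z - z₂`. -/
theorem diffOp₀₂_pow_bracket {Γ U₂ U₃ : Type*} [CommRing Γ] [AddCommGroup U₂] [Module ℂ U₂]
    [AddCommGroup U₃] [Module ℂ U₃] {α₂ : ℤ → Module.End ℂ U₂} {α₃ : ℤ → Module.End ℂ U₃}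
    (Φ : Γ → ℂ → U₂ →ₗ[ℂ] U₃) (hΦ : ∀ n, TruncatedSeries (Φ n)) (hα : TruncatedModes α₂) (k : ℕ)
    (m : ℤ) (n : Γ) (r : ℂ) (u : U₂) :
    (diffOp₀₂ ^ k) (fun m n r => α₃ m (Φ n r u) - Φ n r (α₂ m u)) m n r =
      bracketSum α₂ α₃ (Φ n) k m r u := by
  induction k generalizing m n r with
  | zero => simp [bracketSum]
  | succ k ih =>
    rw [pow_succ', Module.End.mul_apply, Nat.cast_succ, bracketSum_succ (hΦ n) hα, ← ih, ← ih]
    rfl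

theorem diffOp₀₁_pow_bracket {Γ U₂ U₃ : Type*} [CommRing Γ] [AddCommGroup U₂] [Module ℂ U₂]
    [AddCommGroup U₃] [Module ℂ U₃] {α₂ : ℤ → Module.End ℂ U₂} {α₃ : ℤ → Module.End ℂ U₃}
    (Φ : Γ → U₂ →ₗ[ℂ] U₃) (hΦ : TruncatedSeries Φ) (hα : TruncatedModes α₂) (k : ℕ)
    (m : ℤ) (n : Γ) (r : ℂ) (u : ℂ → U₂) :
    (diffOp₀₁ ^ k) (fun m n r => α₃ m (Φ n (u r)) - Φ n (α₂ m (u r))) m n r =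
      bracketSum α₂ α₃ Φ k m n (u r) := by
  induction k generalizing m n r with
  | zero => simp [bracketSum]
  | succ k ih =>
    rw [pow_succ', Module.End.mul_apply, Nat.cast_succ, bracketSum_succ hΦ hα, ← ih, ← ih]
    rfl

namespace AssociativitySystem

variable {Γ U₁ U₂ U₃ U₄ U₅ : Type*} [CommRing Γ] [AddCommGroup U₁]
    [Module ℂ U₁] [AddCommGroup U₂] [Module ℂ U₂] [AddCommGroup U₃] [Module ℂ U₃]
    [AddCommGroup U₄] [Module ℂ U₄] [AddCommGroup U₅] [Module ℂ U₅]
    (S : AssociativitySystem Γ U₁ U₂ U₃ U₄ U₅)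

theorem mem_three {H G : ℤ → Γ → ℂ → ℂ} (h : ∀ m, (H m, G m) ∈ S.R) (m : ℤ) :
    (diffOp₀₂ H m, diffOp₀₂ G m) ∈ S.R := by
  convert S.R.sub_mem (h (m + 1)) (S.R_shift₂ _ _ (h m) 1) using 1
  refine Prod.ext ?_ ?_ <;> funext n r <;> simp [diffOp₀₂]

/-- The factor `z - z₁` of the product becomes `z - z₀ - z₂` on the iterate. -/
theorem mem_three' {H G : ℤ → Γ → ℂ → ℂ} (h : ∀ m, (H m, G m) ∈ S.R) (m : ℤ) :
    (diffOp₀₁ H m, (diffOp₀₂ - shiftOp₁ : Module.End ℂ _) G m) ∈ S.R := by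
  convert S.R.sub_mem (h (m + 1)) (S.R_shift₁ _ _ (h m)) using 1
  refine Prod.ext ?_ ?_ <;> funext n r
  · simp [diffOp₀₁]
  · simp [diffOp₀₂, shiftOp₁]; ring

/-- Weak commutativity of the modes of the iterate. -/
theorem locality (n : Γ) (w₁ : U₁) (w₂ : U₂) :
    ∃ k : ℕ, ∀ m r u, bracketSum S.α₃ S.α₄ (S.ψ n w₁ w₂) k m r u = 0 := by
  obtain ⟨N₁, hN₁⟩ := eventually_atTop.1 (S.trunc₁.eventually' w₁)
  obtain ⟨N₂, hN₂⟩ := eventually_atTop.1 (S.trunc₂.eventually' w₂)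
  -- From this order on, the right sides of the Jacobi identities of `I₁` on `w₁` and `I₂` on `w₂`
  -- vanish.
  set K := max N₁ N₂
  let G : ℤ → Γ → ℂ → (U₃ →ₗ[ℂ] U₄) := fun m n r =>
    S.α₄ m ∘ₗ S.ψ n w₁ w₂ r - S.ψ n w₁ w₂ r ∘ₗ S.α₃ m
  have hG : ((diffOp₀₂ - shiftOp₁) ^ K : Module.End ℂ _) ((diffOp₀₂ ^ K) G) = 0 := by
    ext m n r u
    refine S.F_sep _ fun φ hφ => ?_
    let f : (U₃ →ₗ[ℂ] U₄) →ₗ[ℂ] ℂ := φ ∘ₗ LinearMap.applyₗ u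
    let H : ℤ → Γ → ℂ → ℂ := fun m n r =>
      φ (S.α₄ m (S.I₁ n w₁ (S.I₂ r w₂ u)) - S.I₁ n w₁ (S.I₂ r w₂ (S.α₃ m u)))
    have hR : ∀ m, (H m, fun n r => f (G m n r)) ∈ S.R := fun m => by
      convert S.R.sub_mem (S.rel' (S.F_comp φ hφ m) w₁ w₂ u) (S.rel' hφ w₁ w₂ (S.α₃ m u)) using 1
      refine Prod.ext ?_ ?_ <;> funext n r
      · simp [H, prodCoeff]
      · simp [f, G, iterCoeff]
    have hR1 : ∀ k : ℕ, ∀ m, ((diffOp₀₂ ^ k) H m, (diffOp₀₂ ^ k) (fun m n r => f (G m n r)) m) ∈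
        S.R := fun k => by
      induction k with
      | zero => exact hR
      | succ k ih =>
        intro m
        rw [pow_succ', Module.End.mul_apply, Module.End.mul_apply]
        exact S.mem_three ih m
    have hR2 : ∀ k : ℕ, ∀ m, ((diffOp₀₁ ^ k) ((diffOp₀₂ ^ K) H) m,
        ((diffOp₀₂ - shiftOp₁) ^ k : Module.End ℂ _)
          ((diffOp₀₂ ^ K) (fun m n r => f (G m n r))) m) ∈ S.R := fun k => by
      induction k with
      | zero => exact hR1 K
      | succ k ih =>
        intro m
        rw [pow_succ', pow_succ', Module.End.mul_apply, Module.End.mul_apply]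
        exact S.mem_three' ih m
    have hH : (diffOp₀₁ ^ K) ((diffOp₀₂ ^ K) H) = 0 := by
      let H₁ : ℤ → Γ → ℂ → U₄ := fun m n r => S.α₄ m (S.I₁ n w₁ (S.I₂ r w₂ u)) -
        S.I₁ n w₁ (S.α₅ m (S.I₂ r w₂ u))
      let H₂ : ℤ → Γ → ℂ → U₅ := fun m _ r => S.α₅ m (S.I₂ r w₂ u) - S.I₂ r w₂ (S.α₃ m u)
      have h1 : (diffOp₀₁ ^ K) H₁ = 0 := by
        ext m n r
        rw [diffOp₀₁_pow_bracket (fun n => S.I₁ n w₁) (S.I₁_trunc w₁) S.trunc₅ K m n r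
          (fun r => S.I₂ r w₂ u), S.jacobi₁]
        have : (fun i : ℕ => S.I₁ ((m : Γ) + n - (i : Γ)) (S.α₁ ((K : ℤ) + i) w₁) (S.I₂ r w₂ u)) =
            fun _ => 0 := funext fun i => by
          rw [← Nat.cast_add, hN₁ _ (le_trans (le_max_left N₁ N₂) (Nat.le_add_right _ _))]; simp
        rw [this, psum_zero_right]; rfl
      have h2 : (diffOp₀₂ ^ K) H₂ = 0 := by
        ext m n r
        rw [diffOp₀₂_pow_bracket (fun _ r => S.I₂ r w₂) (fun _ => S.I₂_trunc w₂) S.trunc₃ K m n r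
          u, S.jacobi₂]
        have : (fun i : ℕ => S.I₂ ((m : ℂ) + r - (i : ℂ)) (S.α₂ ((K : ℤ) + i) w₂) u) =
            fun _ => 0 := funext fun i => by
          rw [← Nat.cast_add, hN₂ _ (le_trans (le_max_right N₁ N₂) (Nat.le_add_right _ _))]; simp
        rw [this, psum_zero_right]; rfl
      have h2' : (diffOp₀₂ ^ K) (fun m n r => S.I₁ n w₁ (H₂ m n r)) = 0 := by
        have : ∀ k : ℕ, ∀ m n r, (diffOp₀₂ ^ k) (fun m n r => S.I₁ n w₁ (H₂ m n r)) m n r =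
            S.I₁ n w₁ ((diffOp₀₂ ^ k) H₂ m n r) := by
          intro k
          induction k with
          | zero => intros; rfl
          | succ k ih =>
            intro m n r
            rw [pow_succ', pow_succ', Module.End.mul_apply, Module.End.mul_apply]
            simp only [diffOp₀₂, LinearMap.coe_mk, AddHom.coe_mk, map_sub] at ih ⊢
            rw [ih, ih]
        ext m n r
        rw [this, h2]; simp
      -- The commutator with a product is `[α, I₁] I₂ + I₁ [α, I₂]`. Powers of `z - z₁` kill the
      -- first part and powers of `z - z₂` the second.
      have h3 : H = (fun m n r => φ (H₁ m n r)) + fun m n r => φ (S.I₁ n w₁ (H₂ m n r)) := by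
        ext m n r
        simp [H, H₁, H₂]
      have h4 : (diffOp₀₂ ^ K) (fun m n r => φ (S.I₁ n w₁ (H₂ m n r))) = 0 := by
        ext m n r
        rw [← map_op_pow φ, h2']; simp
      have h5 : ∀ k : ℕ, ∀ m n r, (diffOp₀₁ ^ k) (fun m n r => φ (H₁ m n r)) m n r =
          φ ((diffOp₀₁ ^ k) H₁ m n r) := by
        intro k
        induction k with
        | zero => intros; rfl
        | succ k ih =>
          intro m n r
          rw [pow_succ', pow_succ', Module.End.mul_apply, Module.End.mul_apply]
          simp only [diffOp₀₁, LinearMap.coe_mk, AddHom.coe_mk, map_sub] at ih ⊢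
          rw [ih, ih]
      have h6 : (diffOp₀₁ ^ K) (fun m n r => φ (H₁ m n r)) = 0 := by
        ext m n r
        rw [h5, h1]; simp
      rw [h3, map_add, h4, add_zero, ← Module.End.mul_apply, (commute_diffOps.pow_pow K K).eq,
        Module.End.mul_apply, h6, map_zero]
    have h7 := hR2 K m
    rw [hH] at h7
    have h8 := congrFun (congrFun (S.R_unique _ h7) n) r
    have h9 := map_op_pow' f ((diffOp₀₂ ^ K) G) K m n r
    have h10 : (fun m n r => f ((diffOp₀₂ ^ K) G m n r)) =
        (diffOp₀₂ ^ K) (fun m n r => f (G m n r)) := by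
      ext m n r
      exact map_op_pow f G K m n r
    rw [h10, h8] at h9
    exact h9
  obtain ⟨k, hk⟩ := exists_pow_eq_zero G K hG n (by
    obtain ⟨N, hN⟩ := eventually_atTop.1 (S.eventually_ψ w₁ w₂ n)
    exact ⟨N, fun i hi m r => by simp [G, hN i hi]⟩)
  refine ⟨k, fun m r u => ?_⟩
  rw [← diffOp₀₂_pow_bracket (fun n => S.ψ n w₁ w₂) (fun n => S.ψ_trunc' n w₁ w₂) S.trunc₃]
  have := map_op_pow (LinearMap.applyₗ u : (U₃ →ₗ[ℂ] U₄) →ₗ[ℂ] U₄) G k m n r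
  rw [hk m r, map_zero] at this
  exact this.symm

end AssociativitySystem

end VertexAssoc

/-! ### Uniqueness of formal expansions. -/

namespace VertexAssoc

set_option linter.unusedSectionVars false

open Filter Topology

/-- The coefficient of `z₀^p z₂^q` in `z₂^r z₀^s f(z₀/z₂)`. -/
noncomputable def termCoeff (r s : ℂ) (f : ℂ → ℂ) (p q : ℂ) : ℂ :=
  ∑ᶠ j : ℕ, open Classical in
    if s + j = p ∧ r - j = q then iteratedDeriv j f 0 / (j.factorial : ℂ) else 0

theorem series_eq_sum (D : ExpansionData) (p q : ℂ) :
    D.series p q = ∑ i, termCoeff (D.r i) (D.s i) (D.f i) p q := rfl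

theorem termCoeff_eq {r s : ℂ} (f : ℂ → ℂ) {p q : ℂ} {j : ℕ} (hp : s + j = p) (hq : r - j = q) :
    termCoeff r s f p q = iteratedDeriv j f 0 / (j.factorial : ℂ) := by
  unfold termCoeff
  rw [finsum_eq_single _ j, if_pos ⟨hp, hq⟩]
  intro i hi
  rw [if_neg]
  rintro ⟨h, -⟩
  rw [← hp, add_right_inj, Nat.cast_inj] at h
  exact hi h

theorem termCoeff_eq_zero {r s : ℂ} (f : ℂ → ℂ) {p q : ℂ}
    (h : ∀ j : ℕ, s + j = p → r - j ≠ q) : termCoeff r s f p q = 0 := by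
  unfold termCoeff
  refine finsum_eq_zero_of_forall_eq_zero fun j => if_neg ?_
  rintro ⟨h1, h2⟩
  exact h j h1 h2

theorem exists_of_termCoeff_ne_zero {r s : ℂ} {f : ℂ → ℂ} {p q : ℂ}
    (h : termCoeff r s f p q ≠ 0) : ∃ j : ℕ, s + j = p ∧ r - j = q := by
  contrapose! h
  exact termCoeff_eq_zero f h

theorem termCoeff_congr {r s r' s' p q p' q' : ℂ} (f : ℂ → ℂ) (hs : s' - s = p' - p)
    (hr : r' - r = q' - q) : termCoeff r' s' f p' q' = termCoeff r s f p q := by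
  unfold termCoeff
  refine finsum_congr fun j => ?_
  have h1 : s' + j = p' ↔ s + j = p := by
    constructor <;> intro h
    · linear_combination h - hs
    · linear_combination h + hs
  have h2 : r' - j = q' ↔ r - j = q := by
    constructor <;> intro h
    · linear_combination h - hr
    · linear_combination h + hr
  simp only [h1, h2]

/-- Taylor coefficients of `x^k f`. -/
theorem iteratedDeriv_pow_mul {f : ℂ → ℂ} (hf : AnalyticAt ℂ f 0) (k K : ℕ) :
    iteratedDeriv K (fun x => x ^ k * f x) 0 / (K.factorial : ℂ) =
      if k ≤ K then iteratedDeriv (K - k) f 0 / ((K - k).factorial : ℂ) else 0 := by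
  rw [iteratedDeriv_fun_mul (by fun_prop) hf.contDiffAt]
  simp only [iteratedDeriv_fun_pow_zero]
  split_ifs with h
  · rw [Finset.sum_eq_single k]
    · rw [if_pos rfl, Nat.cast_choose ℂ h]
      have h1 : (k.factorial : ℂ) ≠ 0 := Nat.cast_ne_zero.2 k.factorial_ne_zero
      have h2 : (K.factorial : ℂ) ≠ 0 := Nat.cast_ne_zero.2 K.factorial_ne_zero
      have h3 : ((K - k).factorial : ℂ) ≠ 0 := Nat.cast_ne_zero.2 (K - k).factorial_ne_zero
      field_simp
    · intro i _ hi
      simp [hi]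
    · intro hk
      exact absurd (Finset.mem_range.2 (by omega)) hk
  · rw [Finset.sum_eq_zero, zero_div]
    intro i hi
    have : i ≠ k := by have := Finset.mem_range.1 hi; omega
    simp [this]

section Uniqueness

variable (D : ExpansionData)

/-- In this strip `log (exp u) = u`, so the multivalued powers become exponentials in `u`. -/
theorem value_exp {t u : ℂ} (h : |u.im| < Real.pi / 2) :
    D.value t (Complex.exp u) = ∑ i, Complex.exp ((D.r i + D.s i) * t) *
      (Complex.exp (D.s i * u) * D.f i (Complex.exp u)) := by
  unfold ExpansionData.value
  have h' := abs_lt.1 h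
  have hpi := Real.pi_pos
  rw [Complex.log_exp (by linarith) (by linarith)]
  refine Finset.sum_congr rfl fun i _ => ?_
  rw [← mul_assoc, ← Complex.exp_add, ← Complex.exp_add]
  ring_nf

/-- The exponential form is analytic on the whole half plane `Re u < 0`. Near `u = -1` it equals
`D.value`, since there `exp u` has positive real part and lies in the overlap; the identity theorem
then reaches all branches. -/
theorem sum_exp_eq_zero
    (h : ∀ t x : ℂ, ‖x‖ < 1 → 1 < ‖1 + x‖ → D.value t x = 0) (t : ℂ) {u : ℂ} (hu : u.re < 0) :
    ∑ i, Complex.exp ((D.r i + D.s i) * t) *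
      (Complex.exp (D.s i * u) * D.f i (Complex.exp u)) = 0 := by
  have han : AnalyticOnNhd ℂ (fun u => ∑ i, Complex.exp ((D.r i + D.s i) * t) *
      (Complex.exp (D.s i * u) * D.f i (Complex.exp u))) {u | u.re < 0} := by
    intro u hu
    refine Finset.analyticAt_fun_sum _ fun i _ => analyticAt_const.mul (AnalyticAt.mul ?_ ?_)
    · fun_prop
    · refine AnalyticAt.fun_comp (D.analytic i _ ?_) (by fun_prop)
      rw [mem_ball_zero_iff, Complex.norm_exp, Real.exp_lt_one_iff]
      exact hu
  refine han.eqOn_zero_of_preconnected_of_eventuallyEq_zero (z₀ := -1)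
    (convex_halfSpace_re_lt 0).isPreconnected (by simp) ?_ hu
  have hopen : IsOpen {u : ℂ | u.re < 0 ∧ |u.im| < Real.pi / 2} :=
    (isOpen_lt Complex.continuous_re continuous_const).inter
      (isOpen_lt (Complex.continuous_im.abs) continuous_const)
  have hmem : (-1 : ℂ) ∈ {u : ℂ | u.re < 0 ∧ |u.im| < Real.pi / 2} := by
    simp [Real.pi_pos]
  filter_upwards [hopen.mem_nhds hmem]
    with u ⟨h1, h2⟩
  rw [← value_exp D h2]
  refine h t _ ?_ ?_
  · rwa [Complex.norm_exp, Real.exp_lt_one_iff]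
  · refine lt_of_lt_of_le ?_ (Complex.re_le_norm _)
    rw [Complex.add_re, Complex.one_re, Complex.exp_re]
    have := abs_lt.1 h2
    have := Real.cos_pos_of_mem_Ioo ⟨this.1, this.2⟩
    have := Real.exp_pos u.re
    nlinarith [mul_pos this (Real.cos_pos_of_mem_Ioo ⟨(abs_lt.1 h2).1, (abs_lt.1 h2).2⟩)]

/-- The character `(t, k) ↦ exp (a t + 2πi k b)` of `ℂ × ℕ`. -/
noncomputable def expCharacter (a b : ℂ) : Multiplicative (ℂ × ℕ) →* ℂ where
  toFun x := Complex.exp (a * x.toAdd.1 + b * (2 * Real.pi * Complex.I * x.toAdd.2))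
  map_one' := by simp
  map_mul' x y := by
    rw [← Complex.exp_add]
    simp only [toAdd_mul, Prod.fst_add, Prod.snd_add]
    push_cast
    ring_nf

/-- Differentiation in `t` at `0` recovers `a`, while `k = 1` recovers `b` only modulo `ℤ`. -/
theorem expCharacter_eq_iff {a b a' b' : ℂ} :
    expCharacter a b = expCharacter a' b' ↔ a = a' ∧ ∃ n : ℤ, b = b' + n := by
  constructor
  · intro h
    have h' : ∀ (t : ℂ) (k : ℕ), Complex.exp (a * t + b * (2 * Real.pi * Complex.I * k)) =
        Complex.exp (a' * t + b' * (2 * Real.pi * Complex.I * k)) := fun t k =>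
      DFunLike.congr_fun h (Multiplicative.ofAdd (t, k))
    constructor
    · have h1 : (fun t : ℂ => Complex.exp (a * t)) = fun t => Complex.exp (a' * t) := by
        funext t; simpa using h' t 0
      have h2 := congrArg (fun g => deriv g 0) h1
      have hd : ∀ c : ℂ, deriv (fun t : ℂ => Complex.exp (c * t)) 0 = c := fun c => by
        have := ((hasDerivAt_id (0 : ℂ)).const_mul c).cexp
        simpa using this.deriv
      simpa [hd] using h2
    · have h1 := h' 0 1
      simp only [mul_zero, zero_add, Nat.cast_one, mul_one] at h1
      obtain ⟨n, hn⟩ := Complex.exp_eq_exp_iff_exists_int.1 h1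
      refine ⟨n, ?_⟩
      have h2 : (2 * Real.pi * Complex.I : ℂ) ≠ 0 := Complex.two_pi_I_ne_zero
      rw [← add_mul] at hn
      exact mul_right_cancel₀ h2 hn
  · rintro ⟨rfl, n, rfl⟩
    refine MonoidHom.ext fun x => ?_
    change Complex.exp _ = Complex.exp _
    rw [Complex.exp_eq_exp_iff_exists_int]
    exact ⟨n * x.toAdd.2, by push_cast; ring⟩

open Classical in
-- Varying `t` and replacing `u` by `u + 2πik` keeps each `f_i(exp u)` fixed and multiplies each
-- summand by a character of `ℂ × ℕ`. Distinct characters are linearly independent, so each class of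
-- equal characters sums to zero.
theorem sum_class_eq_zero
    (h : ∀ t x : ℂ, ‖x‖ < 1 → 1 < ‖1 + x‖ → D.value t x = 0) {u : ℂ} (hu : u.re < 0) (i₀ : Fin D.k) :
    ∑ i ∈ Finset.univ.filter (fun i => D.r i + D.s i = D.r i₀ + D.s i₀ ∧
      ∃ n : ℤ, D.s i = D.s i₀ + n), Complex.exp (D.s i * u) * D.f i (Complex.exp u) = 0 := by
  set g : Fin D.k → ℂ := fun i => Complex.exp (D.s i * u) * D.f i (Complex.exp u) with hg
  let χ : Fin D.k → (Multiplicative (ℂ × ℕ) →* ℂ) := fun i =>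
    expCharacter (D.r i + D.s i) (D.s i)
  have h1 : ∑ i, g i • (χ i : Multiplicative (ℂ × ℕ) → ℂ) = 0 := by
    funext x
    rw [Finset.sum_apply, Pi.zero_apply]
    have h2 := sum_exp_eq_zero D h x.toAdd.1
      (u := u + 2 * Real.pi * Complex.I * x.toAdd.2) (by simpa using hu)
    rw [← h2]
    refine Finset.sum_congr rfl fun i _ => ?_
    have h3 : Complex.exp (u + 2 * Real.pi * Complex.I * x.toAdd.2) = Complex.exp u := by
      rw [Complex.exp_eq_exp_iff_exists_int]
      exact ⟨x.toAdd.2, by push_cast; ring⟩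
    rw [h3]
    change g i * Complex.exp _ = _
    simp only [hg, mul_add, Complex.exp_add]
    ring
  have h2 : ∑ c ∈ Finset.univ.image χ, (∑ i ∈ Finset.univ.filter (fun i => χ i = c), g i) •
      (c : Multiplicative (ℂ × ℕ) → ℂ) = 0 := by
    rw [← h1, ← Finset.sum_fiberwise_of_maps_to (g := χ) (t := Finset.univ.image χ)
      fun i hi => Finset.mem_image_of_mem χ hi]
    refine Finset.sum_congr rfl fun c _ => ?_
    rw [Finset.sum_smul]
    refine Finset.sum_congr rfl fun i hi => ?_
    rw [(Finset.mem_filter.1 hi).2]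
  have h3 := linearIndependent_iff'.1 (linearIndependent_monoidHom (Multiplicative (ℂ × ℕ)) ℂ) _ _
    h2 (χ i₀) (Finset.mem_image_of_mem χ (Finset.mem_univ _))
  rw [← h3]
  refine Finset.sum_congr (Finset.filter_congr fun i _ => ?_) fun _ _ => rfl
  exact expCharacter_eq_iff.symm

/-- The formal expansion is determined by the multivalued function. -/
theorem series_eq_zero
    (h : ∀ t x : ℂ, ‖x‖ < 1 → 1 < ‖1 + x‖ → D.value t x = 0) : D.series = 0 := by
  classical
  funext p q
  change D.series p q = 0
  rw [series_eq_sum]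
  by_cases hI : ∃ i₀, ∃ j : ℕ, D.s i₀ + j = p ∧ D.r i₀ - j = q
  swap
  · push Not at hI
    exact Finset.sum_eq_zero fun i _ => termCoeff_eq_zero _ (hI i)
  obtain ⟨i₀, j₀, hp, hq⟩ := hI
  set I := Finset.univ.filter (fun i => D.r i + D.s i = D.r i₀ + D.s i₀ ∧
      ∃ n : ℤ, D.s i = D.s i₀ + n) with hIdef
  have hn : ∀ i, ∃ n : ℤ, i ∈ I → D.s i = p - n := fun i => by
    by_cases hi : i ∈ I
    · obtain ⟨n, hn⟩ := (Finset.mem_filter.1 hi).2.2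
      exact ⟨j₀ - n, fun _ => by rw [hn, ← hp]; push_cast; ring⟩
    · exact ⟨0, fun h => absurd h hi⟩
  choose n hn using hn
  -- Within the class of `(p, q)` one has `s_i = p - n_i` with integral `n_i`. Multiplying by
  -- `x^(K-p)` makes all powers natural, so `g` is analytic at zero and its `K`-th Taylor
  -- coefficient is the coefficient sought.
  obtain ⟨K, hK⟩ : ∃ K : ℕ, ∀ i, n i ≤ K := by
    refine ⟨∑ i, (n i).toNat, fun i => ?_⟩
    have := Finset.single_le_sum (f := fun i => (n i).toNat)
      (fun _ _ => Nat.zero_le _) (Finset.mem_univ i)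
    omega
  have hI : ∀ i ∈ I, D.s i = p - n i ∧ D.r i = q + n i := fun i hi => by
    refine ⟨hn i hi, ?_⟩
    have h1 := (Finset.mem_filter.1 hi).2.1
    have h2 := hn i hi
    linear_combination h1 - h2 + hp + hq
  have hnotI : ∀ i ∉ I, termCoeff (D.r i) (D.s i) (D.f i) p q = 0 := fun i hi => by
    refine termCoeff_eq_zero _ fun j h1 h2 => hi (Finset.mem_filter.2 ⟨Finset.mem_univ _, ?_, ?_⟩)
    · linear_combination h1 + h2 - hp - hq
    · exact ⟨j₀ - j, by push_cast; linear_combination h1 - hp⟩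
  rw [← Finset.sum_subset (Finset.subset_univ I) fun i _ hi => hnotI i hi]
  set k : Fin D.k → ℕ := fun i => (K - n i).toNat with hk
  set g : ℂ → ℂ := fun x => ∑ i ∈ I, x ^ k i * D.f i x with hg
  have hfan : ∀ i, AnalyticAt ℂ (D.f i) 0 := fun i => D.analytic i 0 (by simp)
  have hgan : AnalyticAt ℂ g 0 :=
    Finset.analyticAt_fun_sum _ fun i _ => (by fun_prop : AnalyticAt ℂ (fun x : ℂ => x ^ k i) 0).mul
      (hfan i)
  have hg0 : ∀ x : ℂ, x ≠ 0 → ‖x‖ < 1 → g x = 0 := fun x hx hx1 => by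
    have hu : (Complex.log x).re < 0 := by
      rw [Complex.log_re]
      exact Real.log_neg (norm_pos_iff.2 hx) hx1
    have h1 := sum_class_eq_zero D h hu i₀
    rw [← hIdef, Complex.exp_log hx] at h1
    have h2 : g x = Complex.exp ((K - p) * Complex.log x) *
        ∑ i ∈ I, Complex.exp (D.s i * Complex.log x) * D.f i x := by
      rw [hg, Finset.mul_sum]
      refine Finset.sum_congr rfl fun i hi => ?_
      rw [← mul_assoc, ← Complex.exp_add, ← add_mul, (hI i hi).1]
      congr 1
      have h3 : ((k i : ℕ) : ℤ) = K - n i := by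
        have := hK i
        simp only [hk]
        omega
      have h4 : (K - p + (p - n i) : ℂ) = (k i : ℕ) := by
        have := congrArg (Int.cast : ℤ → ℂ) h3
        push_cast at this
        rw [this]; ring
      rw [h4, Complex.exp_nat_mul, Complex.exp_log hx]
    rw [h2, h1, mul_zero]
  have hgev : g =ᶠ[𝓝 0] 0 := by
    refine hgan.frequently_zero_iff_eventually_zero.1 (Eventually.frequently ?_)
    filter_upwards [self_mem_nhdsWithin, nhdsWithin_le_nhds (Metric.ball_mem_nhds (0 : ℂ) one_pos)]
      with x hx hx1
    exact hg0 x hx (by simpa using hx1)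
  have h5 : iteratedDeriv K g 0 / (K.factorial : ℂ) = 0 := by
    rw [hgev.iteratedDeriv_eq K]; simp
  have h6 : iteratedDeriv K g 0 = ∑ i ∈ I, iteratedDeriv K (fun x => x ^ k i * D.f i x) 0 := by
    rw [hg]
    exact iteratedDeriv_fun_sum fun i _ =>
      ((by fun_prop : AnalyticAt ℂ (fun x : ℂ => x ^ k i) 0).mul (hfan i)).contDiffAt
  rw [h6, Finset.sum_div] at h5
  rw [← h5]
  refine Finset.sum_congr rfl fun i hi => ?_
  rw [iteratedDeriv_pow_mul (hfan i)]
  have hKi := hK i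
  obtain ⟨h7, h8⟩ := hI i hi
  split_ifs with hle
  · have h9 : ((K - k i : ℕ) : ℤ) = n i := by
      simp only [hk] at hle ⊢
      omega
    have h9' : ((K - k i : ℕ) : ℂ) = n i := by
      have := congrArg (Int.cast : ℤ → ℂ) h9
      rwa [Int.cast_natCast] at this
    refine termCoeff_eq _ ?_ ?_
    · rw [h7, h9']; ring
    · rw [h8, h9']; ring
  · refine termCoeff_eq_zero _ fun j h10 _ => hle ?_
    have h11 : (j : ℂ) = (n i : ℤ) := by linear_combination h10 - h7
    have h12 : (j : ℤ) = n i := by exact_mod_cast h11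
    simp only [hk]
    omega

end Uniqueness

end VertexAssoc

/-! ### Operations on series with an analytic extension. -/

namespace VertexAssoc

set_option linter.unusedSectionVars false

open Filter Topology

namespace ExpansionData

/-- The sum of two expansions. -/
def append (D E : ExpansionData) : ExpansionData where
  k := D.k + E.k
  r := Fin.append D.r E.r
  s := Fin.append D.s E.s
  f := Fin.append D.f E.f
  analytic i := by
    refine Fin.addCases (fun i => ?_) (fun i => ?_) i
    · rw [Fin.append_left]; exact D.analytic i
    · rw [Fin.append_right]; exact E.analytic i

theorem append_value (D E : ExpansionData) (t x : ℂ) :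
    (D.append E).value t x = D.value t x + E.value t x := by
  unfold value append
  rw [Fin.sum_univ_add]
  simp only [Fin.append_left, Fin.append_right]

theorem append_series (D E : ExpansionData) : (D.append E).series = D.series + E.series := by
  funext p q
  rw [Pi.add_apply, Pi.add_apply]
  simp only [series_eq_sum]
  unfold append
  rw [Fin.sum_univ_add]
  simp only [Fin.append_left, Fin.append_right]

/-- Modification of the exponents and of the analytic functions of an expansion. -/
def modify (D : ExpansionData) (a b : ℂ) (g : Fin D.k → ℂ → ℂ)
    (hg : ∀ i, AnalyticOnNhd ℂ (g i) (Metric.ball 0 1)) : ExpansionData where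
  k := D.k
  r i := D.r i + a
  s i := D.s i + b
  f := g
  analytic := hg

/-- Multiplication by `z₂^a z₀^b`. -/
def shift (D : ExpansionData) (a b : ℂ) : ExpansionData := D.modify a b D.f D.analytic

theorem shift_value (D : ExpansionData) (a b t x : ℂ) :
    (D.shift a b).value t x =
      Complex.exp (a * t) * Complex.exp (b * (t + Complex.log x)) * D.value t x := by
  unfold value
  rw [Finset.mul_sum]
  refine Finset.sum_congr rfl fun i _ => ?_
  simp only [shift, modify, add_mul, Complex.exp_add]
  ring

theorem shift_series (D : ExpansionData) (a b p q : ℂ) :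
    (D.shift a b).series p q = D.series (p - b) (q - a) := by
  simp only [series_eq_sum]
  exact Finset.sum_congr rfl fun i _ => termCoeff_congr _ (by simp [shift, modify])
    (by simp [shift, modify])

theorem termCoeff_const_mul {r s : ℂ} (f : ℂ → ℂ) (a p q : ℂ) :
    termCoeff r s (fun x => a * f x) p q = a * termCoeff r s f p q := by
  by_cases h : ∃ j : ℕ, s + j = p ∧ r - j = q
  · obtain ⟨j, h1, h2⟩ := h
    rw [termCoeff_eq _ h1 h2, termCoeff_eq _ h1 h2, iteratedDeriv_const_mul_field, mul_div_assoc]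
  · push Not at h
    rw [termCoeff_eq_zero _ h, termCoeff_eq_zero _ h, mul_zero]

/-- Scaling of the summands of an expansion. -/
def scale (D : ExpansionData) (a : Fin D.k → ℂ) : ExpansionData :=
  D.modify 0 0 (fun i x => a i * D.f i x) fun i => analyticOnNhd_const.mul (D.analytic i)

theorem scale_value (D : ExpansionData) (a : Fin D.k → ℂ) (t x : ℂ) :
    (D.scale a).value t x = ∑ i, a i * (Complex.exp (D.r i * t) *
      Complex.exp (D.s i * (t + Complex.log x)) * D.f i x) := by
  unfold value
  refine Finset.sum_congr rfl fun i _ => ?_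
  simp only [scale, modify, add_zero]
  ring

theorem scale_series (D : ExpansionData) (a : Fin D.k → ℂ) (p q : ℂ) :
    (D.scale a).series p q = ∑ i, a i * termCoeff (D.r i) (D.s i) (D.f i) p q := by
  rw [series_eq_sum]
  refine Finset.sum_congr rfl fun i _ => ?_
  rw [← termCoeff_const_mul]
  simp only [scale, modify, add_zero]

/-- The derivative with respect to `z₀`. -/
noncomputable def derivative (D : ExpansionData) : ExpansionData :=
  (((D.scale D.s).shift 0 (-1)).append
    (D.modify (-1) 0 (fun i => deriv (D.f i)) fun i => (D.analytic i).deriv))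

/-- With `z₀ = e^t x` and `t` fixed, differentiation in `x` is `z₂ ∂/∂z₀`, whence the factor `e^t`.
-/
theorem derivative_value (D : ExpansionData) (t x : ℂ) (hx : x ≠ 0) (hx1 : ‖x‖ < 1)
    (hs : x ∈ Complex.slitPlane) :
    HasDerivAt (fun x => D.value t x) (Complex.exp t * D.derivative.value t x) x := by
  have h : ∀ i, HasDerivAt (fun x => Complex.exp (D.r i * t) *
      Complex.exp (D.s i * (t + Complex.log x)) * D.f i x)
      (Complex.exp (D.r i * t) * (Complex.exp (D.s i * (t + Complex.log x)) *
        (D.s i * x⁻¹)) * D.f i x + Complex.exp (D.r i * t) *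
          Complex.exp (D.s i * (t + Complex.log x)) * deriv (D.f i) x) x := fun i => by
    have h1 : HasDerivAt (fun x => D.s i * (t + Complex.log x)) (D.s i * x⁻¹) x :=
      ((Complex.hasDerivAt_log hs).const_add t).const_mul _
    have h2 := (D.analytic i x (by simpa using hx1)).differentiableAt.hasDerivAt
    exact ((h1.cexp.const_mul (Complex.exp (D.r i * t)))).mul h2
  have h' := HasDerivAt.fun_sum fun i (_ : i ∈ Finset.univ) => h i
  refine h'.congr_deriv (Eq.symm ?_)
  unfold derivative
  rw [append_value, shift_value, scale_value, Finset.sum_add_distrib, mul_add]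
  congr 1
  · rw [Finset.mul_sum, Finset.mul_sum]
    refine Finset.sum_congr rfl fun i _ => ?_
    have h3 : Complex.exp t * Complex.exp (-1 * (t + Complex.log x)) = x⁻¹ := by
      rw [← Complex.exp_add, neg_one_mul, neg_add, ← add_assoc, add_neg_cancel, zero_add,
        Complex.exp_neg, Complex.exp_log hx]
    rw [zero_mul, Complex.exp_zero, ← h3]
    ring
  · unfold value
    rw [Finset.mul_sum]
    refine Finset.sum_congr rfl fun i _ => ?_
    simp only [modify, add_zero]
    have h4 : Complex.exp (D.r i * t) = Complex.exp t * Complex.exp ((D.r i + -1) * t) := by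
      rw [← Complex.exp_add]; ring_nf
    rw [h4]
    ring

theorem derivative_series (D : ExpansionData) (p q : ℂ) :
    D.derivative.series p q = (p + 1) * D.series (p + 1) q := by
  unfold derivative
  rw [append_series, Pi.add_apply, Pi.add_apply, shift_series, scale_series,
    series_eq_sum, series_eq_sum, Finset.mul_sum]
  refine Finset.sum_add_distrib.symm.trans ?_
  refine Finset.sum_congr rfl fun i _ => ?_
  simp only [modify, add_zero, sub_neg_eq_add, sub_zero]
  have hval : ∀ j : ℕ, iteratedDeriv j (deriv (D.f i)) 0 / (j.factorial : ℂ) =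
      ((j : ℂ) + 1) * (iteratedDeriv (j + 1) (D.f i) 0 / ((j + 1).factorial : ℂ)) := fun j => by
    rw [iteratedDeriv_succ', Nat.factorial_succ]
    have h1 : ((j : ℂ) + 1) ≠ 0 := Nat.cast_add_one_ne_zero j
    have h2 : (j.factorial : ℂ) ≠ 0 := Nat.cast_ne_zero.2 j.factorial_ne_zero
    push_cast
    field_simp
  by_cases h : ∃ j : ℕ, D.s i + j = p + 1 ∧ D.r i - j = q
  · obtain ⟨j, h1, h2⟩ := h
    rw [termCoeff_eq _ h1 h2]
    rcases j with _ | j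
    · rw [termCoeff_eq_zero]
      · push_cast at h1
        rw [← h1]; ring
      · intro j h3 h4
        have : ((j : ℂ) + 1) = 0 := by push_cast at h1; linear_combination h3 - h1
        exact Nat.cast_add_one_ne_zero j this
    · rw [termCoeff_eq (j := j), hval, ← h1]
      · push_cast; ring
      · push_cast at h1; linear_combination h1
      · push_cast at h2; linear_combination h2
  · push Not at h
    rw [termCoeff_eq_zero _ h, termCoeff_eq_zero]
    · ring
    · intro j h1 h2
      refine h (j + 1) ?_ ?_
      · push_cast; linear_combination h1
      · push_cast; linear_combination h2

theorem exists_of_series_ne_zero {D : ExpansionData} {p q : ℂ} (h : D.series p q ≠ 0) :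
    ∃ i, ∃ j : ℕ, D.s i + j = p ∧ D.r i - j = q := by
  rw [series_eq_sum] at h
  obtain ⟨i, -, hi⟩ := Finset.exists_ne_zero_of_sum_ne_zero h
  exact ⟨i, exists_of_termCoeff_ne_zero hi⟩

end ExpansionData

open ExpansionData

/-- The difference of two expansions has value zero on the overlap, so `series_eq_zero` applies.
This makes the choice inside `E12` harmless. -/
theorem HasExtension.unique {c e e' : ℂ → ℂ → ℂ} (h : HasExtension c e) (h' : HasExtension c e') :
    e = e' := by
  obtain ⟨-, D, hD, rfl⟩ := h
  obtain ⟨-, D', hD', rfl⟩ := h'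
  have := series_eq_zero (D.append (D'.scale fun _ => -1)) fun t x hx hx' => by
    rw [append_value, scale_value, ← Finset.mul_sum, neg_one_mul, ← sub_eq_add_neg, sub_eq_zero]
    exact (hD t x hx hx').unique (hD' t x hx hx')
  funext p q
  have := congrFun (congrFun this p) q
  rw [append_series, Pi.add_apply, Pi.add_apply, scale_series, ← Finset.mul_sum, neg_one_mul,
    ← sub_eq_add_neg, Pi.zero_apply, Pi.zero_apply, sub_eq_zero] at this
  exact this

theorem HasExtension.E12_eq {c e : ℂ → ℂ → ℂ} (h : HasExtension c e) : E12 c = e := by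
  have h' : ∃ e, HasExtension c e := ⟨e, h⟩
  unfold E12
  rw [dif_pos h']
  exact h'.choose_spec.unique h

theorem HasExtension.zero : HasExtension 0 0 := by
  refine ⟨fun t₁ t₂ _ => by simp, ⟨0, Fin.elim0, Fin.elim0, Fin.elim0,
    fun i => i.elim0⟩, fun t x _ _ => ?_, ?_⟩
  · simp [ExpansionData.value]
  · funext p q; simp [ExpansionData.series]

theorem HasExtension.add {c e c' e' : ℂ → ℂ → ℂ} (h : HasExtension c e)
    (h' : HasExtension c' e') : HasExtension (c + c') (e + e') := by
  obtain ⟨hc, D, hD, rfl⟩ := h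
  obtain ⟨hc', D', hD', rfl⟩ := h'
  refine ⟨fun t₁ t₂ ht => ?_, D.append D', fun t x hx hx' => ?_, (append_series _ _).symm⟩
  · simpa [add_mul] using (hc t₁ t₂ ht).add (hc' t₁ t₂ ht)
  · rw [append_value]
    simpa [add_mul] using (hD t x hx hx').add (hD' t x hx hx')

theorem HasExtension.smul {c e : ℂ → ℂ → ℂ} (a : ℂ) (h : HasExtension c e) :
    HasExtension (a • c) (a • e) := by
  obtain ⟨hc, D, hD, rfl⟩ := h
  refine ⟨fun t₁ t₂ ht => ?_, D.scale fun _ => a, fun t x hx hx' => ?_, ?_⟩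
  · simpa [mul_assoc] using (hc t₁ t₂ ht).mul_left a
  · rw [scale_value, ← Finset.mul_sum]
    refine ((hD t x hx hx').mul_left a).congr_fun fun y => ?_
    exact mul_assoc _ _ _
  · funext p q
    rw [scale_series, ← Finset.mul_sum]
    rfl

theorem hasSum_shift_iff (c : ℂ → ℂ → ℂ) (a b t₁ t₂ v : ℂ) :
    HasSum (fun x : ℂ × ℂ => c (x.1 - a) (x.2 - b) *
        (Complex.exp (x.1 * t₁) * Complex.exp (x.2 * t₂)))
      (Complex.exp (a * t₁) * Complex.exp (b * t₂) * v) ↔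
    HasSum (fun x : ℂ × ℂ => c x.1 x.2 *
        (Complex.exp (x.1 * t₁) * Complex.exp (x.2 * t₂))) v := by
  rw [← ((Equiv.addRight a).prodCongr (Equiv.addRight b)).hasSum_iff]
  have h0 : Complex.exp (a * t₁) * Complex.exp (b * t₂) ≠ 0 :=
    mul_ne_zero (Complex.exp_ne_zero _) (Complex.exp_ne_zero _)
  rw [← hasSum_mul_left_iff h0 (f := fun x : ℂ × ℂ => c x.1 x.2 *
        (Complex.exp (x.1 * t₁) * Complex.exp (x.2 * t₂)))]
  refine iff_of_eq (congrArg (fun g => HasSum g _) (funext fun x => ?_))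
  simp only [Function.comp_apply, Equiv.prodCongr_apply, Prod.map, Equiv.coe_addRight,
    add_sub_cancel_right, add_mul, Complex.exp_add]
  ring

theorem ConvergesInDomain.shift {c : ℂ → ℂ → ℂ} (hc : ConvergesInDomain c) (a b : ℂ) :
    ConvergesInDomain fun p q => c (p - a) (q - b) := fun t₁ t₂ ht =>
  ((hasSum_shift_iff c a b t₁ t₂ _).2 (hc t₁ t₂ ht).hasSum).summable

theorem HasExtension.mul_second {c e : ℂ → ℂ → ℂ} (h : HasExtension c e) (b : ℂ) :
    HasExtension (fun p q => c p (q - b)) (fun p q => e p (q - b)) := by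
  obtain ⟨hc, D, hD, rfl⟩ := h
  refine ⟨by simpa using hc.shift 0 b, D.shift b 0, fun t x hx hx' => ?_, ?_⟩
  · rw [shift_value]
    have := (hasSum_shift_iff c 0 b _ _ _).2 (hD t x hx hx')
    simpa using this
  · funext p q
    rw [shift_series, sub_zero]

theorem ne_zero_of_overlap {x : ℂ} (hx' : 1 < ‖1 + x‖) : x ≠ 0 := by
  rintro rfl
  simp at hx'

theorem one_add_ne_zero_of_overlap {x : ℂ} (hx' : 1 < ‖1 + x‖) : 1 + x ≠ 0 := by
  intro h
  rw [h] at hx'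
  simp at hx'
  linarith

/-- On the overlap `z₁ = z₂ + z₀`, so one product splits into two shifted expansions. -/
theorem HasExtension.mul_first {c e : ℂ → ℂ → ℂ} (h : HasExtension c e) :
    HasExtension (fun p q => c (p - 1) q) (fun p q => e p (q - 1) + e (p - 1) q) := by
  obtain ⟨hc, D, hD, rfl⟩ := h
  refine ⟨by simpa using hc.shift 1 0, (D.shift 1 0).append (D.shift 0 1),
    fun t x hx hx' => ?_, ?_⟩
  · rw [append_value, shift_value, shift_value]
    have := (hasSum_shift_iff c 1 0 _ _ _).2 (hD t x hx hx')
    convert this using 1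
    · simp
    · simp only [one_mul, zero_mul, Complex.exp_zero, mul_one, Complex.exp_add,
        Complex.exp_log (ne_zero_of_overlap hx'), Complex.exp_log (one_add_ne_zero_of_overlap hx')]
      ring
  · funext p q
    rw [append_series, Pi.add_apply, Pi.add_apply, shift_series, shift_series]
    simp

/-- Local bound for exponentials by their values at the corners of a square. -/
theorem norm_exp_le_corners (p τ t : ℂ) {ε : ℝ} (h1 : |t.re - τ.re| ≤ ε) (h2 : |t.im - τ.im| ≤ ε) :
    ‖Complex.exp (p * t)‖ ≤ ∑ a : Fin 2 × Fin 2, ‖Complex.exp (p * (τ +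
      (((-1) ^ (a.1 : ℕ) * ε : ℝ) : ℂ) + (((-1) ^ (a.2 : ℕ) * ε : ℝ) : ℂ) * Complex.I))‖ := by
  -- The logarithm of the norm is `Re (p t)`, real affine in the two coordinates of `t`, so its
  -- maximum on a square is at a corner.
  have key : ∃ a : Fin 2 × Fin 2, ‖Complex.exp (p * t)‖ ≤ ‖Complex.exp (p * (τ +
      (((-1) ^ (a.1 : ℕ) * ε : ℝ) : ℂ) + (((-1) ^ (a.2 : ℕ) * ε : ℝ) : ℂ) * Complex.I))‖ := by
    have hr : ∃ i : Fin 2, p.re * (t.re - τ.re) ≤ p.re * ((-1) ^ (i : ℕ) * ε) := by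
      have := abs_le.1 h1
      rcases le_total 0 p.re with h | h
      · exact ⟨0, by simpa using mul_le_mul_of_nonneg_left this.2 h⟩
      · exact ⟨1, by simpa using mul_le_mul_of_nonpos_left this.1 h⟩
    have hi : ∃ i : Fin 2, -p.im * (t.im - τ.im) ≤ -p.im * ((-1) ^ (i : ℕ) * ε) := by
      have := abs_le.1 h2
      rcases le_total 0 (-p.im) with h | h
      · exact ⟨0, by simpa using mul_le_mul_of_nonneg_left this.2 h⟩
      · exact ⟨1, by simpa using mul_le_mul_of_nonpos_left this.1 h⟩
    obtain ⟨i, hi'⟩ := hr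
    obtain ⟨j, hj⟩ := hi
    refine ⟨(i, j), ?_⟩
    rw [Complex.norm_exp, Complex.norm_exp, Real.exp_le_exp]
    simp only [Complex.mul_re, Complex.add_re, Complex.add_im, Complex.mul_im, Complex.ofReal_re,
      Complex.ofReal_im, Complex.I_re, Complex.I_im]
    nlinarith
  obtain ⟨a, ha⟩ := key
  exact ha.trans (Finset.single_le_sum (f := fun a : Fin 2 × Fin 2 => ‖Complex.exp (p * (τ +
      (((-1) ^ (a.1 : ℕ) * ε : ℝ) : ℂ) + (((-1) ^ (a.2 : ℕ) * ε : ℝ) : ℂ) * Complex.I))‖)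
      (fun _ _ => norm_nonneg _) (Finset.mem_univ a))

/-- On a small square the terms are dominated by their values at the four corners, where the series
converges absolutely; hence the sum is holomorphic and is differentiated termwise. -/
theorem ConvergesInDomain.hasDerivAt {c : ℂ → ℂ → ℂ} (hc : ConvergesInDomain c) {t₁ t₂ : ℂ}
    (ht : t₂.re < t₁.re) :
    ∃ d, HasSum (fun x : ℂ × ℂ => x.1 * c x.1 x.2 *
        (Complex.exp (x.1 * t₁) * Complex.exp (x.2 * t₂))) d ∧
      HasDerivAt (fun t => ∑' x : ℂ × ℂ, c x.1 x.2 *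
        (Complex.exp (x.1 * t) * Complex.exp (x.2 * t₂))) d t₁ := by
  -- Half the gap, so that the corners still satisfy `|z₁| > |z₂|`.
  set ε := (t₁.re - t₂.re) / 2 with hε
  have hε0 : 0 < ε := by rw [hε]; linarith
  set U : Set ℂ := {t | |t.re - t₁.re| < ε ∧ |t.im - t₁.im| < ε} with hU
  have hUo : IsOpen U :=
    (isOpen_lt (f := fun t : ℂ => |t.re - t₁.re|) (by fun_prop) continuous_const).inter
      (isOpen_lt (f := fun t : ℂ => |t.im - t₁.im|) (by fun_prop) continuous_const)
  have hmem : t₁ ∈ U := by simp [hU, hε0]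
  let u : ℂ × ℂ → ℝ := fun x => ∑ a : Fin 2 × Fin 2, ‖c x.1 x.2 * (Complex.exp (x.1 * (t₁ +
      (((-1) ^ (a.1 : ℕ) * ε : ℝ) : ℂ) + (((-1) ^ (a.2 : ℕ) * ε : ℝ) : ℂ) * Complex.I)) *
      Complex.exp (x.2 * t₂))‖
  have hu : Summable u := by
    refine summable_sum fun a _ => (hc _ _ ?_).norm
    simp only [Complex.add_re, Complex.mul_re, Complex.ofReal_re,
      Complex.ofReal_im, Complex.I_re, Complex.I_im]
    have : -ε ≤ (-1) ^ (a.1 : ℕ) * ε := by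
      rcases neg_one_pow_eq_or ℝ (a.1 : ℕ) with h | h <;> rw [h] <;> linarith
    linarith
  have hle : ∀ (x : ℂ × ℂ) (t : ℂ), t ∈ U → ‖c x.1 x.2 *
        (Complex.exp (x.1 * t) * Complex.exp (x.2 * t₂))‖ ≤ u x := fun x t ht => by
    have := norm_exp_le_corners x.1 t₁ t ht.1.le ht.2.le
    simp only [u, norm_mul]
    rw [← Finset.mul_sum, ← Finset.sum_mul]
    gcongr
  have hdiff : ∀ x : ℂ × ℂ, DifferentiableOn ℂ (fun t => c x.1 x.2 *
        (Complex.exp (x.1 * t) * Complex.exp (x.2 * t₂))) U := fun x => by fun_prop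
  have h1 := Complex.hasSum_deriv_of_summable_norm hu hdiff hUo hle hmem
  have h2 := Complex.differentiableOn_tsum_of_summable_norm hu hdiff hUo hle
  refine ⟨_, ?_, (h2.differentiableAt (hUo.mem_nhds hmem)).hasDerivAt⟩
  refine h1.congr_fun fun x => ?_
  have h3 : HasDerivAt (fun t : ℂ => x.1 * t) x.1 t₁ := by
    simpa using (hasDerivAt_id t₁).const_mul x.1
  have := ((h3.cexp.mul_const (Complex.exp (x.2 * t₂))).const_mul (c x.1 x.2)).deriv
  rw [this]; ring

/-- Termwise derivative with respect to `z₁`. -/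
theorem HasExtension.derivative {c e : ℂ → ℂ → ℂ} (h : HasExtension c e) :
    HasExtension (fun p q => (p + 1) * c (p + 1) q) (fun p q => (p + 1) * e (p + 1) q) := by
  obtain ⟨hc, D, hD, rfl⟩ := h
  have hshift : ∀ t₁ t₂ d, HasSum (fun x : ℂ × ℂ => x.1 * c x.1 x.2 *
        (Complex.exp (x.1 * t₁) * Complex.exp (x.2 * t₂))) d →
      HasSum (fun x : ℂ × ℂ => (x.1 + 1) * c (x.1 + 1) x.2 *
        (Complex.exp (x.1 * t₁) * Complex.exp (x.2 * t₂))) (Complex.exp (-t₁) * d) :=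
    fun t₁ t₂ d hd => by
      have := (hasSum_shift_iff (fun p q => p * c p q) (-1) 0 t₁ t₂ d).2 hd
      simpa using this
  refine ⟨fun t₁ t₂ ht => ?_, D.derivative, fun t x hx hx' => ?_, ?_⟩
  · obtain ⟨d, hd, -⟩ := hc.hasDerivAt ht
    exact (hshift _ _ _ hd).summable
  · have hx0 := ne_zero_of_overlap hx'
    have hx1 := one_add_ne_zero_of_overlap hx'
    -- A nonpositive real `x` with `|x| < 1` would have `|1 + x| ≤ 1`.
    have hslit : x ∈ Complex.slitPlane := by
      by_contra hn
      rw [Complex.mem_slitPlane_iff, not_or, not_lt, not_not] at hn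
      obtain ⟨h1, h2⟩ := hn
      have h3 : x = (x.re : ℂ) := Complex.ext (by simp) (by simp [h2])
      rw [h3, ← Complex.ofReal_one, ← Complex.ofReal_add, Complex.norm_real, Real.norm_eq_abs,
        lt_abs] at hx'
      rw [h3, Complex.norm_real, Real.norm_eq_abs, abs_lt] at hx
      rcases hx' with h | h <;> linarith [hx.1]
    have hslit1 : 1 + x ∈ Complex.slitPlane := by
      rw [Complex.mem_slitPlane_iff]
      left
      have := (abs_lt.1 (lt_of_le_of_lt (Complex.abs_re_le_norm x) hx)).1
      simp only [Complex.add_re, Complex.one_re]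
      linarith
    have hre : t.re < (t + Complex.log (1 + x)).re := by
      rw [Complex.add_re, Complex.log_re]
      linarith [Real.log_pos hx']
    obtain ⟨d, hd, hder⟩ := hc.hasDerivAt hre
    have hlog : HasDerivAt (fun x => t + Complex.log (1 + x)) (1 + x)⁻¹ x := by
      have := (Complex.hasDerivAt_log hslit1).comp x ((hasDerivAt_id x).const_add 1)
      simpa using this.const_add t
    -- With `z₂` fixed, `log z₁ = t + log (1 + x)`. Computing the derivative in `x` of the common
    -- value from both sides identifies `∂/∂z₁` with `∂/∂z₀`.
    have h4 := hder.comp x hlog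
    have h5 : HasDerivAt (fun x => D.value t x) (d * (1 + x)⁻¹) x := by
      refine h4.congr_of_eventuallyEq ?_
      have ho : IsOpen {x : ℂ | ‖x‖ < 1 ∧ 1 < ‖1 + x‖} :=
        (isOpen_lt (f := fun x : ℂ => ‖x‖) (by fun_prop) continuous_const).inter
          (isOpen_lt (g := fun x : ℂ => ‖1 + x‖) continuous_const (by fun_prop))
      filter_upwards [ho.mem_nhds ⟨hx, hx'⟩] with y hy
      exact (hD t y hy.1 hy.2).tsum_eq.symm
    have h6 := h5.unique (D.derivative_value t x hx0 hx hslit)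
    have h7 := hshift _ _ _ hd
    convert h7 using 1
    rw [neg_add, Complex.exp_add, Complex.exp_neg, Complex.exp_neg, Complex.exp_log hx1, mul_assoc,
      mul_comm _ d, h6, ← mul_assoc, inv_mul_cancel₀ (Complex.exp_ne_zero _), one_mul]
  · funext p q
    exact (D.derivative_series p q).symm

/-- A homogeneous series has a homogeneous expansion. -/
theorem HasExtension.support {c e : ℂ → ℂ → ℂ} (h : HasExtension c e) {S : ℂ}
    (hS : ∀ p q, p + q ≠ S → c p q = 0) {p q : ℂ} (hpq : p + q ≠ S) : e p q = 0 := by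
  -- Translating `t` by `τ` rescales both variables by `e^τ`. A homogeneous `c` is multiplied by
  -- `e^(Sτ)`, its expansion by `e^((p+q)τ)` in each degree.
  have key : ∀ τ : ℂ, HasExtension (Complex.exp (S * τ) • c)
      (fun p q => Complex.exp ((p + q) * τ) * e p q) := fun τ => by
    refine ⟨(h.smul _).1, ?_⟩
    obtain ⟨hc, D, hD, rfl⟩ := h
    refine ⟨D.scale fun i => Complex.exp ((D.r i + D.s i) * τ), fun t x hx hx' => ?_, ?_⟩
    · convert hD (t + τ) x hx hx' using 1
      · funext y
        simp only [Pi.smul_apply, smul_eq_mul]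
        by_cases hy : y.1 + y.2 = S
        · rw [← hy, mul_comm (Complex.exp _) (c _ _), mul_assoc, ← Complex.exp_add,
            ← Complex.exp_add, ← Complex.exp_add]
          ring_nf
        · rw [hS _ _ hy]; simp
      · rw [scale_value]
        unfold value
        refine Finset.sum_congr rfl fun i _ => ?_
        rw [← mul_assoc, ← Complex.exp_add, ← Complex.exp_add, ← Complex.exp_add]
        ring_nf
    · funext p q
      rw [scale_series, series_eq_sum, Finset.mul_sum]
      refine Finset.sum_congr rfl fun i _ => ?_
      by_cases h0 : termCoeff (D.r i) (D.s i) (D.f i) p q = 0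
      · rw [h0, mul_zero, mul_zero]
      · obtain ⟨j, rfl, rfl⟩ := exists_of_termCoeff_ne_zero h0
        congr 2
        ring
  have hne : p + q - S ≠ 0 := sub_ne_zero.2 hpq
  -- For this `τ` the two factors differ by `e`, so a nonzero coefficient would make `1` an integer
  -- multiple of `2πi`.
  have h1 := congrFun (congrFun ((key (1 / (p + q - S))).unique (h.smul _)) p) q
  simp only [Pi.smul_apply, smul_eq_mul] at h1
  by_contra h0
  have h2 := mul_right_cancel₀ h0 h1
  obtain ⟨n, hn⟩ := Complex.exp_eq_exp_iff_exists_int.1 h2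
  have h3 : (1 : ℂ) = n * (2 * Real.pi * Complex.I) := by
    have : (p + q) * (1 / (p + q - S)) - S * (1 / (p + q - S)) = 1 := by
      field_simp
    rw [← this, hn]; ring
  have h4 := congrArg Complex.re h3
  simp at h4

end VertexAssoc

/-! ### Weights, gradings and the restricted dual. -/

namespace VertexAssoc

set_option linter.unusedSectionVars false

open Filter

section Leibniz

variable {U₁ U₂ U₃ : Type*} [AddCommGroup U₁] [Module ℂ U₁]
  [AddCommGroup U₂] [Module ℂ U₂] [AddCommGroup U₃] [Module ℂ U₃]

/-- Each application of `T₃` spends one application of `T₁` or `T₂`, and after `a + b` of them one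
of the two is exhausted. -/
theorem pow_apply_eq_zero_of_leibniz (B : U₁ →ₗ[ℂ] U₂ →ₗ[ℂ] U₃) {T₁ : Module.End ℂ U₁}
    {T₂ : Module.End ℂ U₂} {T₃ : Module.End ℂ U₃}
    (h : ∀ w u, T₃ (B w u) = B (T₁ w) u + B w (T₂ u)) (s : ℕ) :
    ∀ a b : ℕ, a + b = s → ∀ w u, (T₁ ^ a) w = 0 → (T₂ ^ b) u = 0 → (T₃ ^ s) (B w u) = 0 := by
  induction s with
  | zero =>
    intro a b hab w u hw _
    obtain rfl : a = 0 := by omega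
    have : w = 0 := hw
    simp [this]
  | succ s ih =>
    intro a b hab w u hw hu
    rw [pow_succ, Module.End.mul_apply, h, map_add]
    have h1 : (T₃ ^ s) (B (T₁ w) u) = 0 := by
      rcases a with _ | a
      · have : w = 0 := hw
        simp [this]
      · rw [pow_succ, Module.End.mul_apply] at hw
        exact ih a b (by omega) _ _ hw hu
    have h2 : (T₃ ^ s) (B w (T₂ u)) = 0 := by
      rcases b with _ | b
      · have : u = 0 := hu
        simp [this]
      · rw [pow_succ, Module.End.mul_apply] at hu
        exact ih a b (by omega) _ _ hw hu
    rw [h1, h2, add_zero]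

theorem mem_maxGenEigenspace_of_leibniz (B : U₁ →ₗ[ℂ] U₂ →ₗ[ℂ] U₃) {T₁ : Module.End ℂ U₁}
    {T₂ : Module.End ℂ U₂} {T₃ : Module.End ℂ U₃} {c : ℂ}
    (h : ∀ w u, T₃ (B w u) = B (T₁ w) u + B w (T₂ u) - c • B w u) {h₁ h₂ : ℂ} {w : U₁} {u : U₂}
    (hw : w ∈ T₁.maxGenEigenspace h₁) (hu : u ∈ T₂.maxGenEigenspace h₂) :
    B w u ∈ T₃.maxGenEigenspace (h₁ + h₂ - c) := by
  rw [Module.End.mem_maxGenEigenspace] at hw hu ⊢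
  obtain ⟨a, ha⟩ := hw
  obtain ⟨b, hb⟩ := hu
  refine ⟨a + b, pow_apply_eq_zero_of_leibniz B ?_ _ a b rfl w u ha hb⟩
  intro w u
  simp only [LinearMap.sub_apply, LinearMap.smul_apply, Module.End.one_apply, map_sub, map_smul, h]
  module

end Leibniz

section Modes

variable {V : Type*} [AddCommGroup V] [Module ℂ V] {A : VertexOperatorAlgebra V}

theorem truncatedModes_ncoeff {W : Type*} [AddCommGroup W] [Module ℂ W] (a : VertexOperator ℂ W) :
    TruncatedModes (VertexOperator.ncoeff a) := fun u =>
  ⟨-HahnSeries.order ((HahnModule.of ℂ).symm (a u)), fun n hn =>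
    VertexOperator.ncoeff_eq_zero_of_lt_order a n u (by omega)⟩

namespace WeakModule

variable {W : Type*} [AddCommGroup W] [Module ℂ W] (M : WeakModule A W)

theorem truncatedModes (a : V) : TruncatedModes (M.mode a) := truncatedModes_ncoeff _

/-- The `n`-th mode as a linear function of the vector in `V`. -/
noncomputable def modeₗ (n : ℤ) : V →ₗ[ℂ] W →ₗ[ℂ] W :=
  LinearMap.proj n ∘ₗ VertexOperator.ncoeff ∘ₗ M.Y

end WeakModule

/-- The algebra as a module over itself. -/
def VertexOperatorAlgebra.adjoint (A : VertexOperatorAlgebra V) : WeakModule A V where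
  Y := A.Y
  vacuum_mode := A.vacuum_mode
  derivative := A.derivative
  jacobi := A.jacobi

namespace WeakModule

variable {W : Type*} [AddCommGroup W] [Module ℂ W] (M : WeakModule A W)

theorem jacobi_eq (a b : V) (l m n : ℤ) (u : W) :
    bracketSum (M.mode a) (M.mode a) (fun n => M.mode b n) l m n u =
      psum m fun i => M.mode (A.adjoint.mode a (l + i) b) (m + n - i) u :=
  M.jacobi a b u l m n

theorem mode_derivative (a : V) (n : ℤ) :
    M.mode (A.adjoint.L (-1) a) n = (-(n : ℂ)) • M.mode a (n - 1) := M.derivative a n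

/-- The commutator with `ω_1` (Jacobi at `l = 0`, `m = 1`) has two terms, and the `L(-1)`-derivative
property turns the one with `ω_0 a` into the scalar. -/
theorem L_zero_mode (n : ℤ) (a : V) (u : W) : M.L 0 (M.mode a n u) =
    M.mode (A.adjoint.L 0 a) n u + M.mode a n (M.L 0 u) - ((n : ℂ) + 1) • M.mode a n u := by
  have h := M.jacobi_eq A.omega a 0 1 n u
  simp only [bracketSum, bsum_zero_left] at h
  rw [← Nat.cast_one (R := ℤ), psum_natCast, Finset.sum_range_succ, Finset.sum_range_one] at h
  simp only [Int.negOnePow_zero, Units.val_one, one_smul, Nat.cast_zero, Nat.cast_one, add_zero,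
    sub_zero, zero_add, Nat.choose_self, Nat.choose_zero_right, Int.cast_zero] at h
  have h2 : M.mode (A.adjoint.mode A.omega 0 a) (1 + n) u = (-((n : ℂ) + 1)) • M.mode a n u := by
    have := LinearMap.congr_fun (M.mode_derivative a (1 + n)) u
    rw [add_sub_cancel_left] at this
    refine this.trans ?_
    rw [LinearMap.smul_apply]
    push_cast
    ring_nf
  rw [h2, add_sub_cancel_left, sub_eq_iff_eq_add] at h
  refine h.trans ?_
  change _ + M.mode (A.adjoint.L 0 a) n u + M.mode a n (M.L 0 u) = _
  module

theorem mode_mem {k : ℂ} {a : V} (ha : a ∈ A.adjoint.weightSpace k) {h : ℂ} {u : W}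
    (hu : u ∈ M.weightSpace h) (n : ℤ) : M.mode a n u ∈ M.weightSpace (k + h - (n + 1)) :=
  mem_maxGenEigenspace_of_leibniz (M.modeₗ n) (M.L_zero_mode n) ha hu

end WeakModule

namespace IntertwiningOperator

variable {W₁ W₂ W₃ : Type*} [AddCommGroup W₁] [Module ℂ W₁] [AddCommGroup W₂] [Module ℂ W₂]
  [AddCommGroup W₃] [Module ℂ W₃] {M₁ : WeakModule A W₁} {M₂ : WeakModule A W₂}
  {M₃ : WeakModule A W₃} (I : IntertwiningOperator M₁ M₂ M₃)

theorem jacobi_eq (a : V) (w : W₁) (l m : ℤ) (n : ℂ) (u : W₂) :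
    bracketSum (M₂.mode a) (M₃.mode a) (fun n => I.modes n w) l m n u =
      psum m fun i => I.modes (m + n - i) (M₁.mode a (l + i) w) u :=
  I.jacobi a w u l m n

theorem L_zero_modes (n : ℂ) (w : W₁) (u : W₂) : M₃.L 0 (I.modes n w u) =
    I.modes n (M₁.L 0 w) u + I.modes n w (M₂.L 0 u) - (n + 1) • I.modes n w u := by
  have h := I.jacobi_eq A.omega w 0 1 n u
  simp only [bracketSum, bsum_zero_left] at h
  rw [← Nat.cast_one (R := ℤ), psum_natCast, Finset.sum_range_succ, Finset.sum_range_one] at h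
  simp only [Int.negOnePow_zero, Units.val_one, one_smul, Nat.cast_zero, Nat.cast_one, add_zero,
    sub_zero, zero_add, Nat.choose_self, Nat.choose_zero_right, Int.cast_zero, Int.cast_one] at h
  have h2 : I.modes (1 + n) (M₁.mode A.omega 0 w) u = (-(n + 1)) • I.modes n w u := by
    have := LinearMap.congr_fun (I.derivative (1 + n) w) u
    rw [add_sub_cancel_left, add_comm 1 n] at this
    rw [add_comm 1 n]
    exact this
  rw [h2, add_sub_cancel_left, sub_eq_iff_eq_add] at h
  refine h.trans ?_
  change _ + I.modes n (M₁.L 0 w) u + I.modes n w (M₂.L 0 u) = _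
  module

theorem modes_mem {h₁ h₂ : ℂ} {w : W₁} {u : W₂} (hw : w ∈ M₁.weightSpace h₁)
    (hu : u ∈ M₂.weightSpace h₂) (n : ℂ) :
    I.modes n w u ∈ M₃.weightSpace (h₁ + h₂ - (n + 1)) :=
  mem_maxGenEigenspace_of_leibniz (I.modes n) (I.L_zero_modes n) hw hu

end IntertwiningOperator

end Modes

section Grading

variable {V : Type*} [AddCommGroup V] [Module ℂ V] {A : VertexOperatorAlgebra V}

theorem VertexOperatorAlgebra.iSup_weightSpace (A : VertexOperatorAlgebra V) :
    ⨆ k : ℂ, A.adjoint.weightSpace k = ⊤ := by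
  rw [eq_top_iff, ← A.grading]
  exact iSup_le fun n => le_trans Module.End.eigenspace_le_maxGenEigenspace
    (le_iSup (fun k : ℂ => A.adjoint.weightSpace k) (n : ℂ))

namespace WeakModule

variable {W : Type*} [AddCommGroup W] [Module ℂ W] (M : WeakModule A W)

/-- The module is the sum of its weight spaces, which vanish far down in each coset of `ℤ`. -/
def IsGraded : Prop :=
  (⨆ h : ℂ, M.weightSpace h = ⊤) ∧ ∀ h : ℂ, ∃ N : ℤ, ∀ n : ℤ, n < N → M.weightSpace (h + n) = ⊥

variable {M}

theorem IsOrdinary.isGraded (h : M.IsOrdinary) : M.IsGraded := by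
  obtain ⟨h1, -, h3⟩ := h
  refine ⟨?_, fun k => ?_⟩
  · rw [eq_top_iff, ← h1]
    exact iSup_mono fun n => Module.End.eigenspace_le_maxGenEigenspace
  · obtain ⟨N, hN⟩ := h3 k
    refine ⟨N, fun n hn => ?_⟩
    by_contra hne
    -- A nonzero generalized eigenspace contains a genuine eigenvector.
    have : (M.L 0).HasUnifEigenvalue (k + n) ⊤ := hne
    exact (this.lt (m := 1) one_pos) (hN n hn)

theorem IsC1.isGraded (h : M.IsC1) : M.IsGraded := by
  obtain ⟨h1, H, hH⟩ := h
  refine ⟨?_, fun k => ?_⟩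
  · rw [eq_top_iff]
    intro w _
    obtain ⟨S, hw, hfin, hS⟩ := h1 w
    -- On a finite-dimensional invariant subspace over `ℂ` the generalized eigenspaces span.
    have h3 : (⟨w, hw⟩ : S) ∈
        ⨆ μ, Module.End.maxGenEigenspace ((M.L 0).restrict hS : Module.End ℂ S) μ := by
      rw [Module.End.iSup_maxGenEigenspace_eq_top]; trivial
    have h4 := Submodule.mem_map_of_mem (f := S.subtype) h3
    rw [Submodule.map_iSup] at h4
    refine SetLike.le_def.1 (iSup_mono fun μ => ?_) h4
    rw [Submodule.map_le_iff_le_comap]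
    exact (Module.End.genEigenspace_restrict (M.L 0) S ⊤ μ hS).le
  · obtain ⟨B, hB⟩ := (H.finite_toSet.image fun h₀ : ℂ => (h₀ - k).re).bddBelow
    refine ⟨⌊B⌋, fun n hn => ?_⟩
    by_contra hne
    obtain ⟨h₀, hh₀, j, hj⟩ := hH _ hne
    have h2 := hB (Set.mem_image_of_mem _ hh₀)
    have h3 : (n : ℝ) = (h₀ - k).re + j := by
      have := congrArg Complex.re hj
      simp only [Complex.add_re, Complex.intCast_re, Complex.natCast_re, Complex.sub_re] at this ⊢
      linarith
    have h4 : B ≤ n := by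
      rw [h3]; have : (0 : ℝ) ≤ j := Nat.cast_nonneg j
      linarith
    exact absurd (Int.floor_le B |>.trans h4) (by exact_mod_cast not_le.2 hn)

variable (M)

theorem isCompl_weightSpace (hM : M.IsGraded) (h : ℂ) :
    IsCompl (M.weightSpace h) (⨆ (k : ℂ) (_ : k ≠ h), M.weightSpace k) := by
  refine ⟨(Module.End.independent_maxGenEigenspace (M.L 0)) h, ?_⟩
  rw [codisjoint_iff, eq_top_iff, ← hM.1]
  refine iSup_le fun k => ?_
  by_cases hk : k = h
  · rw [hk]; exact le_sup_left
  · exact le_trans (le_iSup₂_of_le k hk le_rfl) le_sup_right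

/-- The projection to a weight space. -/
noncomputable def weightProj (hM : M.IsGraded) (h : ℂ) : Module.End ℂ W :=
  Submodule.projection _ _ (M.isCompl_weightSpace hM h)

variable {M}

theorem weightProj_of_mem (hM : M.IsGraded) {h : ℂ} {w : W} (hw : w ∈ M.weightSpace h) :
    M.weightProj hM h w = w :=
  Submodule.projection_apply_of_mem_left _ hw

theorem weightProj_of_ne (hM : M.IsGraded) {h k : ℂ} (hk : k ≠ h) {w : W}
    (hw : w ∈ M.weightSpace k) : M.weightProj hM h w = 0 :=
  Submodule.projection_apply_of_mem_right _ ((le_iSup₂_of_le k hk le_rfl :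
    M.weightSpace k ≤ ⨆ (k : ℂ) (_ : k ≠ h), M.weightSpace k) hw)

theorem ext_weightSpace (hM : M.IsGraded) {X : Type*} [AddCommGroup X] [Module ℂ X]
    {f g : W →ₗ[ℂ] X} (hfg : ∀ h, ∀ w ∈ M.weightSpace h, f w = g w) : f = g := by
  have : (⨆ h, M.weightSpace h) ≤ LinearMap.eqLocus f g := iSup_le fun h w hw => hfg h w hw
  rw [hM.1] at this
  exact LinearMap.ext fun w => this (Submodule.mem_top (x := w))

theorem isHomogeneousDual_comp_weightProj (hM : M.IsGraded) (h : ℂ) (φ : Module.Dual ℂ W) :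
    M.IsHomogeneousDual h (φ ∘ₗ M.weightProj hM h) := fun k hk w hw => by
  rw [LinearMap.comp_apply, weightProj_of_ne hM hk hw, map_zero]

theorem IsHomogeneousDual.inRestrictedDual {h : ℂ} {φ : Module.Dual ℂ W}
    (hφ : M.IsHomogeneousDual h φ) : M.InRestrictedDual φ := by
  refine (Set.finite_singleton h).subset ?_
  rintro k ⟨w, hw, hne⟩
  by_contra hk
  exact hne (hφ k hk w hw)

/-- Induction on the restricted dual. -/
theorem InRestrictedDual.induction (hM : M.IsGraded) {p : Module.Dual ℂ W → Prop} (h0 : p 0)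
    (hadd : ∀ φ χ, p φ → p χ → p (φ + χ)) (hhom : ∀ h φ, M.IsHomogeneousDual h φ → p φ)
    {φ : Module.Dual ℂ W} (hφ : M.InRestrictedDual φ) : p φ := by
  classical
  change {h : ℂ | ∃ w ∈ M.weightSpace h, φ w ≠ 0}.Finite at hφ
  have : φ = ∑ h ∈ hφ.toFinset, φ ∘ₗ M.weightProj hM h := by
    refine ext_weightSpace hM fun k w hw => ?_
    rw [LinearMap.sum_apply]
    by_cases hk : k ∈ hφ.toFinset
    · rw [Finset.sum_eq_single k, LinearMap.comp_apply, weightProj_of_mem hM hw]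
      · intro h _ hne
        rw [LinearMap.comp_apply, weightProj_of_ne hM hne.symm hw, map_zero]
      · exact fun h => absurd hk h
    · have h1 : φ w = 0 := by
        by_contra hne
        exact hk (by rw [Set.Finite.mem_toFinset]; exact ⟨w, hw, hne⟩)
      rw [h1, Finset.sum_eq_zero]
      intro h hh
      have hne : k ≠ h := by rintro rfl; exact hk hh
      rw [LinearMap.comp_apply, weightProj_of_ne hM hne hw, map_zero]
  rw [this]
  exact Finset.sum_induction _ p hadd h0 fun h _ =>
    hhom h _ (isHomogeneousDual_comp_weightProj hM h φ)

theorem inRestrictedDual_zero : M.InRestrictedDual 0 := by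
  simp [InRestrictedDual]

theorem InRestrictedDual.add {φ χ : Module.Dual ℂ W} (hφ : M.InRestrictedDual φ)
    (hχ : M.InRestrictedDual χ) : M.InRestrictedDual (φ + χ) := by
  refine (Set.Finite.union hφ hχ).subset ?_
  rintro h ⟨w, hw, hne⟩
  by_contra hn
  simp only [Set.mem_union, Set.mem_ofPred_eq, not_or, not_exists, not_and, not_not] at hn
  exact hne (by rw [LinearMap.add_apply, hn.1 w hw, hn.2 w hw, add_zero])

/-- The restricted dual separates points. -/
theorem eq_zero_of_restrictedDual (hM : M.IsGraded) {v : W}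
    (hv : ∀ φ, M.InRestrictedDual φ → φ v = 0) : v = 0 := by
  have h1 : ∀ h, M.weightProj hM h v = 0 := fun h => by
    rw [← Module.forall_dual_apply_eq_zero_iff ℂ]
    intro φ
    exact hv _ (isHomogeneousDual_comp_weightProj hM h φ).inRestrictedDual
  have h2 : v ∈ ⨆ h, M.weightSpace h := by rw [hM.1]; trivial
  obtain ⟨f, hf, rfl⟩ := (Submodule.mem_iSup_iff_exists_finsupp _ _).1 h2
  refine Finset.sum_eq_zero fun h hh => ?_
  have h3 := h1 h
  rw [Finsupp.sum, map_sum, Finset.sum_eq_single h] at h3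
  · rwa [weightProj_of_mem hM (hf h)] at h3
  · intro k _ hk
    exact weightProj_of_ne hM hk (hf k)
  · intro hn
    exact absurd hh hn

/-- Homogeneous functionals composed with modes of homogeneous vectors are homogeneous. -/
theorem IsHomogeneousDual.comp_mode {h k : ℂ} {φ : Module.Dual ℂ W}
    (hφ : M.IsHomogeneousDual h φ) {a : V} (ha : a ∈ A.adjoint.weightSpace k) (n : ℤ) :
    M.IsHomogeneousDual (h - k + (n + 1)) (φ ∘ₗ M.mode a n) := fun h' hh' w hw =>
  hφ _ (fun he => hh' (by rw [← he]; ring)) _ (M.mode_mem ha hw n)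

theorem mode_add (a b : V) (n : ℤ) : M.mode (a + b) n = M.mode a n + M.mode b n :=
  map_add (M.modeₗ n) a b

theorem mode_zero (n : ℤ) : M.mode (0 : V) n = 0 := map_zero (M.modeₗ n)

/-- For homogeneous `a` and `φ`, composing with `a_n` shifts the weight by an amount tending to `-∞`
with `n`, where the module vanishes. This supplies `F_comp` and `F_trunc`. -/
theorem restrictedDual_mode (hM : M.IsGraded) {φ : Module.Dual ℂ W} (hφ : M.InRestrictedDual φ)
    (a : V) : (∀ n, M.InRestrictedDual (φ ∘ₗ M.mode a n)) ∧
      ∃ N : ℤ, ∀ n, n ≤ N → φ ∘ₗ M.mode a n = 0 := by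
  have ha : a ∈ ⨆ k, A.adjoint.weightSpace k := by rw [A.iSup_weightSpace]; trivial
  induction ha using Submodule.iSup_induction' with
  | mem k a ha =>
    refine hφ.induction hM (p := fun φ => (∀ n, M.InRestrictedDual (φ ∘ₗ M.mode a n)) ∧
      ∃ N : ℤ, ∀ n, n ≤ N → φ ∘ₗ M.mode a n = 0) ?_ ?_ ?_
    · exact ⟨fun n => by rw [LinearMap.zero_comp]; exact inRestrictedDual_zero,
        0, fun n _ => LinearMap.zero_comp _⟩
    · rintro φ χ ⟨h1, N, hN⟩ ⟨h2, N', hN'⟩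
      refine ⟨fun n => by rw [LinearMap.add_comp]; exact (h1 n).add (h2 n), min N N',
        fun n hn => ?_⟩
      rw [LinearMap.add_comp, hN n (hn.trans (min_le_left _ _)),
        hN' n (hn.trans (min_le_right _ _)), add_zero]
    · intro h φ hφ
      refine ⟨fun n => (hφ.comp_mode ha n).inRestrictedDual, ?_⟩
      obtain ⟨N, hN⟩ := hM.2 (h - k)
      refine ⟨N - 2, fun n hn => ext_weightSpace hM fun h' w hw => ?_⟩
      by_cases hh : h' = h - k + (n + 1)
      · have h3 := hN (n + 1) (by omega)
        push_cast at h3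
        rw [hh, h3, Submodule.mem_bot] at hw
        rw [hw, map_zero, map_zero]
      · rw [hφ.comp_mode ha n h' hh w hw, LinearMap.zero_apply]
  | zero =>
    simp only [mode_zero, LinearMap.comp_zero]
    exact ⟨fun _ => inRestrictedDual_zero, 0, fun _ _ => trivial⟩
  | add a b _ _ ha hb =>
    obtain ⟨h1, N, hN⟩ := ha
    obtain ⟨h2, N', hN'⟩ := hb
    simp only [mode_add, LinearMap.comp_add]
    exact ⟨fun n => (h1 n).add (h2 n), min N N', fun n hn => by
      rw [hN n (hn.trans (min_le_left _ _)), hN' n (hn.trans (min_le_right _ _)), add_zero]⟩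

end WeakModule

end Grading

end VertexAssoc

/-! ### Existence of the modes of the iterate. -/

namespace VertexAssoc

set_option linter.unusedSectionVars false

open Filter

section FiniteDimensional

variable {W : Type*} [AddCommGroup W] [Module ℂ W]

/-- On an infinite independent subfamily a functional could take the values `1 / a`, and its series
would contain infinitely many ones. -/
theorem finiteDimensional_span_of_summable {X : Type*} (v : X → W) (a : X → ℂ)
    (ha : ∀ x, a x ≠ 0) (h : ∀ φ : Module.Dual ℂ W, Summable fun x => φ (v x) * a x) :
    FiniteDimensional ℂ (Submodule.span ℂ (Set.range v)) := by
  obtain ⟨b, hb, hspan, hli⟩ := exists_linearIndependent ℂ (Set.range v)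
  rw [← hspan]
  by_cases hfin : b.Finite
  · exact FiniteDimensional.span_of_finite ℂ hfin
  exfalso
  have hinf : Infinite b := (Set.not_finite.1 hfin).to_subtype
  choose x hx using fun y : b => hb y.2
  have hxinj : Function.Injective x := fun y y' hyy => Subtype.ext (by rw [← hx y, ← hx y', hyy])
  obtain ⟨φ, hφ⟩ := LinearMap.exists_extend
    ((Module.Basis.span hli).constr ℂ fun y => (a (x y))⁻¹)
  have hval : ∀ y : b, φ y = (a (x y))⁻¹ := fun y => by
    have h1 := LinearMap.congr_fun hφ (Module.Basis.span hli y)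
    rw [Module.Basis.constr_basis] at h1
    rw [← h1, LinearMap.comp_apply]
    congr 1
    simp [Module.Basis.span_apply]
  have h2 := (h φ).comp_injective hxinj
  have h3 : ((fun x => φ (v x) * a x) ∘ x) = fun _ : b => (1 : ℂ) := by
    funext y
    rw [Function.comp_apply, hx, hval, inv_mul_cancel₀ (ha _)]
  rw [h3, summable_const_iff] at h2
  exact one_ne_zero h2

/-- Such a functional factors through the dual of `E`, and a finite-dimensional space is its own
double dual. -/
theorem exists_eq_eval (E : Submodule ℂ W) [FiniteDimensional ℂ E]
    (Λ : Module.Dual ℂ W →ₗ[ℂ] ℂ) (hΛ : ∀ φ : Module.Dual ℂ W, (∀ v ∈ E, φ v = 0) → Λ φ = 0) :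
    ∃ v ∈ E, ∀ φ, Λ φ = φ v := by
  obtain ⟨P, hP⟩ := E.subtype.exists_leftInverse_of_injective E.ker_subtype
  let Λ' : Module.Dual ℂ (Module.Dual ℂ E) := Λ ∘ₗ Module.Dual.transpose P
  refine ⟨(Module.evalEquiv ℂ E).symm Λ', Submodule.coe_mem _, fun φ => ?_⟩
  have h1 : φ ((Module.evalEquiv ℂ E).symm Λ') = Λ' (φ ∘ₗ E.subtype) := by
    conv_rhs => rw [← (Module.evalEquiv ℂ E).apply_symm_apply Λ']
    rfl
  rw [h1]
  change Λ φ = Λ ((φ ∘ₗ E.subtype) ∘ₗ P)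
  rw [← sub_eq_zero, ← map_sub]
  refine hΛ _ fun v hv => ?_
  have h2 := LinearMap.congr_fun hP ⟨v, hv⟩
  simp only [LinearMap.comp_apply, Submodule.subtype_apply, LinearMap.id_apply] at h2
  simp [h2]

end FiniteDimensional

section Iterate

variable {V : Type*} [AddCommGroup V] [Module ℂ V] {A : VertexOperatorAlgebra V}
  {W₁ W₂ W₃ W₄ W₅ : Type*} [AddCommGroup W₁] [Module ℂ W₁]
  [AddCommGroup W₂] [Module ℂ W₂] [AddCommGroup W₃] [Module ℂ W₃] [AddCommGroup W₄] [Module ℂ W₄]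
  [AddCommGroup W₅] [Module ℂ W₅]
  {M₁ : WeakModule A W₁} {M₂ : WeakModule A W₂} {M₃ : WeakModule A W₃}
  {M₄ : WeakModule A W₄} {M₅ : WeakModule A W₅}
  (Y₁ : IntertwiningOperator M₁ M₅ M₄) (Y₂ : IntertwiningOperator M₂ M₃ M₅)

/-- `v n m` are the modes of the iterate applied to fixed vectors. -/
def IsIterate (w₁ : W₁) (w₂ : W₂) (w₃ : W₃) (v : ℂ → ℂ → W₄) : Prop :=
  ∀ φ, M₄.InRestrictedDual φ →
    HasExtension (productSeries Y₁ Y₂ φ w₁ w₂ w₃) (fun p q => φ (v (-p - 1) (-q - 1)))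

variable {Y₁ Y₂}

theorem IsIterate.unique (hM₄ : M₄.IsGraded) {w₁ : W₁} {w₂ : W₂} {w₃ : W₃} {v v' : ℂ → ℂ → W₄}
    (h : IsIterate Y₁ Y₂ w₁ w₂ w₃ v) (h' : IsIterate Y₁ Y₂ w₁ w₂ w₃ v') : v = v' := by
  funext n m
  rw [← sub_eq_zero]
  refine WeakModule.eq_zero_of_restrictedDual hM₄ fun φ hφ => ?_
  have h1 := congrFun (congrFun ((h φ hφ).unique (h' φ hφ)) (-n - 1)) (-m - 1)
  have e : ∀ x : ℂ, -(-x - 1) - 1 = x := fun x => by ring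
  simp only [e] at h1
  rw [map_sub, h1, sub_self]

theorem IsIterate.add₁ {w₁ w₁' : W₁} {w₂ : W₂} {w₃ : W₃} {v v' : ℂ → ℂ → W₄}
    (h : IsIterate Y₁ Y₂ w₁ w₂ w₃ v) (h' : IsIterate Y₁ Y₂ w₁' w₂ w₃ v') :
    IsIterate Y₁ Y₂ (w₁ + w₁') w₂ w₃ (v + v') := fun φ hφ => by
  convert (h φ hφ).add (h' φ hφ) using 1 <;> funext p q <;> simp [productSeries]

theorem IsIterate.add₂ {w₁ : W₁} {w₂ w₂' : W₂} {w₃ : W₃} {v v' : ℂ → ℂ → W₄}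
    (h : IsIterate Y₁ Y₂ w₁ w₂ w₃ v) (h' : IsIterate Y₁ Y₂ w₁ w₂' w₃ v') :
    IsIterate Y₁ Y₂ w₁ (w₂ + w₂') w₃ (v + v') := fun φ hφ => by
  convert (h φ hφ).add (h' φ hφ) using 1 <;> funext p q <;> simp [productSeries]

theorem IsIterate.add₃ {w₁ : W₁} {w₂ : W₂} {w₃ w₃' : W₃} {v v' : ℂ → ℂ → W₄}
    (h : IsIterate Y₁ Y₂ w₁ w₂ w₃ v) (h' : IsIterate Y₁ Y₂ w₁ w₂ w₃' v') :
    IsIterate Y₁ Y₂ w₁ w₂ (w₃ + w₃') (v + v') := fun φ hφ => by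
  convert (h φ hφ).add (h' φ hφ) using 1 <;> funext p q <;> simp [productSeries]

theorem IsIterate.smul {w₁ : W₁} {w₂ : W₂} {w₃ : W₃} {v : ℂ → ℂ → W₄} (a : ℂ)
    (h : IsIterate Y₁ Y₂ w₁ w₂ w₃ v) :
    IsIterate Y₁ Y₂ (a • w₁) w₂ w₃ (a • v) ∧ IsIterate Y₁ Y₂ w₁ (a • w₂) w₃ (a • v) ∧
      IsIterate Y₁ Y₂ w₁ w₂ (a • w₃) (a • v) := by
  refine ⟨fun φ hφ => ?_, fun φ hφ => ?_, fun φ hφ => ?_⟩ <;>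
    convert (h φ hφ).smul a using 1 <;> funext p q <;> simp [productSeries]

theorem isIterate_zero {w₁ : W₁} {w₂ : W₂} {w₃ : W₃} (h : w₁ = 0 ∨ w₂ = 0 ∨ w₃ = 0) :
    IsIterate Y₁ Y₂ w₁ w₂ w₃ 0 := fun φ hφ => by
  convert HasExtension.zero using 1
  · funext p q
    rcases h with rfl | rfl | rfl <;> simp [productSeries]
  · funext p q; simp

theorem product_mem {h₁ h₂ h₃ : ℂ} {w₁ : W₁} {w₂ : W₂} {w₃ : W₃} (hw₁ : w₁ ∈ M₁.weightSpace h₁)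
    (hw₂ : w₂ ∈ M₂.weightSpace h₂) (hw₃ : w₃ ∈ M₃.weightSpace h₃) (p q : ℂ) :
    Y₁.modes (-p - 1) w₁ (Y₂.modes (-q - 1) w₂ w₃) ∈ M₄.weightSpace (h₁ + h₂ + h₃ + p + q) := by
  have := Y₁.modes_mem hw₁ (Y₂.modes_mem hw₂ hw₃ (-q - 1)) (-p - 1)
  convert this using 2
  ring

/-- Existence of the iterate for homogeneous vectors. -/
theorem exists_isIterate_of_homogeneous (hM₄ : M₄.IsGraded) {N : ℤ} {h₁ h₂ h₃ : ℂ} {w₁ : W₁}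
    {w₂ : W₂} {w₃ : W₃} (hw₁ : w₁ ∈ M₁.weightSpace h₁)
    (hw₂ : w₂ ∈ M₂.weightSpace h₂) (hw₃ : w₃ ∈ M₃.weightSpace h₃)
    (hconv : ∀ h₄ : ℂ, ∀ φ : Module.Dual ℂ W₄, M₄.IsHomogeneousDual h₄ φ →
      ConvergesInDomain (productSeries Y₁ Y₂ φ w₁ w₂ w₃) ∧
      ∃ D : ExpansionData, (∀ i, (N : ℝ) < (h₁ + h₂ + D.s i).re) ∧
        ExtendsTo (productSeries Y₁ Y₂ φ w₁ w₂ w₃) D) :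
    ∃ v, IsIterate Y₁ Y₂ w₁ w₂ w₃ v ∧
      (∀ p q, v (-p - 1) (-q - 1) ∈ M₄.weightSpace (h₁ + h₂ + h₃ + p + q)) ∧
      ∀ n m, (h₁ + h₂).re - N ≤ n.re + 1 → v n m = 0 := by
  -- Projecting to weight `h` makes an arbitrary functional homogeneous. The condition on `N` gives
  -- a lower bound for the powers of `z₀` that does not involve `φ`, `h` or `w₃`.
  have hext : ∀ h φ, ∃ e, HasExtension (productSeries Y₁ Y₂ (φ ∘ₗ M₄.weightProj hM₄ h) w₁ w₂ w₃) e ∧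
      ∀ p q, p.re ≤ N - (h₁ + h₂).re → e p q = 0 := fun h φ => by
    obtain ⟨hc, D, hD, hex⟩ := hconv h _ (WeakModule.isHomogeneousDual_comp_weightProj hM₄ h φ)
    refine ⟨D.series, ⟨hc, D, hex, rfl⟩, fun p q hp => ?_⟩
    by_contra hne
    obtain ⟨i, j, hj, -⟩ := ExpansionData.exists_of_series_ne_zero hne
    have h1 := hD i
    have h2 := congrArg Complex.re hj
    simp only [Complex.add_re, Complex.natCast_re] at h1 h2 hp
    have : (0 : ℝ) ≤ j := Nat.cast_nonneg j
    linarith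
  choose e he he0 using hext
  have hφadd : ∀ h φ χ, e h (φ + χ) = e h φ + e h χ := fun h φ χ => by
    exact (he h _).unique ((he h φ).add (he h χ))
  have hφsmul : ∀ h (a : ℂ) φ, e h (a • φ) = a • e h φ := fun h a φ => by
    exact (he h _).unique ((he h φ).smul a)
  let E : ℂ → Submodule ℂ W₄ := fun h => Submodule.span ℂ (Set.range
    fun x : {x : ℂ × ℂ // h₁ + h₂ + h₃ + x.1 + x.2 = h} =>
      Y₁.modes (-x.1.1 - 1) w₁ (Y₂.modes (-x.1.2 - 1) w₂ w₃))
  have hE : ∀ h, E h ≤ M₄.weightSpace h := fun h => by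
    rw [Submodule.span_le]
    rintro _ ⟨⟨x, hx⟩, rfl⟩
    change _ ∈ M₄.weightSpace h
    have := product_mem (Y₁ := Y₁) (Y₂ := Y₂) hw₁ hw₂ hw₃ x.1 x.2
    rwa [hx] at this
  -- Convergence at the single point `t₁ = 1`, `t₂ = 0`, for all functionals on the weight space, is
  -- enough.
  have hfin : ∀ h, FiniteDimensional ℂ (E h) := fun h => by
    refine finiteDimensional_span_of_summable _ (fun x => Complex.exp (x.1.1 * 1) *
      Complex.exp (x.1.2 * 0)) (fun x => mul_ne_zero (Complex.exp_ne_zero _)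
        (Complex.exp_ne_zero _)) fun φ => ?_
    have h1 := ((he h φ).1 1 0 (by simp)).comp_injective
      (Subtype.val_injective (p := fun x : ℂ × ℂ => h₁ + h₂ + h₃ + x.1 + x.2 = h))
    refine h1.congr fun x => ?_
    simp only [Function.comp_apply, productSeries, LinearMap.comp_apply]
    rw [WeakModule.weightProj_of_mem hM₄]
    have := product_mem (Y₁ := Y₁) (Y₂ := Y₂) hw₁ hw₂ hw₃ x.1.1 x.1.2
    rwa [x.2] at this
  -- The coefficient depends linearly on `φ` by uniqueness. If `φ` vanishes on `E`, the projected
  -- product series is zero and so is its expansion.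
  have hΛ : ∀ p q : ℂ, ∃ v ∈ E (h₁ + h₂ + h₃ + p + q), ∀ φ,
      e (h₁ + h₂ + h₃ + p + q) φ p q = φ v := fun p q => by
    have := hfin (h₁ + h₂ + h₃ + p + q)
    refine exists_eq_eval _ (⟨⟨fun φ => e (h₁ + h₂ + h₃ + p + q) φ p q, fun φ χ => ?_⟩,
      fun a φ => ?_⟩ : Module.Dual ℂ W₄ →ₗ[ℂ] ℂ) fun φ hφ => ?_
    · rw [hφadd]; rfl
    · simp only [hφsmul]; rfl
    · change e (h₁ + h₂ + h₃ + p + q) φ p q = 0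
      rw [show e (h₁ + h₂ + h₃ + p + q) φ = 0 from (he _ φ).unique ?_]
      · rfl
      · convert HasExtension.zero using 1
        funext p' q'
        simp only [productSeries, LinearMap.comp_apply, Pi.zero_apply]
        by_cases hpq : h₁ + h₂ + h₃ + p' + q' = h₁ + h₂ + h₃ + p + q
        · rw [WeakModule.weightProj_of_mem hM₄ (hpq ▸ product_mem hw₁ hw₂ hw₃ _ _)]
          exact hφ _ (Submodule.subset_span ⟨⟨(p', q'), hpq⟩, rfl⟩)
        · rw [WeakModule.weightProj_of_ne hM₄ hpq (product_mem hw₁ hw₂ hw₃ _ _), map_zero]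
  choose v hvE hv using hΛ
  have e1 : ∀ x : ℂ, -(-x - 1) - 1 = x := fun x => by ring
  refine ⟨fun n m => v (-n - 1) (-m - 1), fun φ hφ => ?_, fun p q => ?_, fun n m hn => ?_⟩
  · simp only [e1]
    refine hφ.induction hM₄ (p := fun φ => HasExtension (productSeries Y₁ Y₂ φ w₁ w₂ w₃)
      fun p q => φ (v p q)) HasExtension.zero (fun φ χ h h' => ?_) fun h φ hφ => ?_
    · exact h.add h'
    · have h1 : φ ∘ₗ M₄.weightProj hM₄ h = φ := by
        refine WeakModule.ext_weightSpace hM₄ fun k w hw => ?_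
        rw [LinearMap.comp_apply]
        by_cases hk : k = h
        · rw [WeakModule.weightProj_of_mem hM₄ (hk ▸ hw)]
        · rw [WeakModule.weightProj_of_ne hM₄ hk hw, map_zero, hφ k hk w hw]
      have h2 := he h φ
      have h3 := h2
      rw [h1] at h3
      convert h3 using 1
      funext p q
      -- The vector at `(p, q)` was built from functionals of one weight only. In other degrees both
      -- sides vanish, since a homogeneous product has a homogeneous expansion.
      by_cases hpq : h₁ + h₂ + h₃ + p + q = h
      · rw [← hpq, hv]
      · rw [hφ _ hpq _ (hE _ (hvE p q))]
        refine (h3.support (S := h - h₁ - h₂ - h₃) (fun p' q' hne => ?_) fun h4 => hpq ?_).symm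
        · refine hφ _ (fun h5 => hne ?_) _ (product_mem hw₁ hw₂ hw₃ p' q')
          rw [← h5]; ring
        · linear_combination h4
  · simp only [e1]
    exact hE _ (hvE p q)
  · rw [← Module.forall_dual_apply_eq_zero_iff ℂ]
    intro φ
    rw [← hv]
    refine he0 _ _ _ _ ?_
    simp only [Complex.sub_re, Complex.neg_re, Complex.one_re]
    linarith

variable (Y₁ Y₂) in
/-- The modes `ψ_n(w₁,w₂,z₂)` of the iterate. -/
structure IterateModes where
  ψ : ℂ → W₁ →ₗ[ℂ] W₂ →ₗ[ℂ] (ℂ → W₃ →ₗ[ℂ] W₄)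
  hasExtension : ∀ w₁ w₂ w₃, IsIterate Y₁ Y₂ w₁ w₂ w₃ fun n m => ψ n w₁ w₂ m w₃
  mem : ∀ {h₁ h₂ h₃ : ℂ} {w₁ w₂ w₃}, w₁ ∈ M₁.weightSpace h₁ → w₂ ∈ M₂.weightSpace h₂ →
    w₃ ∈ M₃.weightSpace h₃ → ∀ n m, ψ n w₁ w₂ m w₃ ∈
      M₄.weightSpace (h₁ + h₂ + h₃ - (n + 1) - (m + 1))
  trunc_left : ∀ w₁ w₂, ∃ C : ℝ, ∀ n, C ≤ n.re → ψ n w₁ w₂ = 0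
  trunc_right : ∀ n w₁ w₂, TruncatedSeries (ψ n w₁ w₂)

theorem iSup_induction₃ {W₁ W₂ W₃ ι : Type*} [AddCommGroup W₁] [Module ℂ W₁]
    [AddCommGroup W₂] [Module ℂ W₂] [AddCommGroup W₃] [Module ℂ W₃] {S₁ : ι → Submodule ℂ W₁}
    {S₂ : ι → Submodule ℂ W₂} {S₃ : ι → Submodule ℂ W₃} (hS₁ : ⨆ i, S₁ i = ⊤)
    (hS₂ : ⨆ i, S₂ i = ⊤) (hS₃ : ⨆ i, S₃ i = ⊤) {p : W₁ → W₂ → W₃ → Prop}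
    (hmem : ∀ i j k, ∀ x ∈ S₁ i, ∀ y ∈ S₂ j, ∀ z ∈ S₃ k, p x y z)
    (hzero : ∀ x y z, x = 0 ∨ y = 0 ∨ z = 0 → p x y z)
    (h₁ : ∀ x x' y z, p x y z → p x' y z → p (x + x') y z)
    (h₂ : ∀ x y y' z, p x y z → p x y' z → p x (y + y') z)
    (h₃ : ∀ x y z z', p x y z → p x y z' → p x y (z + z')) (x : W₁) (y : W₂) (z : W₃) :
    p x y z := by
  have hx : x ∈ ⨆ i, S₁ i := by rw [hS₁]; trivial
  have hy : y ∈ ⨆ i, S₂ i := by rw [hS₂]; trivial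
  have hz : z ∈ ⨆ i, S₃ i := by rw [hS₃]; trivial
  refine Submodule.iSup_induction S₁ (motive := fun x => p x y z) hx (fun i x hx => ?_)
    (hzero _ _ _ (by simp)) fun x x' => h₁ x x' y z
  refine Submodule.iSup_induction S₂ (motive := fun y => p x y z) hy (fun j y hy => ?_)
    (hzero _ _ _ (by simp)) fun y y' => h₂ x y y' z
  exact Submodule.iSup_induction S₃ (motive := fun z => p x y z) hz (fun k z hz =>
    hmem i j k x hx y hy z hz) (hzero _ _ _ (by simp)) fun z z' => h₃ x y z z'

/-- Existence spreads from homogeneous vectors by additivity, and uniqueness of the iterate turns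
the chosen values into a trilinear map. -/
theorem exists_iterateModes (hM₁ : M₁.IsGraded) (hM₂ : M₂.IsGraded) (hM₃ : M₃.IsGraded)
    (hM₄ : M₄.IsGraded) (hconv : ConvergenceExtension Y₁ Y₂) :
    Nonempty (IterateModes Y₁ Y₂) := by
  obtain ⟨N, hN⟩ := hconv
  have hhom := fun {h₁ h₂ h₃ : ℂ} {w₁ w₂ w₃} (hw₁ : w₁ ∈ M₁.weightSpace h₁)
    (hw₂ : w₂ ∈ M₂.weightSpace h₂) (hw₃ : w₃ ∈ M₃.weightSpace h₃) =>
    exists_isIterate_of_homogeneous hM₄ (N := N) hw₁ hw₂ hw₃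
      fun h₄ => hN h₁ h₂ h₃ h₄ w₁ hw₁ w₂ hw₂ w₃ hw₃
  have hex : ∀ w₁ w₂ w₃, ∃ v, IsIterate Y₁ Y₂ w₁ w₂ w₃ v := by
    refine iSup_induction₃ hM₁.1 hM₂.1 hM₃.1 ?_ ?_ ?_ ?_ ?_
    · intro i j k x hx y hy z hz
      obtain ⟨v, hv, -⟩ := hhom hx hy hz
      exact ⟨v, hv⟩
    · exact fun x y z h => ⟨0, isIterate_zero h⟩
    · rintro x x' y z ⟨v, hv⟩ ⟨v', hv'⟩
      exact ⟨_, hv.add₁ hv'⟩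
    · rintro x y y' z ⟨v, hv⟩ ⟨v', hv'⟩
      exact ⟨_, hv.add₂ hv'⟩
    · rintro x y z z' ⟨v, hv⟩ ⟨v', hv'⟩
      exact ⟨_, hv.add₃ hv'⟩
  choose v hv using hex
  have huniq := fun {w₁ w₂ w₃ v'} (h : IsIterate Y₁ Y₂ w₁ w₂ w₃ v') =>
    (hv w₁ w₂ w₃).unique hM₄ h
  let ψ : ℂ → W₁ →ₗ[ℂ] W₂ →ₗ[ℂ] (ℂ → W₃ →ₗ[ℂ] W₄) := fun n =>
    LinearMap.mk₂ ℂ (fun w₁ w₂ m =>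
      { toFun := fun w₃ => v w₁ w₂ w₃ n m
        map_add' := fun w₃ w₃' => by rw [huniq ((hv w₁ w₂ w₃).add₃ (hv w₁ w₂ w₃'))]; rfl
        map_smul' := fun a w₃ => by rw [huniq ((hv w₁ w₂ w₃).smul a).2.2]; rfl })
      (fun w₁ w₁' w₂ => by
        ext m w₃
        change v (w₁ + w₁') w₂ w₃ n m = v w₁ w₂ w₃ n m + v w₁' w₂ w₃ n m
        rw [huniq ((hv w₁ w₂ w₃).add₁ (hv w₁' w₂ w₃))]; rfl)
      (fun a w₁ w₂ => by
        ext m w₃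
        change v (a • w₁) w₂ w₃ n m = a • v w₁ w₂ w₃ n m
        rw [huniq ((hv w₁ w₂ w₃).smul a).1]; rfl)
      (fun w₁ w₂ w₂' => by
        ext m w₃
        change v w₁ (w₂ + w₂') w₃ n m = v w₁ w₂ w₃ n m + v w₁ w₂' w₃ n m
        rw [huniq ((hv w₁ w₂ w₃).add₂ (hv w₁ w₂' w₃))]; rfl)
      (fun a w₁ w₂ => by
        ext m w₃
        change v w₁ (a • w₂) w₃ n m = a • v w₁ w₂ w₃ n m
        rw [huniq ((hv w₁ w₂ w₃).smul a).2.1]; rfl)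
  have hψ : ∀ n w₁ w₂ m w₃, ψ n w₁ w₂ m w₃ = v w₁ w₂ w₃ n m := fun _ _ _ _ _ => rfl
  have hmem : ∀ {h₁ h₂ h₃ : ℂ} {w₁ w₂ w₃}, w₁ ∈ M₁.weightSpace h₁ → w₂ ∈ M₂.weightSpace h₂ →
    w₃ ∈ M₃.weightSpace h₃ → ∀ n m, ψ n w₁ w₂ m w₃ ∈
      M₄.weightSpace (h₁ + h₂ + h₃ - (n + 1) - (m + 1)) := by
    intro h₁ h₂ h₃ w₁ w₂ w₃ hw₁ hw₂ hw₃ n m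
    obtain ⟨v', hv', h1, -⟩ := hhom hw₁ hw₂ hw₃
    have := h1 (-n - 1) (-m - 1)
    have e1 : ∀ x : ℂ, -(-x - 1) - 1 = x := fun x => by ring
    rw [e1, e1, ← huniq hv'] at this
    rw [hψ]
    convert this using 2
    ring
  refine ⟨⟨ψ, hv, hmem, ?_, ?_⟩⟩
  · intro w₁ w₂
    have h1 : w₁ ∈ ⨆ h, M₁.weightSpace h := by rw [hM₁.1]; trivial
    have h2 : w₂ ∈ ⨆ h, M₂.weightSpace h := by rw [hM₂.1]; trivial
    refine Submodule.iSup_induction _ (motive := fun w₁ => ∃ C : ℝ, ∀ n : ℂ, C ≤ n.re →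
      ψ n w₁ w₂ = 0) h1 (fun h₁ w₁ hw₁ => ?_) ⟨0, fun n _ => by simp⟩ ?_
    · refine Submodule.iSup_induction _ (motive := fun w₂ => ∃ C : ℝ, ∀ n : ℂ, C ≤ n.re →
        ψ n w₁ w₂ = 0) h2 (fun h₂ w₂ hw₂ => ?_) ⟨0, fun n _ => by simp⟩ ?_
      -- This bound does not involve `w₃`, so `ψ_n(w₁, w₂)` vanishes as a whole series.
      · refine ⟨(h₁ + h₂).re - N - 1, fun n hn => ?_⟩
        funext m
        refine WeakModule.ext_weightSpace hM₃ fun h₃ w₃ hw₃ => ?_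
        obtain ⟨v', hv', -, h3⟩ := hhom hw₁ hw₂ hw₃
        rw [hψ, huniq hv', h3 n m (by linarith)]
        rfl
      · rintro x y ⟨C, hC⟩ ⟨C', hC'⟩
        refine ⟨max C C', fun n hn => ?_⟩
        rw [map_add, hC n ((le_max_left _ _).trans hn), hC' n ((le_max_right _ _).trans hn),
          add_zero]
    · rintro x y ⟨C, hC⟩ ⟨C', hC'⟩
      refine ⟨max C C', fun n hn => ?_⟩
      rw [map_add, LinearMap.add_apply, hC n ((le_max_left _ _).trans hn),
        hC' n ((le_max_right _ _).trans hn), add_zero]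
  · intro n w₁ w₂ β w₃
    refine iSup_induction₃ hM₁.1 hM₂.1 hM₃.1 (p := fun w₁ w₂ w₃ => ∃ N : ℤ, ∀ k : ℤ, N ≤ k →
      ψ n w₁ w₂ (β + k) w₃ = 0) ?_ ?_ ?_ ?_ ?_ w₁ w₂ w₃
    · intro h₁ h₂ h₃ w₁ hw₁ w₂ hw₂ w₃ hw₃
      obtain ⟨N', hN'⟩ := hM₄.2 (h₁ + h₂ + h₃ - (n + 1) - (β + 1))
      refine ⟨1 - N', fun k hk => ?_⟩
      have h1 := hmem hw₁ hw₂ hw₃ n (β + k)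
      have h2 := hN' (-k) (by omega)
      have h3 : h₁ + h₂ + h₃ - (n + 1) - (β + 1) + ((-k : ℤ) : ℂ) =
        h₁ + h₂ + h₃ - (n + 1) - (β + k + 1) := by push_cast; ring
      rw [h3] at h2
      rwa [h2, Submodule.mem_bot] at h1
    · intro x y z h
      refine ⟨0, fun k _ => ?_⟩
      rcases h with rfl | rfl | rfl <;> simp
    · rintro x x' y z ⟨N, hN⟩ ⟨N', hN'⟩
      refine ⟨max N N', fun k hk => ?_⟩
      rw [map_add, LinearMap.add_apply, Pi.add_apply, LinearMap.add_apply,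
        hN k ((le_max_left _ _).trans hk), hN' k ((le_max_right _ _).trans hk), add_zero]
    · rintro x y y' z ⟨N, hN⟩ ⟨N', hN'⟩
      refine ⟨max N N', fun k hk => ?_⟩
      rw [map_add, Pi.add_apply, LinearMap.add_apply,
        hN k ((le_max_left _ _).trans hk), hN' k ((le_max_right _ _).trans hk), add_zero]
    · rintro x y z z' ⟨N, hN⟩ ⟨N', hN'⟩
      refine ⟨max N N', fun k hk => ?_⟩
      rw [map_add, hN k ((le_max_left _ _).trans hk), hN' k ((le_max_right _ _).trans hk),
        add_zero]

end Iterate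

end VertexAssoc

/-! ### Jacobi identity and derivative properties of the iterate. -/

namespace VertexAssoc

set_option linter.unusedSectionVars false

open Filter

/-- `HasExtension` as a linear relation between series indexed by modes. -/
def extensionRelation : Submodule ℂ ((ℂ → ℂ → ℂ) × (ℂ → ℂ → ℂ)) where
  carrier := {x | HasExtension (fun p q => x.1 (-p - 1) (-q - 1)) fun p q => x.2 (-p - 1) (-q - 1)}
  zero_mem' := HasExtension.zero
  add_mem' := fun h h' => HasExtension.add h h'
  smul_mem' := fun a _ h => HasExtension.smul a h

theorem mem_extensionRelation {c e : ℂ → ℂ → ℂ} : (c, e) ∈ extensionRelation ↔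
    HasExtension (fun p q => c (-p - 1) (-q - 1)) fun p q => e (-p - 1) (-q - 1) := Iff.rfl

section Iterate

variable {V : Type*} [AddCommGroup V] [Module ℂ V] {A : VertexOperatorAlgebra V}
  {W₁ W₂ W₃ W₄ W₅ : Type*} [AddCommGroup W₁] [Module ℂ W₁]
  [AddCommGroup W₂] [Module ℂ W₂] [AddCommGroup W₃] [Module ℂ W₃] [AddCommGroup W₄] [Module ℂ W₄]
  [AddCommGroup W₅] [Module ℂ W₅]
  {M₁ : WeakModule A W₁} {M₂ : WeakModule A W₂} {M₃ : WeakModule A W₃}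
  {M₄ : WeakModule A W₄} {M₅ : WeakModule A W₅}
  {Y₁ : IntertwiningOperator M₁ M₅ M₄} {Y₂ : IntertwiningOperator M₂ M₃ M₅}

theorem IsGeneralizedLeft.locality {Φ : ℂ → W₃ →ₗ[ℂ] W₄} (h : IsGeneralizedLeft M₃ M₄ Φ) (a : V) :
    ∃ k : ℕ, ∀ m n u, bracketSum (M₃.mode a) (M₄.mode a) Φ k m n u = 0 := by
  obtain ⟨k, -, hk⟩ := h.2.2 a
  refine ⟨k, fun m n u => ?_⟩
  rw [bracketSum_natCast _ _ _ _ h.1 (M₃.truncatedModes a)]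
  simp only [smul_sub, Finset.sum_sub_distrib]
  exact sub_eq_zero.2 (hk m n u)

/-- Positivity of the order costs nothing, since `k` may be replaced by `k + 1`. -/
theorem isGeneralizedLeft_iff {Φ : ℂ → W₃ →ₗ[ℂ] W₄} : IsGeneralizedLeft M₃ M₄ Φ ↔
    TruncatedSeries Φ ∧
    (∀ (n : ℂ) (u : W₃), M₄.L (-1) (Φ n u) - Φ n (M₃.L (-1) u) = (-n) • Φ (n - 1) u) ∧
    ∀ a, ∃ k : ℕ, ∀ m n u, bracketSum (M₃.mode a) (M₄.mode a) Φ k m n u = 0 := by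
  refine ⟨fun h => ⟨h.1, h.2.1, h.locality⟩, fun ⟨h1, h2, h3⟩ => ⟨h1, h2, fun a => ?_⟩⟩
  obtain ⟨k, hk⟩ := h3 a
  refine ⟨k + 1, k.succ_pos, fun m r u => ?_⟩
  have h4 := bracketSum_eq_zero_of_le h1 (M₃.truncatedModes a) hk
    (l := ((k + 1 : ℕ) : ℤ)) (by push_cast; omega) m r u
  rw [bracketSum_natCast _ _ _ _ h1 (M₃.truncatedModes a)] at h4
  simp only [smul_sub, Finset.sum_sub_distrib] at h4
  exact sub_eq_zero.1 h4

namespace IterateModes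

variable (P : IterateModes Y₁ Y₂)

theorem trunc_coset (w₁ : W₁) (w₂ : W₂) (β : ℂ) :
    ∃ N : ℤ, ∀ k : ℤ, N ≤ k → P.ψ (β + k) w₁ w₂ = 0 := by
  obtain ⟨C, hC⟩ := P.trunc_left w₁ w₂
  refine ⟨⌈C - β.re⌉, fun k hk => hC _ ?_⟩
  have := Int.ceil_le.1 hk
  rw [Complex.add_re, Complex.intCast_re]
  linarith

/-- The product and the iterate of `Y₁` and `Y₂`, for the modes of `a`. -/
def system (hM₄ : M₄.IsGraded) (a : V) : AssociativitySystem ℂ W₁ W₂ W₃ W₄ W₅ where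
  α₁ := M₁.mode a
  α₂ := M₂.mode a
  α₃ := M₃.mode a
  α₄ := M₄.mode a
  α₅ := M₅.mode a
  trunc₁ := M₁.truncatedModes a
  trunc₂ := M₂.truncatedModes a
  trunc₃ := M₃.truncatedModes a
  trunc₅ := M₅.truncatedModes a
  I₁ := Y₁.modes
  I₂ := Y₂.modes
  I₁_trunc w β u := Y₁.truncation w u β
  I₂_trunc w β u := Y₂.truncation w u β
  jacobi₁ := Y₁.jacobi_eq a
  jacobi₂ := Y₂.jacobi_eq a
  ψ := P.ψ
  ψ_trunc := P.trunc_coset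
  ψ_trunc' := P.trunc_right
  F := {φ | M₄.InRestrictedDual φ}
  F_comp φ hφ m := (WeakModule.restrictedDual_mode hM₄ hφ a).1 m
  F_trunc φ hφ := (WeakModule.restrictedDual_mode hM₄ hφ a).2
  F_sep v hv := WeakModule.eq_zero_of_restrictedDual hM₄ hv
  R := extensionRelation
  R_shift₁ c e h := by
    rw [mem_extensionRelation] at h ⊢
    convert h.mul_first using 1 <;> funext p q <;> ring_nf
  R_shift₂ c e h k := by
    rw [mem_extensionRelation] at h ⊢
    convert h.mul_second k using 1 <;> funext p q <;> ring_nf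
  R_unique e h := by
    have h1 := (mem_extensionRelation.1 h).unique HasExtension.zero
    funext n m
    have h2 := congrFun (congrFun h1 (-n - 1)) (-m - 1)
    have e1 : ∀ x : ℂ, -(-x - 1) - 1 = x := fun x => by ring
    simp only [e1] at h2
    exact h2
  rel φ hφ w₁ w₂ w₃ := P.hasExtension w₁ w₂ w₃ φ hφ

theorem residueAction_eq (hM₄ : M₄.IsGraded) (a : V) (m : ℤ) (n : ℂ) (w₁ : W₁) (w₂ : W₂) (r : ℂ) (w₃ : W₃) :
    residueAction (M₃.mode a) (M₄.mode a) m (P.ψ n w₁ w₂) r w₃ = P.ψ n w₁ (M₂.mode a m w₂) r w₃ +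
      psum m fun i => P.ψ (n + ((m - i : ℤ) : ℂ)) (M₁.mode a i w₁) w₂ r w₃ :=
  (P.system hM₄ a).residueAction_iterate w₁ w₂ w₃ m n r

theorem locality (hM₄ : M₄.IsGraded) (a : V) (n : ℂ) (w₁ : W₁) (w₂ : W₂) : ∃ k : ℕ, ∀ m r u,
    bracketSum (M₃.mode a) (M₄.mode a) (P.ψ n w₁ w₂) k m r u = 0 :=
  (P.system hM₄ a).locality n w₁ w₂

theorem jacobi (hM₄ : M₄.IsGraded) (a : V) (w₁ : W₁) (w₂ : W₂) (r : ℂ) (w₃ : W₃) (l m : ℤ) (n : ℂ) :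
    bsum l (fun i => residueAction (M₃.mode a) (M₄.mode a) (m + l - i) (P.ψ (n + i) w₁ w₂) r w₃
        - (l.negOnePow : ℤ) • P.ψ (n + l - i) w₁ (M₂.mode a (m + i) w₂) r w₃) =
      psum m fun i => P.ψ (m + n - i) (M₁.mode a (l + i) w₁) w₂ r w₃ :=
  sub_eq_zero.1 ((P.system hM₄ a).iterDefect_eq_zero (fun n w₁ w₂ => by
    obtain ⟨k, hk⟩ := P.locality hM₄ a n w₁ w₂
    exact ⟨k, hk⟩) w₁ w₂ r w₃ l m n)

/-- Equality of modes from an expansion of the product. -/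
theorem eq_of_isIterate (hM₄ : M₄.IsGraded) (w₁ : W₁) (w₂ : W₂) (w₃ : W₃) {v : ℂ → ℂ → W₄}
    (h : IsIterate Y₁ Y₂ w₁ w₂ w₃ v) (n m : ℂ) : P.ψ n w₁ w₂ m w₃ = v n m :=
  congrFun (congrFun ((P.hasExtension w₁ w₂ w₃).unique hM₄ h) n) m

theorem L_neg_one_left (hM₄ : M₄.IsGraded) (n : ℂ) (w₁ : W₁) (w₂ : W₂) :
    P.ψ n (M₁.L (-1) w₁) w₂ = (-n) • P.ψ (n - 1) w₁ w₂ := by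
  ext m w₃
  refine P.eq_of_isIterate hM₄ _ _ _ (v := fun n m => (-n) • P.ψ (n - 1) w₁ w₂ m w₃)
    (fun φ hφ => ?_) n m
  convert (P.hasExtension w₁ w₂ w₃ φ hφ).derivative using 1
  · funext p q
    simp only [productSeries, Y₁.derivative, LinearMap.smul_apply, map_smul, smul_eq_mul]
    ring_nf
  · funext p q
    simp only [map_smul, smul_eq_mul]
    ring_nf

/-- For a series of total degree `S`, Euler's formula gives `∂₂ = z₂⁻¹ (S - z₁ ∂₁)`, so the
`z₂`-derivative needs no separate analytic argument. -/
theorem isIterate_L_neg_one_of_homogeneous (hM₄ : M₄.IsGraded) {h₁ h₂ h₃ : ℂ} {w₁ : W₁}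
    {w₂ : W₂} {w₃ : W₃} (hw₁ : w₁ ∈ M₁.weightSpace h₁)
    (hw₂ : w₂ ∈ M₂.weightSpace h₂) (hw₃ : w₃ ∈ M₃.weightSpace h₃) :
    IsIterate Y₁ Y₂ w₁ (M₂.L (-1) w₂) w₃ fun n m =>
      (-m) • P.ψ n w₁ w₂ (m - 1) w₃ + n • P.ψ (n - 1) w₁ w₂ m w₃ := by
  intro φ hφ
  refine hφ.induction hM₄ (p := fun φ => HasExtension (productSeries Y₁ Y₂ φ w₁ (M₂.L (-1) w₂) w₃)
    fun p q => φ ((-(-q - 1)) • P.ψ (-p - 1) w₁ w₂ (-q - 1 - 1) w₃ +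
      (-p - 1) • P.ψ (-p - 1 - 1) w₁ w₂ (-q - 1) w₃)) HasExtension.zero
    (fun φ χ h h' => h.add h') fun h φ hφ => ?_
  have h1 := P.hasExtension w₁ w₂ w₃ φ hφ.inRestrictedDual
  set S := h - h₁ - h₂ - h₃ with hS
  have hc : ∀ p q, p + q ≠ S → productSeries Y₁ Y₂ φ w₁ w₂ w₃ p q = 0 := fun p q hne => by
    refine hφ _ (fun h5 => hne ?_) _ (product_mem hw₁ hw₂ hw₃ p q)
    rw [hS, ← h5]; ring
  have he := fun {p q : ℂ} => h1.support hc (p := p) (q := q)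
  -- This is Euler's operator; multiplication by `z₁` becomes `z₀ + z₂` on the expansion, whence the
  -- additional `z₀`-derivative.
  have h2 := ((h1.mul_second (-1)).smul S).add ((h1.derivative.mul_first.mul_second (-1)).smul (-1))
  convert h2 using 1
  · funext p q
    have h3 : productSeries Y₁ Y₂ φ w₁ (M₂.L (-1) w₂) w₃ p q =
        (q + 1) * productSeries Y₁ Y₂ φ w₁ w₂ w₃ p (q + 1) := by
      simp only [productSeries, Y₂.derivative, LinearMap.smul_apply, map_smul, smul_eq_mul]
      ring_nf
    rw [h3]
    simp only [Pi.add_apply, Pi.smul_apply, smul_eq_mul, sub_neg_eq_add, sub_add_cancel]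
    by_cases hpq : p + (q + 1) = S
    · rw [← hpq]; ring
    · rw [hc _ _ hpq]; ring
  · funext p q
    simp only [Pi.add_apply, Pi.smul_apply, smul_eq_mul, sub_neg_eq_add, sub_add_cancel,
      add_sub_cancel_right, map_add, map_smul]
    have e1 : -q - 1 - 1 = -(q + 1) - 1 := by ring
    have e2 : -p - 1 - 1 = -(p + 1) - 1 := by ring
    rw [e1, e2]
    by_cases hpq : p + (q + 1) = S
    · rw [← hpq]; ring
    · rw [he hpq]; ring

theorem L_neg_one_right (hM₄ : M₄.IsGraded) (hM₁ : M₁.IsGraded) (hM₂ : M₂.IsGraded) (hM₃ : M₃.IsGraded) (n : ℂ)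
    (w₁ : W₁) (w₂ : W₂) (m : ℂ) (w₃ : W₃) : P.ψ n w₁ (M₂.L (-1) w₂) m w₃ =
      (-m) • P.ψ n w₁ w₂ (m - 1) w₃ + n • P.ψ (n - 1) w₁ w₂ m w₃ := by
  refine iSup_induction₃ hM₁.1 hM₂.1 hM₃.1 (p := fun w₁ w₂ w₃ => P.ψ n w₁ (M₂.L (-1) w₂) m w₃ =
      (-m) • P.ψ n w₁ w₂ (m - 1) w₃ + n • P.ψ (n - 1) w₁ w₂ m w₃) ?_ ?_ ?_ ?_ ?_ w₁ w₂ w₃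
  · intro i j k x hx y hy z hz
    exact P.eq_of_isIterate hM₄ _ _ _ (P.isIterate_L_neg_one_of_homogeneous hM₄ hx hy hz) n m
  · rintro x y z (rfl | rfl | rfl) <;> simp
  · intro x x' y z h h'
    simp only [map_add, LinearMap.add_apply, Pi.add_apply, h, h']
    module
  · intro x y y' z h h'
    simp only [map_add, LinearMap.add_apply, Pi.add_apply, h, h']
    module
  · intro x y z z' h h'
    simp only [map_add, h, h']
    module

/-- The commutator formula for `ω_0 = L(-1)` adds the two `L(-1)` formulas, whose `z₀`-derivatives
cancel. -/
theorem isGeneralizedLeft (hM₄ : M₄.IsGraded) (hM₁ : M₁.IsGraded) (hM₂ : M₂.IsGraded) (hM₃ : M₃.IsGraded) (n : ℂ)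
    (w₁ : W₁) (w₂ : W₂) : IsGeneralizedLeft M₃ M₄ (P.ψ n w₁ w₂) := by
  refine isGeneralizedLeft_iff.2 ⟨P.trunc_right n w₁ w₂, fun r u => ?_,
    fun a => P.locality hM₄ a n w₁ w₂⟩
  have h := P.residueAction_eq hM₄ A.omega 0 n w₁ w₂ r u
  simp only [residueAction, bsum_zero_left, psum_zero_left] at h
  simp only [Int.negOnePow_zero, Units.val_one, one_smul, Nat.cast_zero, add_zero,
    sub_zero, Int.cast_zero] at h
  refine h.trans ?_
  change P.ψ n w₁ (M₂.L (-1) w₂) r u + P.ψ n (M₁.L (-1) w₁) w₂ r u = _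
  rw [P.L_neg_one_right hM₄ hM₁ hM₂ hM₃, P.L_neg_one_left hM₄]
  simp only [Pi.smul_apply, LinearMap.smul_apply]
  module

theorem isPsi (w₁ : W₁) (w₂ : W₂) (n : ℂ) : IsPsi Y₁ Y₂ w₁ w₂ n (P.ψ n w₁ w₂) :=
  fun m w₃ φ hφ => by
    rw [(P.hasExtension w₁ w₂ w₃ φ hφ).E12_eq]
    have e1 : ∀ x : ℂ, -(-x - 1) - 1 = x := fun x => by ring
    simp only [e1]

/-- The restricted dual separates points, so the defining property of `ψ_n` admits only one series.
-/
theorem psiSpan_eq (hM₄ : M₄.IsGraded) : psiSpan Y₁ Y₂ = Submodule.span ℂ {Φ | ∃ w₁ w₂ n, Φ = P.ψ n w₁ w₂} := by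
  unfold psiSpan
  congr 1
  ext Φ
  constructor
  · rintro ⟨w₁, w₂, n, h⟩
    refine ⟨w₁, w₂, n, ?_⟩
    ext m w₃
    rw [← sub_eq_zero]
    refine WeakModule.eq_zero_of_restrictedDual hM₄ fun φ hφ => ?_
    rw [map_sub, h m w₃ φ hφ, P.isPsi w₁ w₂ n m w₃ φ hφ, sub_self]
  · rintro ⟨w₁, w₂, n, rfl⟩
    exact ⟨w₁, w₂, n, P.isPsi w₁ w₂ n⟩

theorem ψ_mem (n : ℂ) (w₁ : W₁) (w₂ : W₂) : P.ψ n w₁ w₂ ∈ psiSpan Y₁ Y₂ :=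
  Submodule.subset_span ⟨w₁, w₂, n, P.isPsi w₁ w₂ n⟩

theorem psiSpan_le (P : IterateModes Y₁ Y₂) (hM₄ : M₄.IsGraded)
    (hM₁ : M₁.IsGraded) (hM₂ : M₂.IsGraded) (hM₃ : M₃.IsGraded) :
    psiSpan Y₁ Y₂ ≤ homogeneousGeneralizedLeft M₃ M₄ := by
  rw [P.psiSpan_eq hM₄, Submodule.span_le]
  rintro _ ⟨w₁, w₂, n, rfl⟩
  have h1 : w₁ ∈ ⨆ h, M₁.weightSpace h := by rw [hM₁.1]; trivial
  have h2 : w₂ ∈ ⨆ h, M₂.weightSpace h := by rw [hM₂.1]; trivial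
  refine Submodule.iSup_induction _ (motive := fun w₁ => P.ψ n w₁ w₂ ∈
    homogeneousGeneralizedLeft M₃ M₄) h1 (fun h₁ w₁ hw₁ => ?_) (by simp) fun x y hx hy => by
      rw [map_add, LinearMap.add_apply]; exact add_mem hx hy
  refine Submodule.iSup_induction _ (motive := fun w₂ => P.ψ n w₁ w₂ ∈
    homogeneousGeneralizedLeft M₃ M₄) h2 (fun h₂ w₂ hw₂ => ?_) (by simp) fun x y hx hy => by
      rw [map_add]; exact add_mem hx hy
  refine Submodule.subset_span ⟨P.isGeneralizedLeft hM₄ hM₁ hM₂ hM₃ n w₁ w₂,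
    h₁ + h₂ - (n + 1), fun m h₃ w₃ hw₃ => ?_⟩
  have := P.mem hw₁ hw₂ hw₃ n m
  convert this using 2
  ring

end IterateModes

end Iterate

end VertexAssoc

/-! ### Linearity, vacuum and derivative rules for the residue action. -/

namespace VertexAssoc

set_option linter.unusedSectionVars false

open Filter

section Sums

variable {X : Type*} [AddCommGroup X]

theorem bsum_sub_smul (l : ℤ) {f : ℕ → X} (hf : ∀ᶠ i in atTop, f i = 0) :
    bsum l (fun i => (l - i : ℤ) • f i) = l • bsum (l - 1) f := by
  rw [← bsum_smul _ _ hf]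
  refine finsum_congr fun i => ?_
  have h := choose_mul_choose_comm l 1 i
  rw [Ring.choose_one_right, Ring.choose_one_right, Nat.cast_one] at h
  rw [smul_smul, smul_smul, mul_assoc, mul_assoc, ← h, mul_comm l]

theorem bsum_natCast_smul (l : ℤ) {f : ℕ → X} (hf : ∀ᶠ i in atTop, f i = 0) :
    bsum l (fun i => (i : ℤ) • f i) = (-l) • bsum (l - 1) fun i => f (i + 1) := by
  obtain ⟨N, hN⟩ := eventually_atTop.1 hf
  rw [bsum_eq_sum (N := N + 1) l fun i hi => by rw [hN i (by omega), smul_zero],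
    bsum_eq_sum (N := N) (l - 1) fun i hi => hN _ (by omega), Finset.sum_range_succ',
    Finset.smul_sum]
  simp only [Nat.cast_zero, zero_smul, smul_zero, add_zero]
  refine Finset.sum_congr rfl fun i _ => ?_
  have h := choose_mul_choose l 1 i
  rw [Ring.choose_one_right, Nat.cast_one, Nat.choose_one_right, add_comm 1 i] at h
  rw [smul_smul, smul_smul]
  congr 1
  rw [pow_succ]
  linear_combination (-1 : ℤ) ^ i * h

end Sums

section Action

variable {U₂ U₃ : Type*} [AddCommGroup U₂] [Module ℂ U₂] [AddCommGroup U₃] [Module ℂ U₃]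
  {α₂ β₂ : ℤ → Module.End ℂ U₂} {α₃ β₃ : ℤ → Module.End ℂ U₃} {Φ Φ' : ℂ → U₂ →ₗ[ℂ] U₃}

theorem residueAction_eq_sub (hΦ : TruncatedSeries Φ) (hα : TruncatedModes α₂) (m : ℤ) (n : ℂ)
    (u : U₂) : residueAction α₂ α₃ m Φ n u = bsum m (fun i => α₃ (m - i) (Φ (n + i) u))
      - (m.negOnePow : ℤ) • bsum m fun i => Φ (n + m - i) (α₂ i u) := by
  rw [← bracketSum_zero_middle, bracketSum_eq_sub hΦ hα]
  simp

theorem residueAction_eventually (hΦ : TruncatedSeries Φ) (hα : TruncatedModes α₂) (m : ℤ) (n : ℂ)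
    (u : U₂) : ∀ᶠ i : ℕ in atTop, α₃ (m - i) (Φ (n + i) u)
      - (m.negOnePow : ℤ) • Φ (n + m - i) (α₂ i u) = 0 := by
  filter_upwards [hΦ.eventually n u, hα.eventually' u] with i h1 h2
  rw [h1, h2]; simp

theorem residueAction_add_series (hΦ : TruncatedSeries Φ) (hΦ' : TruncatedSeries Φ')
    (hα : TruncatedModes α₂) (m : ℤ) (n : ℂ) (u : U₂) :
    residueAction α₂ α₃ m (Φ + Φ') n u =
      residueAction α₂ α₃ m Φ n u + residueAction α₂ α₃ m Φ' n u := by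
  unfold residueAction
  rw [← bsum_add _ (residueAction_eventually hΦ hα m n u) (residueAction_eventually hΦ' hα m n u)]
  congr 1
  funext i
  simp only [Pi.add_apply, LinearMap.add_apply, map_add, smul_add]
  abel

theorem residueAction_smul_series (hΦ : TruncatedSeries Φ)
    (hα : TruncatedModes α₂) (c : ℂ) (m : ℤ) (n : ℂ) (u : U₂) :
    residueAction α₂ α₃ m (c • Φ) n u = c • residueAction α₂ α₃ m Φ n u := by
  unfold residueAction
  rw [← bsum_smul _ _ (residueAction_eventually hΦ hα m n u)]
  congr 1
  funext i
  simp only [Pi.smul_apply, LinearMap.smul_apply, map_smul, smul_sub]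
  rw [smul_comm c]

theorem residueAction_add_modes (hΦ : TruncatedSeries Φ)
    (hα : TruncatedModes α₂) (hβ : TruncatedModes β₂) (m : ℤ) (n : ℂ) (u : U₂) :
    residueAction (α₂ + β₂) (α₃ + β₃) m Φ n u =
      residueAction α₂ α₃ m Φ n u + residueAction β₂ β₃ m Φ n u := by
  unfold residueAction
  rw [← bsum_add _ (residueAction_eventually hΦ hα m n u) (residueAction_eventually hΦ hβ m n u)]
  congr 1
  funext i
  simp only [Pi.add_apply, LinearMap.add_apply, map_add, smul_add]
  abel

theorem residueAction_smul_modes (hΦ : TruncatedSeries Φ)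
    (hα : TruncatedModes α₂) (c : ℂ) (m : ℤ) (n : ℂ) (u : U₂) :
    residueAction (c • α₂) (c • α₃) m Φ n u = c • residueAction α₂ α₃ m Φ n u := by
  unfold residueAction
  rw [← bsum_smul _ _ (residueAction_eventually hΦ hα m n u)]
  congr 1
  funext i
  simp only [Pi.smul_apply, LinearMap.smul_apply, map_smul, smul_sub]
  rw [smul_comm c (m.negOnePow : ℤ)]

/-- The vacuum field is the identity: only `m - i = -1` can contribute, and for `i > 0` this forces
`m = i - 1 ≥ 0`, where the binomial coefficient is zero. -/
theorem residueAction_identity (m : ℤ) (n : ℂ) (u : U₂) :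
    residueAction (fun k => if k = -1 then 1 else 0) (fun k => if k = -1 then 1 else 0) m Φ n u =
      if m = -1 then Φ n u else 0 := by
  unfold residueAction bsum
  have hterm : ∀ i : ℕ, ((-1 : ℤ) ^ i * Ring.choose m i) •
      ((if m - i = -1 then 1 else 0 : Module.End ℂ U₃) (Φ (n + i) u) -
        (m.negOnePow : ℤ) • Φ (n + m - i) ((if (i : ℤ) = -1 then 1 else 0 : Module.End ℂ U₂) u)) =
      if i = 0 then (if m = -1 then Φ n u else 0) else 0 := fun i => by
    rw [if_neg (show (i : ℤ) ≠ -1 by omega), LinearMap.zero_apply, map_zero, smul_zero, sub_zero]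
    by_cases hi : m - i = -1
    · rw [if_pos hi, Module.End.one_apply]
      rcases i with _ | i
      · simp only [Nat.cast_zero, sub_zero] at hi
        simp [hi]
      · have hm : m = (i : ℕ) := by push_cast at hi; omega
        rw [if_neg i.succ_ne_zero, hm, Ring.choose_natCast, Nat.choose_succ_self]
        simp
    · rw [if_neg hi]
      by_cases h0 : i = 0
      · subst h0
        rw [if_neg (show m ≠ -1 by simpa using hi)]
        simp
      · simp [h0]
  rw [finsum_congr hterm, finsum_eq_single _ 0 fun i hi => if_neg hi, if_pos rfl]

/-- Integration by parts under the residue; on coefficients it is `(m - i) C(m,i) = m C(m-1,i)` and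
`i C(m,i) = m C(m-1,i-1)`. -/
theorem residueAction_derivative (hΦ : TruncatedSeries Φ) (hα : TruncatedModes α₂)
    (m : ℤ) (n : ℂ) (u : U₂) :
    residueAction (fun k => (-(k : ℂ)) • α₂ (k - 1)) (fun k => (-(k : ℂ)) • α₃ (k - 1)) m Φ n u =
      (-(m : ℂ)) • residueAction α₂ α₃ (m - 1) Φ n u := by
  have hβ : TruncatedModes fun k : ℤ => (-(k : ℂ)) • α₂ (k - 1) := fun u => by
    obtain ⟨N, hN⟩ := hα u
    exact ⟨N + 1, fun k hk => by rw [LinearMap.smul_apply, hN _ (by omega), smul_zero]⟩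
  have e1 : bsum m (fun i : ℕ => ((-((m - i : ℤ) : ℂ)) • α₃ (m - i - 1)) (Φ (n + i) u)) =
      -(m • bsum (m - 1) fun i : ℕ => α₃ (m - 1 - i) (Φ (n + i) u)) := by
    rw [← bsum_sub_smul m (eventually_left hΦ _ _ _),
      ← neg_one_smul ℤ (bsum m _), ← bsum_smul _ _ (eventually_smul
        (c := fun i : ℕ => (m - i : ℤ)) (eventually_left hΦ _ _ _))]
    congr 1
    funext i
    rw [LinearMap.smul_apply, ← Int.cast_neg, Int.cast_smul_eq_zsmul, neg_smul, neg_one_smul,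
      show m - (i : ℤ) - 1 = m - 1 - i by ring]
  have e2 : bsum m (fun i : ℕ => Φ (n + m - i) (((-(((i : ℕ) : ℤ) : ℂ)) • α₂ ((i : ℤ) - 1)) u)) =
      m • bsum (m - 1) fun i : ℕ => Φ (n + ((m - 1 : ℤ) : ℂ) - i) (α₂ i u) := by
    have hev : ∀ᶠ i : ℕ in atTop, Φ (n + m - i) (α₂ ((i : ℤ) - 1) u) = 0 := by
      filter_upwards [hα.eventually (-1) u] with i hi
      rw [show (i : ℤ) - 1 = -1 + i by ring, hi, map_zero]
    have h2 : (fun i : ℕ => Φ (n + m - i) (((-(((i : ℕ) : ℤ) : ℂ)) • α₂ ((i : ℤ) - 1)) u)) =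
        fun i : ℕ => (-1 : ℤ) • (i : ℤ) • Φ (n + m - i) (α₂ ((i : ℤ) - 1) u) := by
      funext i
      rw [LinearMap.smul_apply, ← Int.cast_neg, Int.cast_smul_eq_zsmul, map_zsmul, neg_smul,
        neg_one_smul]
    rw [h2, bsum_smul _ _ (eventually_smul (c := fun i : ℕ => (i : ℤ)) hev),
      bsum_natCast_smul m hev, neg_smul, one_smul, neg_smul, neg_neg]
    congr 2
    funext i
    push_cast
    rw [add_sub_cancel_right]
    congr 2
    ring
  rw [residueAction_eq_sub hΦ hα, residueAction_eq_sub hΦ hβ, e1, e2, ← Int.cast_neg,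
    Int.cast_smul_eq_zsmul, Int.negOnePow_sub, Int.negOnePow_one]
  simp only [Units.val_mul, Units.val_neg, Units.val_one]
  module

end Action

end VertexAssoc

/-! ### Local spaces of series as weak modules. -/

namespace VertexAssoc

set_option linter.unusedSectionVars false

open Filter

/-- Matrix coefficients `c` of `Y(b,z₁)Φ(z₂)` and `e` of `(Y(b,z₀)Φ)(z₂)`: both are
truncated, and after multiplication by high powers of `z₁ = z₀ + z₂` the Jacobi identity reduces
to the equality of the two. -/
def residueRelation : Submodule ℂ ((ℤ → ℂ → ℂ) × (ℤ → ℂ → ℂ)) where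
  carrier := {x | (∀ r : ℂ, ∃ N : ℕ, ∀ i : ℕ, N ≤ i → ∀ n, x.1 n (r + i) = 0) ∧
    (∃ N : ℤ, ∀ n, N ≤ n → ∀ r, x.2 n r = 0) ∧
    ∃ k₀ : ℤ, ∀ k, k₀ ≤ k → ∀ (l : ℤ) (r : ℂ), bsum l (fun i => x.1 (k + l - i) (r + i)) =
      psum k fun i => x.2 (l + i) (k + r - i)}
  zero_mem' := ⟨fun _ => ⟨0, fun _ _ _ => rfl⟩, ⟨0, fun _ _ _ => rfl⟩, 0, fun k _ l r =>
    (bsum_zero_right l).trans (psum_zero_right k).symm⟩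
  add_mem' := by
    rintro x y ⟨h1, ⟨N, hN⟩, k, hk⟩ ⟨h1', ⟨N', hN'⟩, k', hk'⟩
    refine ⟨fun r => ?_, ⟨max N N', fun n hn r => ?_⟩, max k k', fun j hj l r => ?_⟩
    · obtain ⟨a, ha⟩ := h1 r
      obtain ⟨b, hb⟩ := h1' r
      refine ⟨max a b, fun i hi n => ?_⟩
      change x.1 n _ + y.1 n _ = 0
      rw [ha i ((le_max_left _ _).trans hi), hb i ((le_max_right _ _).trans hi), add_zero]
    · change x.2 n _ + y.2 n _ = 0
      rw [hN n ((le_max_left _ _).trans hn), hN' n ((le_max_right _ _).trans hn), add_zero]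
    · obtain ⟨a, ha⟩ := h1 r
      obtain ⟨b, hb⟩ := h1' r
      have e1 := bsum_add l (f := fun i : ℕ => x.1 (j + l - i) (r + i))
        (g := fun i : ℕ => y.1 (j + l - i) (r + i))
        (eventually_atTop.2 ⟨a, fun i hi => ha i hi _⟩)
        (eventually_atTop.2 ⟨b, fun i hi => hb i hi _⟩)
      have e2 := psum_add j (f := fun i : ℕ => x.2 (l + i) (j + r - i))
        (g := fun i : ℕ => y.2 (l + i) (j + r - i))
        (eventually_atTop.2 ⟨(N - l).toNat, fun i hi => hN _ (by omega) _⟩)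
        (eventually_atTop.2 ⟨(N' - l).toNat, fun i hi => hN' _ (by omega) _⟩)
      refine e1.trans (Eq.trans ?_ e2.symm)
      rw [hk j ((le_max_left _ _).trans hj), hk' j ((le_max_right _ _).trans hj)]
  smul_mem' := by
    rintro c x ⟨h1, ⟨N, hN⟩, k, hk⟩
    refine ⟨fun r => ?_, ⟨N, fun n hn r => ?_⟩, k, fun j hj l r => ?_⟩
    · obtain ⟨a, ha⟩ := h1 r
      refine ⟨a, fun i hi n => ?_⟩
      change c * x.1 n _ = 0
      rw [ha i hi, mul_zero]
    · change c * x.2 n _ = 0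
      rw [hN n hn, mul_zero]
    · obtain ⟨a, ha⟩ := h1 r
      have e1 := bsum_smul c l (f := fun i : ℕ => x.1 (j + l - i) (r + i))
        (eventually_atTop.2 ⟨a, fun i hi => ha i hi _⟩)
      have e2 := psum_smul c j (f := fun i : ℕ => x.2 (l + i) (j + r - i))
        (eventually_atTop.2 ⟨(N - l).toNat, fun i hi => hN _ (by omega) _⟩)
      refine e1.trans (Eq.trans ?_ e2.symm)
      rw [hk j hj]

/-- The relation at order `k + 1`, with Pascal's rule splitting one factor `z₀ + z₂` off the right
side. -/
theorem residueRelation_shift_first {c e : ℤ → ℂ → ℂ} (h : (c, e) ∈ residueRelation) :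
    ((fun n r => c (n + 1) r, fun n r => e (n + 1) r + e n (r + 1)) :
      (ℤ → ℂ → ℂ) × (ℤ → ℂ → ℂ)) ∈ residueRelation := by
  obtain ⟨h1, ⟨N, hN⟩, k, hk⟩ := h
  refine ⟨fun r => ?_, ⟨N, fun n hn r => ?_⟩, k, fun j hj l r => ?_⟩
  · obtain ⟨a, ha⟩ := h1 r
    exact ⟨a, fun i hi n => ha i hi _⟩
  · change e (n + 1) r + e n (r + 1) = 0
    rw [show e (n + 1) r = 0 from hN _ (by omega) _, show e n (r + 1) = 0 from hN _ hn _, add_zero]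
  · have h2 := hk (j + 1) (by omega) l r
    have hev : ∀ f : ℕ → ℂ, ∀ᶠ i : ℕ in atTop, e (l + i) (f i) = 0 := fun f =>
      eventually_atTop.2 ⟨(N - l).toNat, fun i hi => hN _ (by omega) _⟩
    simp only at h2
    rw [psum_succ j (hev _)] at h2
    have h3 := psum_add j (eventually_succ (hev fun i => ((j + 1 : ℤ) : ℂ) + r - i))
      (hev fun i => ((j + 1 : ℤ) : ℂ) + r - i)
    rw [add_comm (psum j _), ← h3] at h2
    have e1 : ∀ i : ℕ, j + 1 + l - (i : ℤ) = j + l - i + 1 := fun i => by ring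
    have e2 : ∀ i : ℕ, l + ((i + 1 : ℕ) : ℤ) = l + i + 1 := fun i => by push_cast; ring
    have e3 : ∀ i : ℕ, ((j + 1 : ℤ) : ℂ) + r - ((i + 1 : ℕ) : ℂ) = j + r - i := fun i => by
      push_cast; ring
    have e4 : ∀ i : ℕ, ((j + 1 : ℤ) : ℂ) + r - (i : ℂ) = j + r - i + 1 := fun i => by
      push_cast; ring
    simp only [e1, e2, e3, e4] at h2
    exact h2

theorem residueRelation_shift_second {c e : ℤ → ℂ → ℂ} (h : (c, e) ∈ residueRelation) (s : ℂ) :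
    ((fun n r => c n (r + s), fun n r => e n (r + s)) :
      (ℤ → ℂ → ℂ) × (ℤ → ℂ → ℂ)) ∈ residueRelation := by
  obtain ⟨h1, ⟨N, hN⟩, k, hk⟩ := h
  refine ⟨fun r => ?_, ⟨N, fun n hn r => hN n hn _⟩, k, fun j hj l r => ?_⟩
  · obtain ⟨a, ha⟩ := h1 (r + s)
    refine ⟨a, fun i hi n => ?_⟩
    change c n (r + i + s) = 0
    rw [add_right_comm]
    exact ha i hi n
  · have h2 := hk j hj l (r + s)
    have e1 : ∀ i : ℕ, r + s + (i : ℂ) = r + i + s := fun i => by ring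
    have e2 : ∀ i : ℕ, (j : ℂ) + (r + s) - i = j + r - i + s := fun i => by ring
    simp only [e1, e2] at h2
    exact h2

/-- Descending induction on the first index: when all higher modes vanish, only the `i = 0` term
remains in the relation. -/
theorem residueRelation_unique {e : ℤ → ℂ → ℂ} (h : (0, e) ∈ residueRelation) : e = 0 := by
  obtain ⟨-, ⟨N, hN⟩, k, hk⟩ := h
  suffices ∀ n, ∀ r, e n r = 0 by
    funext n r; exact this n r
  intro n
  rcases le_total N n with h | h
  · exact hN n h
  have : ∀ j, n ≤ j → ∀ r, e j r = 0 := by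
    induction n, h using Int.leInductionDown with
    | base => exact hN
    | pred n _ ih =>
      intro j hj r
      rcases hj.eq_or_lt with rfl | hj
      · have h2 := hk k le_rfl (n - 1) (r - k)
        simp only [Pi.zero_apply, bsum_zero_right] at h2
        rw [psum_eq_sum (N := 1) k fun i hi => ih _ (by omega) _] at h2
        simpa using h2.symm
      · exact ih j (by omega) r
  exact this n le_rfl

section LocalSpace

variable {V : Type*} [AddCommGroup V] [Module ℂ V] {A : VertexOperatorAlgebra V}
  {W₃ W₄ : Type*} [AddCommGroup W₃] [Module ℂ W₃] [AddCommGroup W₄] [Module ℂ W₄]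

/-- A space of truncated series which are weakly commuting with the vertex operators and which is
closed under the residue action. -/
structure IsLocalSpace (M₃ : WeakModule A W₃) (M₄ : WeakModule A W₄)
    (W : Submodule ℂ (ℂ → W₃ →ₗ[ℂ] W₄)) : Prop where
  trunc : ∀ Φ ∈ W, TruncatedSeries Φ
  locality : ∀ Φ ∈ W, ∀ a, ∃ k : ℕ, ∀ m n u,
    bracketSum (M₃.mode a) (M₄.mode a) Φ k m n u = 0
  closed : ∀ Φ ∈ W, ∀ a m, ∃ Φ' ∈ W, ∀ n u,
    Φ' n u = residueAction (M₃.mode a) (M₄.mode a) m Φ n u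

namespace IsLocalSpace

variable {M₃ : WeakModule A W₃} {M₄ : WeakModule A W₄} {W : Submodule ℂ (ℂ → W₃ →ₗ[ℂ] W₄)}

/-- The residue action of the modes of `V` on a local space. -/
noncomputable def action (hW : IsLocalSpace M₃ M₄ W) (m : ℤ) : V →ₗ[ℂ] W →ₗ[ℂ] W :=
  have hex : ∀ (a : V) (Φ : W), ∃ Φ' : W, ∀ n u, (Φ' : ℂ → W₃ →ₗ[ℂ] W₄) n u =
      residueAction (M₃.mode a) (M₄.mode a) m (Φ : ℂ → W₃ →ₗ[ℂ] W₄) n u := fun a Φ => by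
    obtain ⟨Φ', h, h'⟩ := hW.closed Φ Φ.2 a m
    exact ⟨⟨Φ', h⟩, h'⟩
  LinearMap.mk₂ ℂ (fun a Φ => (hex a Φ).choose)
    (fun a b Φ => Subtype.ext <| funext fun n => LinearMap.ext fun u => by
      have h3 : M₃.mode (a + b) = M₃.mode a + M₃.mode b := funext (WeakModule.mode_add a b)
      have h4 : M₄.mode (a + b) = M₄.mode a + M₄.mode b := funext (WeakModule.mode_add a b)
      rw [(hex (a + b) Φ).choose_spec, h3, h4, residueAction_add_modes (hW.trunc Φ Φ.2)
        (M₃.truncatedModes a) (M₃.truncatedModes b), ← (hex a Φ).choose_spec,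
        ← (hex b Φ).choose_spec]
      rfl)
    (fun c a Φ => Subtype.ext <| funext fun n => LinearMap.ext fun u => by
      have h3 : M₃.mode (c • a) = c • M₃.mode a := funext fun n => map_smul (M₃.modeₗ n) c a
      have h4 : M₄.mode (c • a) = c • M₄.mode a := funext fun n => map_smul (M₄.modeₗ n) c a
      rw [(hex (c • a) Φ).choose_spec, h3, h4, residueAction_smul_modes (hW.trunc Φ Φ.2)
        (M₃.truncatedModes a), ← (hex a Φ).choose_spec]
      rfl)
    (fun a Φ Φ' => Subtype.ext <| funext fun n => LinearMap.ext fun u => by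
      rw [(hex a (Φ + Φ')).choose_spec, Submodule.coe_add, residueAction_add_series
        (hW.trunc Φ Φ.2) (hW.trunc Φ' Φ'.2) (M₃.truncatedModes a), ← (hex a Φ).choose_spec,
        ← (hex a Φ').choose_spec]
      rfl)
    (fun c a Φ => Subtype.ext <| funext fun n => LinearMap.ext fun u => by
      rw [(hex a (c • Φ)).choose_spec, Submodule.coe_smul, residueAction_smul_series
        (hW.trunc Φ Φ.2) (M₃.truncatedModes a), ← (hex a Φ).choose_spec]
      rfl)

theorem action_apply (hW : IsLocalSpace M₃ M₄ W) (m : ℤ) (a : V) (Φ : W) (n : ℂ) (u : W₃) :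
    (hW.action m a Φ : ℂ → W₃ →ₗ[ℂ] W₄) n u =
      residueAction (M₃.mode a) (M₄.mode a) m (Φ : ℂ → W₃ →ₗ[ℂ] W₄) n u := by
  unfold action
  rw [LinearMap.mk₂_apply]
  obtain ⟨Φ', h, h'⟩ := hW.closed Φ Φ.2 a m
  exact (⟨⟨Φ', h⟩, h'⟩ : ∃ Φ' : W, ∀ n u, (Φ' : ℂ → W₃ →ₗ[ℂ] W₄) n u =
      residueAction (M₃.mode a) (M₄.mode a) m (Φ : ℂ → W₃ →ₗ[ℂ] W₄) n u).choose_spec n u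

theorem action_truncated (hW : IsLocalSpace M₃ M₄ W) (a : V) :
    TruncatedModes fun m => hW.action m a := fun Φ => by
  obtain ⟨k, hk⟩ := hW.locality Φ Φ.2 a
  refine ⟨k, fun m hm => Subtype.ext <| funext fun n => LinearMap.ext fun u => ?_⟩
  rw [action_apply, residueAction_eq_zero_of_le (hW.trunc Φ Φ.2) (M₃.truncatedModes a) hk hm]
  rfl

theorem bracketSum_eq (hW : IsLocalSpace M₃ M₄ W) (a : V) (Φ : W) (l m : ℤ) (n : ℂ) (u : W₃) :
    bracketSum (M₃.mode a) (M₄.mode a) (Φ : ℂ → W₃ →ₗ[ℂ] W₄) l m n u =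
      psum m fun i => (hW.action (l + i) a Φ : ℂ → W₃ →ₗ[ℂ] W₄) (m + n - i) u := by
  obtain ⟨k, hk⟩ := hW.locality Φ Φ.2 a
  simp only [action_apply]
  exact bracketSum_eq_of_locality (hW.trunc Φ Φ.2) (M₃.truncatedModes a) hk l m n u

/-- This is the Jacobi identity with middle index so large that the modes of `b` kill `u`, so the
reversed product drops out. -/
theorem residueRelation_mem (hW : IsLocalSpace M₃ M₄ W) (φ : Module.Dual ℂ W₄) (b : V) (Φ : W)
    (u : W₃) : ((fun n r => φ (M₄.mode b n ((Φ : ℂ → W₃ →ₗ[ℂ] W₄) r u)),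
      fun n r => φ ((hW.action n b Φ : ℂ → W₃ →ₗ[ℂ] W₄) r u)) :
        (ℤ → ℂ → ℂ) × (ℤ → ℂ → ℂ)) ∈ residueRelation := by
  obtain ⟨N, hN⟩ := hW.action_truncated b Φ
  obtain ⟨k, hk⟩ := M₃.truncatedModes b u
  refine ⟨fun r => ?_, ⟨N, fun n hn r => ?_⟩, k, fun j hj l r => ?_⟩
  · obtain ⟨a, ha⟩ := eventually_atTop.1 ((hW.trunc Φ Φ.2).eventually r u)
    refine ⟨a, fun i hi n => ?_⟩
    change φ (M₄.mode b n ((Φ : ℂ → W₃ →ₗ[ℂ] W₄) (r + i) u)) = 0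
    rw [ha i hi, map_zero, map_zero]
  · change φ ((hW.action n b Φ : ℂ → W₃ →ₗ[ℂ] W₄) r u) = 0
    rw [show hW.action n b Φ = 0 from hN n hn]
    simp
  · have h1 := congrArg φ (hW.bracketSum_eq b Φ l j r u)
    rw [map_psum φ j, bracketSum, map_bsum φ l] at h1
    · refine Eq.trans ?_ h1
      congr 1
      funext i
      rw [hk (j + i) (by omega), map_zero, smul_zero, sub_zero]
    · filter_upwards [(hW.trunc Φ Φ.2).eventually r u] with i hi
      rw [hi, hk (j + i) (by omega)]
      simp
    · refine eventually_atTop.2 ⟨(N - l).toNat, fun i hi => ?_⟩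
      rw [show hW.action (l + i) b Φ = 0 from hN _ (by omega)]
      simp

/-- The composition of the vertex operators of `M₄` with the series in a local space, for the modes
of `a`. -/
noncomputable def system (hW : IsLocalSpace M₃ M₄ W) (hM₄ : M₄.IsGraded) (a : V) :
    AssociativitySystem ℤ V W W₃ W₄ W₄ where
  α₁ := A.adjoint.mode a
  α₂ m := hW.action m a
  α₃ := M₃.mode a
  α₄ := M₄.mode a
  α₅ := M₄.mode a
  trunc₁ := A.adjoint.truncatedModes a
  trunc₂ := hW.action_truncated a
  trunc₃ := M₃.truncatedModes a
  trunc₅ := M₄.truncatedModes a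
  I₁ := M₄.modeₗ
  I₂ n := LinearMap.proj n ∘ₗ W.subtype
  I₁_trunc b β u := by
    obtain ⟨N, hN⟩ := M₄.truncatedModes b u
    exact ⟨N - β, fun k hk => hN _ (by simp only [Int.cast_id]; omega)⟩
  I₂_trunc Φ := hW.trunc Φ Φ.2
  jacobi₁ b := M₄.jacobi_eq a b
  jacobi₂ Φ := hW.bracketSum_eq a Φ
  ψ n := (LinearMap.compRight ℂ W.subtype) ∘ₗ hW.action n
  ψ_trunc b Φ β := by
    obtain ⟨N, hN⟩ := hW.action_truncated b Φ
    refine ⟨N - β, fun k hk => ?_⟩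
    change W.subtype (hW.action (β + (k : ℤ)) b Φ) = 0
    rw [show hW.action (β + (k : ℤ)) b Φ = 0 from hN _ (by omega), map_zero]
  ψ_trunc' n b Φ := hW.trunc _ (hW.action n b Φ).2
  F := {φ | M₄.InRestrictedDual φ}
  F_comp φ hφ m := (WeakModule.restrictedDual_mode hM₄ hφ a).1 m
  F_trunc φ hφ := (WeakModule.restrictedDual_mode hM₄ hφ a).2
  F_sep v hv := WeakModule.eq_zero_of_restrictedDual hM₄ hv
  R := residueRelation
  R_shift₁ c e h := residueRelation_shift_first h
  R_shift₂ c e h k := residueRelation_shift_second h k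
  R_unique e h := residueRelation_unique h
  rel φ _ b Φ u := hW.residueRelation_mem φ b Φ u

/-- The Jacobi identity for the iterate in the integer-mode system, read after evaluating the series
at a mode and a vector. -/
theorem action_jacobi (hW : IsLocalSpace M₃ M₄ W) (hM₄ : M₄.IsGraded) (a b : V) (Φ : W)
    (l m n : ℤ) : bracketSum (fun m => hW.action m a) (fun m => hW.action m a)
      (fun n => hW.action n b) l m n Φ =
      psum m fun i => hW.action (m + n - i) (A.adjoint.mode a (l + i) b) Φ := by
  refine Subtype.ext <| funext fun r => LinearMap.ext fun u => ?_
  let ev : W →ₗ[ℂ] W₄ := LinearMap.applyₗ u ∘ₗ LinearMap.proj r ∘ₗ W.subtype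
  change ev _ = ev _
  rw [bracketSum, map_bsum ev, map_psum ev]
  · have h := sub_eq_zero.1 ((hW.system hM₄ a).iterDefect_eq_zero (fun n b Φ => by
      obtain ⟨k, hk⟩ := hW.locality _ (hW.action n b Φ).2 a
      exact ⟨k, hk⟩) b Φ r u l m n)
    refine Eq.trans ?_ h
    congr 1
    funext i
    rw [map_sub, map_zsmul]
    congr 1
    exact hW.action_apply _ _ _ _ _
  · filter_upwards [(A.adjoint.truncatedModes a).eventually l b] with i hi
    rw [hi, map_zero, LinearMap.zero_apply]
  · filter_upwards [(hW.action_truncated b).eventually n Φ,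
      (hW.action_truncated a).eventually m Φ] with i h1 h2
    have h1' : hW.action (n + (i : ℤ)) b Φ = 0 := h1
    have h2' : hW.action (m + (i : ℤ)) a Φ = 0 := h2
    rw [h1', h2', map_zero, map_zero, smul_zero, sub_zero]

theorem bddBelow_action (hW : IsLocalSpace M₃ M₄ W) (a : V) (Φ : W) :
    BddBelow (Function.support fun k : ℤ => hW.action (-k - 1) a Φ) := by
  obtain ⟨N, hN⟩ := hW.action_truncated a Φ
  refine ⟨-N, fun k hk => ?_⟩
  by_contra hlt
  exact hk (hN _ (by omega))

/-- A local space is a weak module under the residue action. -/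
noncomputable def weakModule (hW : IsLocalSpace M₃ M₄ W) (hM₄ : M₄.IsGraded) : WeakModule A W :=
  let Y : V →ₗ[ℂ] VertexOperator ℂ W :=
    -- Coefficients are indexed by the exponent of the variable, which is `-n - 1` for the mode `n`.
    { toFun := fun a => VertexOperator.of_coeff (fun k => hW.action (-k - 1) a)
        (hW.bddBelow_action a)
      map_add' := fun a b => HVertexOperator.coeff_inj <| funext fun k =>
        map_add (hW.action (-k - 1)) a b
      map_smul' := fun c a => HVertexOperator.coeff_inj <| funext fun k =>
        map_smul (hW.action (-k - 1)) c a }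
  have hY : ∀ a n, VertexOperator.ncoeff (Y a) n = hW.action n a := fun a n => by
    refine (VertexOperator.ncoeff_of_coeff _ (hW.bddBelow_action a) n).trans ?_
    ring_nf
  { Y := Y
    vacuum_mode := fun n => by
      rw [hY]
      refine LinearMap.ext fun Φ => Subtype.ext <| funext fun r => LinearMap.ext fun u => ?_
      have h3 : M₃.mode A.vacuum = fun k => if k = -1 then 1 else 0 := funext M₃.vacuum_mode
      have h4 : M₄.mode A.vacuum = fun k => if k = -1 then 1 else 0 := funext M₄.vacuum_mode
      rw [action_apply, h3, h4, residueAction_identity]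
      split_ifs <;> rfl
    derivative := fun a n => by
      rw [hY, hY]
      refine LinearMap.ext fun Φ => Subtype.ext <| funext fun r => LinearMap.ext fun u => ?_
      have h3 : M₃.mode (A.adjoint.L (-1) a) = fun k : ℤ => (-(k : ℂ)) • M₃.mode a (k - 1) :=
        funext (M₃.mode_derivative a)
      have h4 : M₄.mode (A.adjoint.L (-1) a) = fun k : ℤ => (-(k : ℂ)) • M₄.mode a (k - 1) :=
        funext (M₄.mode_derivative a)
      refine (hW.action_apply n (A.adjoint.L (-1) a) Φ r u).trans ?_
      rw [h3, h4, residueAction_derivative (hW.trunc Φ Φ.2) (M₃.truncatedModes a),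
        ← action_apply hW]
      rfl
    jacobi := fun a b Φ l m n => by
      simp only [hY]
      exact hW.action_jacobi hM₄ a b Φ l m n }

theorem weakModule_mode (hW : IsLocalSpace M₃ M₄ W) (hM₄ : M₄.IsGraded) (a : V) (n : ℤ) :
    (hW.weakModule hM₄).mode a n = hW.action n a := by
  have h := VertexOperator.ncoeff_of_coeff (fun k => hW.action (-k - 1) a)
    (hW.bddBelow_action a) n
  have e : -(-n - 1) - 1 = n := by ring
  simp only [e] at h
  exact h

end IsLocalSpace

end LocalSpace

end VertexAssoc

/-! ### The module `W` and its two intertwining operators. -/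

namespace VertexAssoc

set_option linter.unusedSectionVars false

open Filter

section Assembly

variable {V : Type*} [AddCommGroup V] [Module ℂ V] {A : VertexOperatorAlgebra V}
  {W₁ W₂ W₃ W₄ W₅ : Type*} [AddCommGroup W₁] [Module ℂ W₁]
  [AddCommGroup W₂] [Module ℂ W₂] [AddCommGroup W₃] [Module ℂ W₃] [AddCommGroup W₄] [Module ℂ W₄]
  [AddCommGroup W₅] [Module ℂ W₅]
  {M₁ : WeakModule A W₁} {M₂ : WeakModule A W₂} {M₃ : WeakModule A W₃}
  {M₄ : WeakModule A W₄} {M₅ : WeakModule A W₅}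
  {Y₁ : IntertwiningOperator M₁ M₅ M₄} {Y₂ : IntertwiningOperator M₂ M₃ M₅}

theorem bracketSum_add {Φ Φ' : ℂ → W₃ →ₗ[ℂ] W₄} (hΦ : TruncatedSeries Φ)
    (hΦ' : TruncatedSeries Φ') (a : V) (l m : ℤ) (n : ℂ) (u : W₃) :
    bracketSum (M₃.mode a) (M₄.mode a) (Φ + Φ') l m n u =
      bracketSum (M₃.mode a) (M₄.mode a) Φ l m n u +
      bracketSum (M₃.mode a) (M₄.mode a) Φ' l m n u := by
  have hev : ∀ {Φ : ℂ → W₃ →ₗ[ℂ] W₄}, TruncatedSeries Φ → ∀ᶠ i : ℕ in atTop,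
      M₄.mode a (m + l - i) (Φ (n + (i : ℂ)) u)
        - (l.negOnePow : ℤ) • Φ (n + (l : ℂ) - (i : ℂ)) (M₃.mode a (m + i) u) = 0 := fun h => by
    filter_upwards [h.eventually n u, (M₃.truncatedModes a).eventually m u] with i h1 h2
    rw [h1, h2]; simp
  unfold bracketSum
  rw [← bsum_add _ (hev hΦ) (hev hΦ')]
  congr 1
  funext i
  simp only [Pi.add_apply, LinearMap.add_apply, map_add, smul_add]
  abel

theorem bracketSum_smul {Φ : ℂ → W₃ →ₗ[ℂ] W₄} (hΦ : TruncatedSeries Φ) (c : ℂ) (a : V) (l m : ℤ)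
    (n : ℂ) (u : W₃) : bracketSum (M₃.mode a) (M₄.mode a) (c • Φ) l m n u =
      c • bracketSum (M₃.mode a) (M₄.mode a) Φ l m n u := by
  unfold bracketSum
  rw [← bsum_smul]
  · congr 1
    funext i
    simp only [Pi.smul_apply, LinearMap.smul_apply, map_smul, smul_sub]
    rw [smul_comm c]
  · filter_upwards [hΦ.eventually n u, (M₃.truncatedModes a).eventually m u] with i h1 h2
    rw [h1, h2]; simp

variable (M₃ M₄) in
/-- The space of generalized left intertwining operators. -/
def generalizedLeft : Submodule ℂ (ℂ → W₃ →ₗ[ℂ] W₄) where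
  carrier := {Φ | IsGeneralizedLeft M₃ M₄ Φ}
  zero_mem' := isGeneralizedLeft_iff.2 ⟨fun _ _ => ⟨0, fun _ _ => rfl⟩, fun n u => by simp,
    fun a => ⟨0, fun m n u => by simp [bracketSum]⟩⟩
  add_mem' := by
    intro Φ Φ' h h'
    have hΦ : TruncatedSeries Φ := h.1
    have hΦ' : TruncatedSeries Φ' := h'.1
    refine isGeneralizedLeft_iff.2 ⟨fun β u => ?_, fun n u => ?_, fun a => ?_⟩
    · obtain ⟨N, hN⟩ := hΦ β u
      obtain ⟨N', hN'⟩ := hΦ' β u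
      refine ⟨max N N', fun k hk => ?_⟩
      rw [Pi.add_apply, LinearMap.add_apply, hN k ((le_max_left _ _).trans hk),
        hN' k ((le_max_right _ _).trans hk), add_zero]
    · have h1 := h.2.1 n u
      have h2 := h'.2.1 n u
      simp only [Pi.add_apply, LinearMap.add_apply, map_add, smul_add]
      rw [← h1, ← h2]
      abel
    · obtain ⟨k, hk⟩ := h.locality a
      obtain ⟨k', hk'⟩ := h'.locality a
      refine ⟨max k k', fun m n u => ?_⟩
      rw [bracketSum_add hΦ hΦ',
        bracketSum_eq_zero_of_le hΦ (M₃.truncatedModes a) hk (by exact_mod_cast le_max_left k k'),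
        bracketSum_eq_zero_of_le hΦ' (M₃.truncatedModes a) hk'
          (by exact_mod_cast le_max_right k k'), add_zero]
  smul_mem' := by
    intro c Φ h
    have hΦ : TruncatedSeries Φ := h.1
    refine isGeneralizedLeft_iff.2 ⟨fun β u => ?_, fun n u => ?_, fun a => ?_⟩
    · obtain ⟨N, hN⟩ := hΦ β u
      exact ⟨N, fun k hk => by rw [Pi.smul_apply, LinearMap.smul_apply, hN k hk, smul_zero]⟩
    · simp only [Pi.smul_apply, LinearMap.smul_apply, map_smul]
      rw [← smul_sub, h.2.1 n u, smul_comm]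
    · obtain ⟨k, hk⟩ := h.locality a
      exact ⟨k, fun m n u => by rw [bracketSum_smul hΦ, hk, smul_zero]⟩

namespace IterateModes

variable (P : IterateModes Y₁ Y₂)

theorem psiSpan_le_generalizedLeft (P : IterateModes Y₁ Y₂) (hM₁ : M₁.IsGraded)
    (hM₂ : M₂.IsGraded) (hM₃ : M₃.IsGraded) (hM₄ : M₄.IsGraded) :
    psiSpan Y₁ Y₂ ≤ generalizedLeft M₃ M₄ := by
  rw [P.psiSpan_eq hM₄, Submodule.span_le]
  rintro _ ⟨w₁, w₂, n, rfl⟩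
  exact P.isGeneralizedLeft hM₄ hM₁ hM₂ hM₃ n w₁ w₂

theorem isLocalSpace (P : IterateModes Y₁ Y₂) (hM₁ : M₁.IsGraded)
    (hM₂ : M₂.IsGraded) (hM₃ : M₃.IsGraded) (hM₄ : M₄.IsGraded) :
    IsLocalSpace M₃ M₄ (psiSpan Y₁ Y₂) := by
  have hle := P.psiSpan_le_generalizedLeft hM₁ hM₂ hM₃ hM₄
  refine ⟨fun Φ hΦ => (hle hΦ).1, fun Φ hΦ => (hle hΦ).locality, fun Φ hΦ a m => ?_⟩
  have hspan := P.psiSpan_eq hM₄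
  have hΦ' : Φ ∈ Submodule.span ℂ {Φ | ∃ w₁ w₂ n, Φ = P.ψ n w₁ w₂} := hspan ▸ hΦ
  clear hΦ
  induction hΦ' using Submodule.span_induction with
  | mem Φ h =>
    obtain ⟨w₁, w₂, n, rfl⟩ := h
    obtain ⟨N, hN⟩ := eventually_atTop.1 ((M₁.truncatedModes a).eventually' w₁)
    -- The commutator formula exhibits the action on a generator as a finite combination of
    -- generators.
    refine ⟨P.ψ n w₁ (M₂.mode a m w₂) + ∑ i ∈ Finset.range N, Ring.choose m i •
      P.ψ (n + ((m - i : ℤ) : ℂ)) (M₁.mode a i w₁) w₂, add_mem (P.ψ_mem _ _ _)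
        (sum_mem fun i _ => zsmul_mem (P.ψ_mem _ _ _) _), fun r u => ?_⟩
    rw [P.residueAction_eq hM₄, psum_eq_sum (N := N) _ fun i hi => by rw [hN i hi]; simp]
    simp [Finset.sum_apply]
  | zero =>
    exact ⟨0, zero_mem _, fun n u => by simp [residueAction]⟩
  | add Φ Φ' hΦ hΦ' h h' =>
    obtain ⟨χ, hχ, h⟩ := h
    obtain ⟨χ', hχ', h'⟩ := h'
    rw [← hspan] at hΦ hΦ'
    refine ⟨χ + χ', add_mem hχ hχ', fun n u => ?_⟩
    rw [residueAction_add_series (hle hΦ).1 (hle hΦ').1 (M₃.truncatedModes a), ← h, ← h']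
    rfl
  | smul c Φ hΦ h =>
    obtain ⟨χ, hχ, h⟩ := h
    rw [← hspan] at hΦ
    refine ⟨c • χ, Submodule.smul_mem _ c hχ, fun n u => ?_⟩
    rw [residueAction_smul_series (hle hΦ).1 (M₃.truncatedModes a), ← h]
    rfl

end IterateModes

/-- Evaluation of the series in a local space of generalized left intertwining operators. -/
noncomputable def evaluation {W : Submodule ℂ (ℂ → W₃ →ₗ[ℂ] W₄)} (hW : IsLocalSpace M₃ M₄ W)
    (hM₄ : M₄.IsGraded) (hle : W ≤ generalizedLeft M₃ M₄) :
    IntertwiningOperator (hW.weakModule hM₄) M₃ M₄ where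
  modes n := LinearMap.proj n ∘ₗ W.subtype
  truncation Φ u α := hW.trunc Φ Φ.2 α u
  derivative n Φ := by
    refine LinearMap.ext fun u => ?_
    change ((hW.weakModule hM₄).mode A.omega 0 Φ : ℂ → W₃ →ₗ[ℂ] W₄) n u =
      (-n) • (Φ : ℂ → W₃ →ₗ[ℂ] W₄) (n - 1) u
    -- The residue action of `ω_0` is the commutator with `L(-1)`, which is the derivative by the
    -- definition of a generalized left operator.
    rw [hW.weakModule_mode, hW.action_apply, ← (hle Φ.2).2.1 n u]
    simp only [residueAction, bsum_zero_left]
    simp only [Int.negOnePow_zero, Units.val_one, one_smul, Nat.cast_zero, add_zero,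
      sub_zero, Int.cast_zero]
    rfl
  jacobi a Φ u l m n := by
    refine (hW.bracketSum_eq a Φ l m n u).trans ?_
    congr 1
    funext i
    have := LinearMap.congr_fun (hW.weakModule_mode hM₄ a (l + i)) Φ
    rw [← this]
    rfl

/-- The intertwining operator given by the modes of the iterate. -/
noncomputable def IterateModes.intertwining (P : IterateModes Y₁ Y₂) (hM₄ : M₄.IsGraded)
    (hW : IsLocalSpace M₃ M₄ (psiSpan Y₁ Y₂)) :
    IntertwiningOperator M₁ M₂ (hW.weakModule hM₄) where
  modes n := LinearMap.mk₂ ℂ (fun w₁ w₂ => ⟨P.ψ n w₁ w₂, P.ψ_mem n w₁ w₂⟩)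
    (fun w₁ w₁' w₂ => Subtype.ext (by simp)) (fun c w₁ w₂ => Subtype.ext (by simp))
    (fun w₁ w₂ w₂' => Subtype.ext (by simp)) (fun c w₁ w₂ => Subtype.ext (by simp))
  truncation w₁ w₂ α := by
    obtain ⟨N, hN⟩ := P.trunc_coset w₁ w₂ α
    exact ⟨N, fun k hk => Subtype.ext (hN k hk)⟩
  derivative n w₁ := LinearMap.ext fun w₂ => Subtype.ext (P.L_neg_one_left hM₄ n w₁ w₂)
  jacobi a w₁ w₂ l m n := by
    refine Subtype.ext <| funext fun r => LinearMap.ext fun u => ?_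
    let ev : psiSpan Y₁ Y₂ →ₗ[ℂ] W₄ := LinearMap.applyₗ u ∘ₗ LinearMap.proj r ∘ₗ
      (psiSpan Y₁ Y₂).subtype
    change ev (bsum l _) = ev (psum m _)
    rw [map_bsum ev, map_psum ev]
    · refine Eq.trans ?_ (P.jacobi hM₄ a w₁ w₂ r u l m n)
      congr 1
      funext i
      rw [map_sub, map_zsmul]
      congr 1
      have := LinearMap.congr_fun (hW.weakModule_mode hM₄ a (m + l - i))
        ⟨P.ψ (n + i) w₁ w₂, P.ψ_mem _ w₁ w₂⟩
      exact (congrArg ev this).trans (hW.action_apply _ _ _ _ _)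
    · filter_upwards [(M₁.truncatedModes a).eventually l w₁] with i hi
      have hi' : VertexOperator.ncoeff (M₁.Y a) (l + i) w₁ = 0 := hi
      rw [hi', map_zero, LinearMap.zero_apply]
    · obtain ⟨N, hN⟩ := P.trunc_coset w₁ w₂ n
      filter_upwards [eventually_ge_atTop N.toNat, (M₂.truncatedModes a).eventually m w₂]
        with i h1 h2
      have h1' := hN i (by omega)
      rw [Int.cast_natCast] at h1'
      have h2' : VertexOperator.ncoeff (M₂.Y a) (m + i) w₂ = 0 := h2
      have h3 : LinearMap.mk₂ ℂ (fun w₁ w₂ => (⟨P.ψ (n + i) w₁ w₂, P.ψ_mem (n + i) w₁ w₂⟩ :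
          psiSpan Y₁ Y₂)) (fun w₁ w₁' w₂ => Subtype.ext (by simp))
          (fun c w₁ w₂ => Subtype.ext (by simp)) (fun w₁ w₂ w₂' => Subtype.ext (by simp))
          (fun c w₁ w₂ => Subtype.ext (by simp)) w₁ w₂ = 0 := Subtype.ext h1'
      rw [h3, h2', map_zero, map_zero, smul_zero, sub_zero]

end Assembly

end VertexAssoc

theorem theorem3p9 {V W₁ W₂ W₃ W₄ W₅ : Type*} [AddCommGroup V] [Module ℂ V]
    [AddCommGroup W₁] [Module ℂ W₁] [AddCommGroup W₂] [Module ℂ W₂] [AddCommGroup W₃] [Module ℂ W₃]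
    [AddCommGroup W₄] [Module ℂ W₄] [AddCommGroup W₅] [Module ℂ W₅]
    (A : VertexOperatorAlgebra V)
    (M₁ : WeakModule A W₁) (M₂ : WeakModule A W₂) (M₃ : WeakModule A W₃) (M₄ : WeakModule A W₄)
    (M₅ : WeakModule A W₅)
    (hD : (M₁.IsOrdinary ∧ M₂.IsOrdinary ∧ M₃.IsOrdinary ∧ M₄.IsOrdinary) ∨
      (M₁.IsC1 ∧ M₂.IsC1 ∧ M₃.IsC1 ∧ M₄.IsC1))
    (Y₁ : IntertwiningOperator M₁ M₅ M₄) (Y₂ : IntertwiningOperator M₂ M₃ M₅)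
    (hconv : ConvergenceExtension Y₁ Y₂) :
    psiSpan Y₁ Y₂ ≤ homogeneousGeneralizedLeft M₃ M₄ ∧
    ∃ (M : WeakModule A (psiSpan Y₁ Y₂)) (Y₃ : IntertwiningOperator M₁ M₂ M)
      (Y₄ : IntertwiningOperator M M₃ M₄),
      (∀ (a : V) (m : ℤ) (Φ : psiSpan Y₁ Y₂) (n : ℂ) (u : W₃),
        (M.mode a m Φ : ℂ → W₃ →ₗ[ℂ] W₄) n u = leftAction M₃ M₄ a m (Φ : ℂ → W₃ →ₗ[ℂ] W₄) n u) ∧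
      (∀ (Φ : psiSpan Y₁ Y₂) (n : ℂ) (u : W₃),
        Y₄.modes n Φ u = (Φ : ℂ → W₃ →ₗ[ℂ] W₄) n u) ∧
      (∀ (w₁ : W₁) (w₂ : W₂) (n : ℂ),
        IsPsi Y₁ Y₂ w₁ w₂ n (Y₃.modes n w₁ w₂ : ℂ → W₃ →ₗ[ℂ] W₄)) ∧
      ∀ (w₁ : W₁) (w₂ : W₂) (w₃ : W₃) (φ : Module.Dual ℂ W₄), M₄.InRestrictedDual φ →
        HasExtension (productSeries Y₁ Y₂ φ w₁ w₂ w₃) (iterateSeries Y₃ Y₄ φ w₁ w₂ w₃) ∧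
        E12 (productSeries Y₁ Y₂ φ w₁ w₂ w₃) = iterateSeries Y₃ Y₄ φ w₁ w₂ w₃ := by
  -- The argument needs only what the two categories share: a sum of generalized weight spaces,
  -- vanishing far down in each coset of `ℤ`.
  have hg : M₁.IsGraded ∧ M₂.IsGraded ∧ M₃.IsGraded ∧ M₄.IsGraded := by
    rcases hD with ⟨h₁, h₂, h₃, h₄⟩ | ⟨h₁, h₂, h₃, h₄⟩
    · exact ⟨h₁.isGraded, h₂.isGraded, h₃.isGraded, h₄.isGraded⟩
    · exact ⟨h₁.isGraded, h₂.isGraded, h₃.isGraded, h₄.isGraded⟩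
  obtain ⟨h₁, h₂, h₃, h₄⟩ := hg
  obtain ⟨P⟩ := exists_iterateModes h₁ h₂ h₃ h₄ hconv
  have hW := P.isLocalSpace h₁ h₂ h₃ h₄
  refine ⟨P.psiSpan_le h₄ h₁ h₂ h₃, hW.weakModule h₄, P.intertwining h₄ hW,
    evaluation hW h₄ (P.psiSpan_le_generalizedLeft h₁ h₂ h₃ h₄), fun a m Φ n u => ?_,
    fun _ _ _ => rfl, fun w₁ w₂ n => P.isPsi w₁ w₂ n, fun w₁ w₂ w₃ φ hφ => ?_⟩
  · rw [hW.weakModule_mode, hW.action_apply]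
    rfl
  · have h : HasExtension (productSeries Y₁ Y₂ φ w₁ w₂ w₃) (iterateSeries (P.intertwining h₄ hW)
        (evaluation hW h₄ (P.psiSpan_le_generalizedLeft h₁ h₂ h₃ h₄)) φ w₁ w₂ w₃) :=
      P.hasExtension w₁ w₂ w₃ φ hφ
    exact ⟨h, h.E12_eq⟩
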